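/- Let $K$ be an algebraically closed field, $p\ge q\ge 0$ integers, $n=p+q$, $V=K^n$, and let $x=1+N\in SL_n(K)$ be unipotent of type $(p,q)$, i.e. $V$ has a basis $e_{1,1},\dots,e_{p,1},e_{1,2},\dots,e_{q,2}$ adapted to $x$: $N e_{i,j}=e_{i-1,j}$ with $e_{0,j}=0$. Fix such a basis. Let $\mathbb F_x$ be the Springer fiber, the variety of complete flags $F_1\subset\dots\subset F_n=V$, $\dim F_i=i$, with $xF_i\subseteq F_i$ for all $i$; it is a closed subvariety of $Gr(1,n)\times\dots\times Gr(n,n)$. A standard tableau $\sigma$ of type $(p,q)$ is a filling, by $1,\dots,n$ (each used once), of a left column of $p$ boxes and a right column of $q$ boxes, aligned at the top, with entries strictly decreasing from top to bottom and from left to right. Let $\psi(k)=1$ if $k$ is in the left column and $\psi(k)=2$ if it is in the right column. The stratum $X_\sigma=X_{\psi(n)\cdots\psi(1)}(V)$ consists of the flags obtained inductively as follows. If $\psi(1)=1$, then $F_1=\langle e_{1,1}\rangle$, and $V/F_1$ is given the adapted basis of classes of $e_{i+1,1}$ $(1\le i\le p-1)$ and $e_{i,2}$ $(1\le i\le q)$.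 If $\psi(1)=2$, then $F_1=\langle a e_{1,1}+e_{1,2}\rangle$ for some $a\in K$, and $V/F_1$ is given the adapted basis of classes of $e_{i,1}$ $(1\le i\le p)$ and $a e_{i+1,1}+e_{i+1,2}$ $(1\le i\le q-1)$. In both cases the flag $F_2/F_1\subset\dots\subset F_n/F_1$ is required to lie in $X_{\psi(n)\cdots\psi(2)}(V/F_1)$, defined in the same way with respect to this basis. Let $Y_\sigma$ be the Zariski closure of $X_\sigma$. For $0\le r\le n$ let $Y_\sigma(r)$ be the image of $Y_\sigma$ in $Gr(1,n)\times\dots\times Gr(r,n)$ (a point for $r=0$), with its induced structure of variety, and for $1\le r\le n$ let $f_r:Y_\sigma(r)\to Y_\sigma(r-1)$ be the natural projection. Theorem. $Y_\sigma$ is an irreducible component of $\mathbb F_x$, and for every $1\le r\le n$: (a) if $r$ lies in the left column of $\sigma$, then for every $z\in Y_\sigma(r-1)$ the fiber $f_r^{-1}(z)$ is a single point, and $f_r$ is an isomorphism of varieties; (b) if $r$ lies in the right column of $\sigma$, then for every $z\in Y_\sigma(r-1)$ the fiber $f_r^{-1}(z)$ is isomorphic to $\mathbb P^1$ as a variety,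 and $f_r$ is a $\mathbb P^1$-bundle: every point of $Y_\sigma(r-1)$ has a Zariski open neighbourhood $U$ with an isomorphism $f_r^{-1}(U)\cong U\times\mathbb P^1$ over $U$. -/

import Mathlib

/-! ### Classical varieties: Zariski topology, regular functions, morphisms

All varieties occurring here are subsets of products of Grassmannians and projective lines over an
algebraically closed field `K`.  Such a set is the set of orbits of a (saturated) set of
coordinate vectors in an affine space: nonzero vectors modulo scaling for a projective space,
bases modulo change of basis for a Grassmannian. -/

/-- A set `X` with homogeneous coordinates: `Coord a x` says that the vector `a`, in the affine
space with coordinates indexed by `Idx`, is a system of homogeneous coordinates of the point `x`. -/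
class HomCoords (K : Type*) [Field K] (X : Type*) where
  Idx : Type
  finite : Finite Idx
  Coord : (Idx → K) → X → Prop
  exists_coord : ∀ x, ∃ a, Coord a x
  coord_unique : ∀ a x y, Coord a x → Coord a y → x = y

namespace HomCoords

/-- The projective space of lines in `K ^ m`, with its usual homogeneous coordinates. -/
instance instProjectivization (K : Type*) [Field K] (m : ℕ) :
    HomCoords K (Projectivization K (Fin m → K)) where
  Idx := Fin m
  finite := inferInstance
  Coord a x := ∃ h : a ≠ 0, Projectivization.mk K a h = x
  exists_coord x := ⟨x.rep, x.rep_nonzero, x.mk_rep⟩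
  coord_unique := by
    rintro a x y ⟨h, rfl⟩ ⟨h', rfl⟩
    rfl

/-- A subset is described by the coordinates of its points in the ambient set. -/
instance instSubtype (K : Type*) [Field K] (X : Type*) [HomCoords K X] (P : X → Prop) :
    HomCoords K {x : X // P x} where
  Idx := Idx K X
  finite := finite
  Coord a x := Coord a x.1
  exists_coord x := exists_coord x.1
  coord_unique a x y hx hy := Subtype.ext (coord_unique a x.1 y.1 hx hy)

/-- Products. -/
instance instProd (K : Type*) [Field K] (X Y : Type*) [HomCoords K X] [HomCoords K Y] :
    HomCoords K (X × Y) where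
  Idx := Idx K X ⊕ Idx K Y
  finite := by
    have : Finite (Idx K X) := finite
    have : Finite (Idx K Y) := finite
    infer_instance
  Coord a z := Coord (fun i => a (Sum.inl i)) z.1 ∧ Coord (fun j => a (Sum.inr j)) z.2
  exists_coord z := by
    obtain ⟨a, ha⟩ := exists_coord (K := K) z.1
    obtain ⟨b, hb⟩ := exists_coord (K := K) z.2
    exact ⟨Sum.elim a b, ha, hb⟩
  coord_unique a z w hz hw :=
    Prod.ext (coord_unique _ _ _ hz.1 hw.1) (coord_unique _ _ _ hz.2 hw.2)

/-- Finite products of a family. -/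
instance instPi (K : Type*) [Field K] {ι : Type} [Finite ι] (X : ι → Type*)
    [∀ i, HomCoords K (X i)] : HomCoords K (∀ i, X i) where
  Idx := Σ i, Idx K (X i)
  finite := by
    have : ∀ i, Finite (Idx K (X i)) := fun i => finite
    infer_instance
  Coord a x := ∀ i, Coord (fun j => a ⟨i, j⟩) (x i)
  exists_coord x := by
    choose a ha using fun i => exists_coord (K := K) (x i)
    exact ⟨fun s => a s.1 s.2, ha⟩
  coord_unique a x y hx hy := funext fun i => coord_unique _ _ _ (hx i) (hy i)

end HomCoords

open HomCoords in
/-- The Zariski topology: the quotient of the Zariski topology on coordinate vectors.  A set `U` is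
open iff the set of coordinate vectors of its points is, within the set of all coordinate vectors of
points of `X`, a union of principal open sets `h ≠ 0` with `h` a polynomial. -/
@[reducible]
def zariski (K : Type*) [Field K] (X : Type*) [HomCoords K X] : TopologicalSpace X where
  IsOpen U := ∀ x ∈ U, ∀ a : Idx K X → K, Coord a x →
    ∃ h : MvPolynomial (Idx K X) K, MvPolynomial.eval a h ≠ 0 ∧
      ∀ (y : X) (b : Idx K X → K), Coord b y → MvPolynomial.eval b h ≠ 0 → y ∈ U
  isOpen_univ := fun _ _ _ _ => ⟨1, by simp, fun _ _ _ _ => trivial⟩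
  isOpen_inter := by
    intro U V hU hV x hx a ha
    obtain ⟨g, hg, hgU⟩ := hU x hx.1 a ha
    obtain ⟨h, hh, hhV⟩ := hV x hx.2 a ha
    refine ⟨g * h, by simp [hg, hh], fun y b hb hne => ?_⟩
    rw [map_mul] at hne
    exact ⟨hgU y b hb (left_ne_zero_of_mul hne), hhV y b hb (right_ne_zero_of_mul hne)⟩
  isOpen_sUnion := by
    intro S hS x hx a ha
    obtain ⟨U, hU, hxU⟩ := hx
    obtain ⟨h, hh, hhU⟩ := hS U hU x hxU a ha
    exact ⟨h, hh, fun y b hb hne => ⟨U, hU, hhU y b hb hne⟩⟩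

open HomCoords in
/-- `f` is a regular function on the open set `U`: as a function of the coordinate vectors of the
points of `U` it is, locally, a quotient of polynomials. The values of `f` off `U` are irrelevant. -/
def IsRegularOn (K : Type*) [Field K] {X : Type*} [HomCoords K X] (U : Set X) (f : X → K) : Prop :=
  ∀ x ∈ U, ∀ a : Idx K X → K, Coord a x →
    ∃ g h : MvPolynomial (Idx K X) K, MvPolynomial.eval a h ≠ 0 ∧
      ∀ y ∈ U, ∀ b : Idx K X → K, Coord b y → MvPolynomial.eval b h ≠ 0 →
        f y = MvPolynomial.eval b g / MvPolynomial.eval b h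

/-- Morphisms of varieties: Zariski continuous maps which pull regular functions on open sets back
to regular functions. -/
def IsMorphism (K : Type*) [Field K] {X Y : Type*} [HomCoords K X] [HomCoords K Y]
    (φ : X → Y) : Prop :=
  @Continuous X Y (zariski K X) (zariski K Y) φ ∧
    ∀ (V : Set Y) (f : Y → K), @IsOpen Y (zariski K Y) V → IsRegularOn K V f →
      IsRegularOn K (φ ⁻¹' V) (f ∘ φ)

/-- A bijection which is an isomorphism of varieties. -/
def IsVarietyIso (K : Type*) [Field K] {X Y : Type*} [HomCoords K X] [HomCoords K Y]
    (e : X ≃ Y) : Prop :=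
  IsMorphism K e ∧ IsMorphism K e.symm

/-- The projective line over `K`. -/
abbrev ProjLine (K : Type*) [Field K] : Type _ := Projectivization K (Fin 2 → K)

/-- `f : X → Y` is a `ℙ¹`-bundle, locally trivial for the Zariski topology. -/
def IsProjLineBundle (K : Type*) [Field K] {X Y : Type*} [HomCoords K X] [HomCoords K Y]
    (f : X → Y) : Prop :=
  IsMorphism K f ∧ ∀ y : Y, ∃ U : Set Y, @IsOpen Y (zariski K Y) U ∧ y ∈ U ∧
    ∃ e : {x : X // f x ∈ U} ≃ {z : Y // z ∈ U} × ProjLine K,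
      IsVarietyIso K e ∧ ∀ x, ((e x).1 : Y) = f x

/-! ### Grassmannians and flags -/

/-- The Grassmannian of `k`-dimensional subspaces of `K ^ n`. -/
def Gr (K : Type*) [Field K] (k n : ℕ) : Type _ :=
  {W : Submodule K (Fin n → K) // Module.finrank K W = k}

/-- The coordinates of a `k`-dimensional subspace `W` are the `k × n` matrices whose rows span `W`
(and hence form a basis of `W`). -/
instance Gr.instHomCoords (K : Type*) [Field K] (k n : ℕ) : HomCoords K (Gr K k n) where
  Idx := Fin k × Fin n
  finite := inferInstance
  Coord a W := Submodule.span K (Set.range fun (i : Fin k) (j : Fin n) => a (i, j)) = W.1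
  exists_coord W := by
    let b := Module.finBasisOfFinrankEq K W.1 W.2
    refine ⟨fun ij => (b ij.1 : Fin n → K) ij.2, ?_⟩
    have h : (Set.range fun (i : Fin k) (j : Fin n) => (b i : Fin n → K) j)
        = W.1.subtype '' Set.range b := by
      rw [← Set.range_comp]; rfl
    rw [h, Submodule.span_image, b.span_eq, Submodule.map_top, Submodule.range_subtype]
  coord_unique a V W hV hW := Subtype.ext (hV.symm.trans hW)

/-- The product `Gr(1,n) × ⋯ × Gr(r,n)`; the factor of index `i : Fin r` is `Gr(i+1,n)`. -/
abbrev GrProd (K : Type*) [Field K] (n r : ℕ) : Type _ := (i : Fin r) → Gr K (i + 1) n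

/-- Projection to the first `r` factors. -/
def GrProd.trunc (K : Type*) [Field K] {n r s : ℕ} (h : r ≤ s) (F : GrProd K n s) : GrProd K n r :=
  fun i => F (Fin.castLE h i)

/-- The variety of complete flags `F₁ ⊂ ⋯ ⊂ Fₙ` in `K ^ n`. -/
def flagVariety (K : Type*) [Field K] (n : ℕ) : Set (GrProd K n n) :=
  {F | ∀ i j : Fin n, i ≤ j → (F i).1 ≤ (F j).1}

/-- The Springer fiber over `x`: the complete flags fixed by `x`. -/
def springerFiber (K : Type*) [Field K] {n : ℕ} (x : Matrix.SpecialLinearGroup (Fin n) K) :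
    Set (GrProd K n n) :=
  {F | F ∈ flagVariety K n ∧
    ∀ i : Fin n, (F i).1.map (Matrix.toLin' (x : Matrix (Fin n) (Fin n) K)) ≤ (F i).1}

/-! ### Unipotent elements with two Jordan blocks, tableaux, strata, components -/

/-- The basis `e` is adapted to `x = 1 + n`: `n` maps `e_{i+1,j}` to `e_{i,j}` and kills `e_{1,j}`,
for both `j`.  Here `e_{i,1} = e (inl (i-1))` and `e_{i,2} = e (inr (i-1))`.  An element `x` is
unipotent with Jordan blocks of sizes `p, q` iff it has such a basis. -/
def IsAdaptedBasis (K : Type*) [Field K] {p q : ℕ}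
    (x : Matrix.SpecialLinearGroup (Fin (p + q)) K)
    (e : Module.Basis (Fin p ⊕ Fin q) K (Fin (p + q) → K)) : Prop :=
  let N := Matrix.toLin' ((x : Matrix (Fin (p + q)) (Fin (p + q)) K) - 1)
  (∀ i : Fin p, (i : ℕ) = 0 → N (e (Sum.inl i)) = 0) ∧
  (∀ i j : Fin p, (j : ℕ) = i + 1 → N (e (Sum.inl j)) = e (Sum.inl i)) ∧
  (∀ i : Fin q, (i : ℕ) = 0 → N (e (Sum.inr i)) = 0) ∧
  (∀ i j : Fin q, (j : ℕ) = i + 1 → N (e (Sum.inr j)) = e (Sum.inr i))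

/-- Standard tableaux of type `(p,q)`: a left column of `p` boxes and a right column of `q` boxes,
numbered from the top, filled bijectively with `1, …, p+q` (the number `r + 1` is represented by
`r : Fin (p + q)`), strictly decreasing from top to bottom and from left to right. -/
structure StandardTableau (p q : ℕ) where
  entry : Fin p ⊕ Fin q ≃ Fin (p + q)
  left_anti : StrictAnti fun i : Fin p => entry (Sum.inl i)
  right_anti : StrictAnti fun i : Fin q => entry (Sum.inr i)
  row_anti : ∀ (i : Fin p) (j : Fin q), (i : ℕ) = j → entry (Sum.inr j) < entry (Sum.inl i)

/-- The two columns of a tableau. -/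
inductive Column
  | left
  | right

/-- The column `ψ(r+1)` of `σ` in which the number `r + 1` appears. -/
def StandardTableau.column {p q : ℕ} (σ : StandardTableau p q) (r : Fin (p + q)) : Column :=
  match σ.entry.symm r with
  | Sum.inl _ => Column.left
  | Sum.inr _ => Column.right

universe v

/-- Membership of the flag `F 0 ⊂ F 1 ⊂ ⋯` of `V` in the stratum attached to the word `ψ(1), ψ(2), …`
and to an adapted basis of `V` with Jordan chains `u 0, u 1, …` and `w 0, w 1, …`.
* `ψ(1) = left`: the line `F 0` is spanned by `u 0`;
* `ψ(1) = right`: the line `F 0` is spanned by `a • u 0 + w 0` for some scalar `a`;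
and the flag induced in `V ⧸ F 0` lies in the stratum attached to `ψ(2), ψ(3), …` and to the
induced adapted basis of `V ⧸ F 0`, with chains the classes of `u 1, u 2, …` and `w 0, w 1, …` in the
first case, of `u 0, u 1, …` and `a • u 1 + w 1, a • u 2 + w 2, …` in the second. -/
def InStratum (K : Type*) [Field K] : List Column → ∀ (V : Type v) [AddCommGroup V] [Module K V],
    (ℕ → V) → (ℕ → V) → (ℕ → Submodule K V) → Prop
  | [], _, _, _, _, _, _ => True
  | Column.left :: ψ, V, _, _, u, w, F =>
      F 0 = Submodule.span K {u 0} ∧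
        InStratum K ψ (V ⧸ F 0) (fun i => (F 0).mkQ (u (i + 1))) (fun i => (F 0).mkQ (w i))
          (fun i => (F (i + 1)).map (F 0).mkQ)
  | Column.right :: ψ, V, _, _, u, w, F =>
      ∃ a : K, F 0 = Submodule.span K {a • u 0 + w 0} ∧
        InStratum K ψ (V ⧸ F 0) (fun i => (F 0).mkQ (u i))
          (fun i => (F 0).mkQ (a • u (i + 1) + w (i + 1)))
          (fun i => (F (i + 1)).map (F 0).mkQ)

/-- The stratum `X_σ`.  (Chains are prolonged by `0`, the flag by `⊤`; these values play no role.) -/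
def stratum (K : Type*) [Field K] {p q : ℕ}
    (e : Module.Basis (Fin p ⊕ Fin q) K (Fin (p + q) → K)) (σ : StandardTableau p q) :
    Set (GrProd K (p + q) (p + q)) :=
  {F | F ∈ flagVariety K (p + q) ∧
    InStratum K (List.ofFn σ.column) (Fin (p + q) → K)
      (fun i => if h : i < p then e (Sum.inl ⟨i, h⟩) else 0)
      (fun i => if h : i < q then e (Sum.inr ⟨i, h⟩) else 0)
      (fun i => if h : i < p + q then (F ⟨i, h⟩).1 else ⊤)}

/-- `Y_σ`, the Zariski closure of the stratum `X_σ`. -/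
def component (K : Type*) [Field K] {p q : ℕ}
    (e : Module.Basis (Fin p ⊕ Fin q) K (Fin (p + q) → K)) (σ : StandardTableau p q) :
    Set (GrProd K (p + q) (p + q)) :=
  @closure _ (zariski K (GrProd K (p + q) (p + q))) (stratum K e σ)

/-- `Y_σ(r)`, the image of `Y_σ` in `Gr(1,n) × ⋯ × Gr(r,n)`, `n = p + q`; for `r = 0` a point. -/
def componentImage (K : Type*) [Field K] {p q : ℕ}
    (e : Module.Basis (Fin p ⊕ Fin q) K (Fin (p + q) → K)) (σ : StandardTableau p q)
    (r : ℕ) (hr : r ≤ p + q) : Set (GrProd K (p + q) r) :=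
  GrProd.trunc K hr '' component K e σ

/-- The natural projection `Y_σ(r+1) → Y_σ(r)`. -/
def componentProj (K : Type*) [Field K] {p q : ℕ}
    (e : Module.Basis (Fin p ⊕ Fin q) K (Fin (p + q) → K)) (σ : StandardTableau p q)
    (r : Fin (p + q)) (y : componentImage K e σ (r + 1) r.2) : componentImage K e σ r r.2.le :=
  ⟨GrProd.trunc K (Nat.le_succ r) y.1, by
    obtain ⟨F, hF, h⟩ := y.2
    exact ⟨F, hF, by rw [← h]; rfl⟩⟩

/-! Put `N = x - 1` and read `σ` as a lattice path: right column = letter `true` = step up, left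
column = letter `false` = step down. Standardness says that the path stays above its final height `q
- p`. A down-step is then either matched, like a parenthesis, to an earlier up-step, or it reaches a
new minimum.

The closure `Y_σ` is described by explicit closed conditions on a flag `G` (`IsMatched`): `N` maps
each member into the previous one; `N ^ k` maps `G (i + 2k)` into `G i` whenever the path is
balanced between these positions; and when a minimum `-u` is reached at position `2t + u`, `N ^ t`
maps that member into the span of the first `u` vectors of the first chain. Since `ker (N ^ k)` has
dimension `2k` for `k ≤ q`, and since each member lies in the image of a suitable power of `N`
(`IsMatched.le_range`), dimension counts turn the last two kinds of inclusion into equalities. After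
a down-step the new member is thus forced to be the preimage of an earlier member or of a fixed
subspace (`exists_base_of_left`); after an up-step it is an arbitrary subspace of the right
dimension between `G r` and `N⁻¹ (G r)`, that is, a line in a plane. So the matched partial flags
form a tower of isomorphisms and `ℙ¹`-bundles, and they are irreducible.

The recursion defining `X_σ` produces matched flags (`isMatched_of_inStratumOver`). Conversely, a
matched flag which at no stage contains the next vector of the first chain lies in `X_σ`
(`inStratumOver_of_isMatched`). This genericity is open and nonempty, so by irreducibility `Y_σ` is
the set of matched flags; as matched partial flags can be prolonged, `Y_σ(r)` is the set of matched
partial flags of length `r`.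

For maximality, every flag in the Springer fiber is matched to some ballot word: a letter is `false`
when the least `k` with `im (N ^ k) ⊆ G i` drops (`exists_isBallot_isMatched`). The fiber is
therefore a finite union of closed irreducible sets, and no inclusion holds between those of
different words, as is seen on flags spanned by basis vectors
(`IsBallot.eq_of_matchedFlags_subset`).

The algebraic geometry is reduced to linear algebra over germs of rational functions: all maps are
shown to lift locally to rational maps of coordinate vectors (`HasLocalLifts`), a property stable
under composition, products and restriction which implies being a morphism. -/

/-! ### Germs of rational functions on affine space -/

/-- The filter of Zariski neighbourhoods of a point of affine space. -/
def zarNhds {K : Type*} [Field K] {ι : Type*} (a : ι → K) : Filter (ι → K) where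
  sets := {s | ∃ h : MvPolynomial ι K, MvPolynomial.eval a h ≠ 0 ∧
    ∀ b, MvPolynomial.eval b h ≠ 0 → b ∈ s}
  univ_sets := ⟨1, by simp, fun _ _ => trivial⟩
  sets_of_superset := by
    rintro s t ⟨h, ha, hs⟩ hst
    exact ⟨h, ha, fun b hb => hst (hs b hb)⟩
  inter_sets := by
    rintro s t ⟨g, hga, hg⟩ ⟨h, hha, hh⟩
    refine ⟨g * h, by simp [hga, hha], fun b hb => ?_⟩
    rw [map_mul] at hb
    exact ⟨hg b (left_ne_zero_of_mul hb), hh b (right_ne_zero_of_mul hb)⟩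

/-- `f` agrees near `a` with a quotient of polynomials whose denominator does not vanish at `a`. -/
def IsRationalAt {K : Type*} [Field K] {ι : Type*} (f : (ι → K) → K) (a : ι → K) : Prop :=
  ∃ g h : MvPolynomial ι K, MvPolynomial.eval a h ≠ 0 ∧
    ∀ᶠ b in zarNhds a, f b = MvPolynomial.eval b g / MvPolynomial.eval b h

section Rational

variable {K : Type*} [Field K] {ι : Type*} {a : ι → K}

lemma eventually_zarNhds_iff {P : (ι → K) → Prop} :
    (∀ᶠ b in zarNhds a, P b) ↔ ∃ h : MvPolynomial ι K, MvPolynomial.eval a h ≠ 0 ∧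
      ∀ b, MvPolynomial.eval b h ≠ 0 → P b := Iff.rfl

lemma Filter.Eventually.self_of_zarNhds {P : (ι → K) → Prop} (h : ∀ᶠ b in zarNhds a, P b) :
    P a := by
  obtain ⟨h, ha, hP⟩ := h
  exact hP a ha

lemma eventually_eval_ne_zero {h : MvPolynomial ι K} (ha : MvPolynomial.eval a h ≠ 0) :
    ∀ᶠ b in zarNhds a, MvPolynomial.eval b h ≠ 0 :=
  ⟨h, ha, fun _ hb => hb⟩

namespace IsRationalAt

variable {f g : (ι → K) → K}

lemma congr' (hf : IsRationalAt f a) (h : ∀ᶠ b in zarNhds a, g b = f b) : IsRationalAt g a := by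
  obtain ⟨p, q, hq, hpq⟩ := hf
  refine ⟨p, q, hq, ?_⟩
  filter_upwards [hpq, h] with b h1 h2
  rw [h2, h1]

lemma polynomial (p : MvPolynomial ι K) : IsRationalAt (fun b => MvPolynomial.eval b p) a :=
  ⟨p, 1, by simp, by simp⟩

lemma const (c : K) : IsRationalAt (fun _ : ι → K => c) a := by
  simpa using polynomial (a := a) (MvPolynomial.C c : MvPolynomial ι K)

lemma coord (i : ι) : IsRationalAt (fun b : ι → K => b i) a := by
  simpa using polynomial (a := a) (MvPolynomial.X i : MvPolynomial ι K)

lemma add (hf : IsRationalAt f a) (hg : IsRationalAt g a) :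
    IsRationalAt (fun b => f b + g b) a := by
  obtain ⟨p, q, hq, hpq⟩ := hf
  obtain ⟨r, s, hs, hrs⟩ := hg
  refine ⟨p * s + q * r, q * s, by simp [hq, hs], ?_⟩
  filter_upwards [hpq, hrs, eventually_eval_ne_zero hq, eventually_eval_ne_zero hs] with b h1 h2 h3 h4
  rw [h1, h2, div_add_div _ _ h3 h4]
  simp

lemma mul (hf : IsRationalAt f a) (hg : IsRationalAt g a) :
    IsRationalAt (fun b => f b * g b) a := by
  obtain ⟨p, q, hq, hpq⟩ := hf
  obtain ⟨r, s, hs, hrs⟩ := hg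
  refine ⟨p * r, q * s, by simp [hq, hs], ?_⟩
  filter_upwards [hpq, hrs] with b h1 h2
  rw [h1, h2, div_mul_div_comm]
  simp

lemma neg (hf : IsRationalAt f a) : IsRationalAt (fun b => - f b) a := by
  simpa using (const (a := a) (-1 : K)).mul hf

lemma sub (hf : IsRationalAt f a) (hg : IsRationalAt g a) :
    IsRationalAt (fun b => f b - g b) a := by
  simpa [sub_eq_add_neg] using hf.add hg.neg

lemma sum {κ : Type*} (s : Finset κ) {f : κ → (ι → K) → K} (hf : ∀ i ∈ s, IsRationalAt (f i) a) :
    IsRationalAt (fun b => ∑ i ∈ s, f i b) a := by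
  classical
  induction s using Finset.induction_on with
  | empty => simpa using const (a := a) (0 : K)
  | insert i s hi ih =>
    simp only [Finset.sum_insert hi]
    exact (hf i (Finset.mem_insert_self i s)).add
      (ih fun j hj => hf j (Finset.mem_insert_of_mem hj))

lemma prod {κ : Type*} (s : Finset κ) {f : κ → (ι → K) → K} (hf : ∀ i ∈ s, IsRationalAt (f i) a) :
    IsRationalAt (fun b => ∏ i ∈ s, f i b) a := by
  classical
  induction s using Finset.induction_on with
  | empty => simpa using const (a := a) (1 : K)
  | insert i s hi ih =>
    simp only [Finset.prod_insert hi]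
    exact (hf i (Finset.mem_insert_self i s)).mul
      (ih fun j hj => hf j (Finset.mem_insert_of_mem hj))

lemma eventually_ne_zero (hf : IsRationalAt f a) (ha : f a ≠ 0) : ∀ᶠ b in zarNhds a, f b ≠ 0 := by
  obtain ⟨p, q, hq, hpq⟩ := hf
  have hp : MvPolynomial.eval a p ≠ 0 := by
    intro h0
    exact ha (by rw [hpq.self_of_zarNhds, h0, zero_div])
  filter_upwards [hpq, eventually_eval_ne_zero hq, eventually_eval_ne_zero hp] with b h1 h2 h3
  rw [h1]
  exact div_ne_zero h3 h2

lemma inv (hf : IsRationalAt f a) (ha : f a ≠ 0) : IsRationalAt (fun b => (f b)⁻¹) a := by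
  obtain ⟨p, q, hq, hpq⟩ := hf
  have hp : MvPolynomial.eval a p ≠ 0 := by
    intro h0
    exact ha (by rw [hpq.self_of_zarNhds, h0, zero_div])
  refine ⟨q, p, hp, ?_⟩
  filter_upwards [hpq] with b h1
  rw [h1, inv_div]

lemma div (hf : IsRationalAt f a) (hg : IsRationalAt g a) (ha : g a ≠ 0) :
    IsRationalAt (fun b => f b / g b) a := by
  simpa [div_eq_mul_inv] using hf.mul (hg.inv ha)

lemma eval {κ : Type*} {L : (ι → K) → κ → K} (hL : ∀ j, IsRationalAt (fun b => L b j) a)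
    (p : MvPolynomial κ K) : IsRationalAt (fun b => MvPolynomial.eval (L b) p) a := by
  induction p using MvPolynomial.induction_on with
  | C c => simpa using const (a := a) c
  | add p q hp hq => simpa using hp.add hq
  | mul_X p j hp => simpa using hp.mul (hL j)

/-- Pulling back a polynomial that does not vanish at `L a` gives a rational function that does not
vanish at `a`. Statements valid near `L a` can thus be transported to statements valid near `a`. -/
lemma tendsto {κ : Type*} {L : (ι → K) → κ → K} (hL : ∀ j, IsRationalAt (fun b => L b j) a) :
    Filter.Tendsto L (zarNhds a) (zarNhds (L a)) := by
  rintro s ⟨h, ha, hs⟩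
  exact Filter.mem_of_superset ((eval hL h).eventually_ne_zero ha) fun b hb => hs _ hb

lemma comp {κ : Type*} {L : (ι → K) → κ → K} (hL : ∀ j, IsRationalAt (fun b => L b j) a)
    {f : (κ → K) → K} (hf : IsRationalAt f (L a)) : IsRationalAt (fun b => f (L b)) a := by
  obtain ⟨p, q, hq, hpq⟩ := hf
  exact ((eval hL p).div (eval hL q) hq).congr' ((tendsto hL).eventually hpq)

lemma det {m : Type*} [Fintype m] [DecidableEq m] {A : (ι → K) → Matrix m m K}
    (hA : ∀ i j, IsRationalAt (fun b => A b i j) a) : IsRationalAt (fun b => (A b).det) a := by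
  simp only [Matrix.det_apply']
  exact sum _ fun σ _ => (const _).mul (prod _ fun i _ => hA _ _)

lemma matrix_inv {m : Type*} [Fintype m] [DecidableEq m] {A : (ι → K) → Matrix m m K}
    (hA : ∀ i j, IsRationalAt (fun b => A b i j) a) (ha : (A a).det ≠ 0) (i j : m) :
    IsRationalAt (fun b => (A b)⁻¹ i j) a := by
  simp only [Matrix.inv_def, Matrix.smul_apply, smul_eq_mul, Ring.inverse_eq_inv',
    Matrix.adjugate_apply]
  refine ((det hA).inv ha).mul (det fun k l => ?_)
  by_cases hk : k = j
  · subst hk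
    simpa using const (a := a) _
  · simpa [Matrix.updateRow_ne hk] using hA k l

lemma linearMap {n : ℕ} {v : (ι → K) → Fin n → K}
    (hv : ∀ j, IsRationalAt (fun b => v b j) a) (T : (Fin n → K) →ₗ[K] K) :
    IsRationalAt (fun b => T (v b)) a := by
  have h : ∀ b, T (v b) = ∑ j, v b j * T (Pi.single j 1) := by
    intro b
    conv_lhs => rw [pi_eq_sum_univ' (v b)]
    simp [map_sum]
  simp only [h]
  exact sum _ fun j _ => (hv j).mul (const _)

end IsRationalAt

end Rational

/-! ### Maps which lift locally to rational maps on coordinates -/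

open HomCoords in
/-- Locally, `φ` is given on coordinate vectors by rational functions. -/
def HasLocalLifts (K : Type*) [Field K] {X Y : Type*} [HomCoords K X] [HomCoords K Y]
    (φ : X → Y) : Prop :=
  ∀ (x : X) (a : Idx K X → K), Coord a x → ∃ L : (Idx K X → K) → (Idx K Y → K),
    (∀ j, IsRationalAt (fun b => L b j) a) ∧
      ∀ᶠ b in zarNhds a, ∀ y, Coord b y → Coord (L b) (φ y)

open HomCoords

section Lifts

variable {K : Type*} [Field K] {X Y Z : Type*} [HomCoords K X] [HomCoords K Y] [HomCoords K Z]

lemma isOpen_zariski_iff {U : Set X} : @IsOpen X (zariski K X) U ↔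
    ∀ x ∈ U, ∀ a : Idx K X → K, Coord a x → ∀ᶠ b in zarNhds a, ∀ y, Coord b y → y ∈ U := by
  have key : @IsOpen X (zariski K X) U ↔ ∀ x ∈ U, ∀ a : Idx K X → K, Coord a x →
    ∃ h : MvPolynomial (Idx K X) K, MvPolynomial.eval a h ≠ 0 ∧
      ∀ (y : X) (b : Idx K X → K), Coord b y → MvPolynomial.eval b h ≠ 0 → y ∈ U := Iff.rfl
  rw [key]
  simp only [eventually_zarNhds_iff]
  constructor
  · intro h x hx a ha
    obtain ⟨p, hp, hU⟩ := h x hx a ha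
    exact ⟨p, hp, fun b hb y hy => hU y b hy hb⟩
  · intro h x hx a ha
    obtain ⟨p, hp, hU⟩ := h x hx a ha
    exact ⟨p, hp, fun y b hy hb => hU b hb y hy⟩

namespace HasLocalLifts

lemma comp {ψ : Y → Z} {φ : X → Y} (hψ : HasLocalLifts K ψ) (hφ : HasLocalLifts K φ) :
    HasLocalLifts K (ψ ∘ φ) := by
  intro x a ha
  obtain ⟨L, hL, hLφ⟩ := hφ x a ha
  obtain ⟨M, hM, hMψ⟩ := hψ (φ x) (L a) (hLφ.self_of_zarNhds x ha)
  refine ⟨M ∘ L, fun j => IsRationalAt.comp hL (hM j), ?_⟩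
  filter_upwards [hLφ, (IsRationalAt.tendsto hL).eventually hMψ] with b h1 h2 y hy
  exact h2 _ (h1 y hy)

lemma of_forall (φ : X → Y) (L : (Idx K X → K) → (Idx K Y → K))
    (hL : ∀ a j, IsRationalAt (fun b => L b j) a) (h : ∀ b y, Coord b y → Coord (L b) (φ y)) :
    HasLocalLifts K φ :=
  fun _ a _ => ⟨L, hL a, Filter.Eventually.of_forall h⟩

lemma val (P : X → Prop) : HasLocalLifts K (Subtype.val : {x // P x} → X) :=
  of_forall _ (fun b => b) (fun _ j => IsRationalAt.coord j) fun _ _ h => h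

lemma fst : HasLocalLifts K (Prod.fst : X × Y → X) :=
  of_forall _ (fun b i => b (Sum.inl i)) (fun _ _ => IsRationalAt.coord _) fun _ _ h => h.1

lemma snd : HasLocalLifts K (Prod.snd : X × Y → Y) :=
  of_forall _ (fun b i => b (Sum.inr i)) (fun _ _ => IsRationalAt.coord _) fun _ _ h => h.2

lemma prodMk {φ : X → Y} {ψ : X → Z} (hφ : HasLocalLifts K φ) (hψ : HasLocalLifts K ψ) :
    HasLocalLifts K (fun x => (φ x, ψ x)) := by
  intro x a ha
  obtain ⟨L, hL, hLφ⟩ := hφ x a ha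
  obtain ⟨M, hM, hMψ⟩ := hψ x a ha
  refine ⟨fun b => Sum.elim (L b) (M b), ?_, ?_⟩
  · rintro (j | j)
    · exact hL j
    · exact hM j
  · filter_upwards [hLφ, hMψ] with b h1 h2 y hy
    exact ⟨h1 y hy, h2 y hy⟩

lemma id : HasLocalLifts K (fun x : X => x) :=
  of_forall _ (fun b => b) (fun _ j => IsRationalAt.coord j) fun _ _ h => h

lemma const (y : Y) : HasLocalLifts K (fun _ : X => y) := by
  obtain ⟨c, hc⟩ := exists_coord (K := K) y
  exact of_forall _ (fun _ => c) (fun _ _ => IsRationalAt.const _) fun _ _ _ => hc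

lemma isOpen_preimage {φ : X → Y} (hφ : HasLocalLifts K φ) {U : Set Y}
    (hU : @IsOpen Y (zariski K Y) U) : @IsOpen X (zariski K X) (φ ⁻¹' U) := by
  rw [isOpen_zariski_iff] at hU ⊢
  intro x hx a ha
  obtain ⟨L, hL, hLφ⟩ := hφ x a ha
  filter_upwards [hLφ, (IsRationalAt.tendsto hL).eventually
    (hU (φ x) hx (L a) (hLφ.self_of_zarNhds x ha))] with b h1 h2 y hy
  exact h2 _ (h1 y hy)

/-- A local quotient `g / h` composed with a rational lift is again a local quotient, because
rational germs are closed under composition. -/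
lemma isMorphism {φ : X → Y} (hφ : HasLocalLifts K φ) : IsMorphism K φ := by
  refine ⟨@Continuous.mk X Y (zariski K X) (zariski K Y) _ fun U hU => hφ.isOpen_preimage hU, ?_⟩
  intro V f _ hf x hx a ha
  obtain ⟨L, hL, hLφ⟩ := hφ x a ha
  obtain ⟨g, h, hh, hgh⟩ := hf (φ x) hx (L a) (hLφ.self_of_zarNhds x ha)
  obtain ⟨G, H, hH, hGH⟩ := (IsRationalAt.eval hL g).div (IsRationalAt.eval hL h) hh
  obtain ⟨e, he, hev⟩ := eventually_zarNhds_iff.1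
    ((hLφ.and hGH).and ((IsRationalAt.eval hL h).eventually_ne_zero hh))
  -- The quotient `G / H` represents the pullback only where `e ≠ 0`. The common factor `e` leaves
  -- the quotient unchanged there and makes non-vanishing of the denominator imply `e ≠ 0`.
  refine ⟨G * e, H * e, by simp [hH, he], fun y hy b hb hne => ?_⟩
  rw [map_mul] at hne
  have hb' := right_ne_zero_of_mul hne
  obtain ⟨⟨h1, h2⟩, h3⟩ := hev b hb'
  beta_reduce at h2
  rw [Function.comp_apply, hgh (φ y) hy (L b) (h1 y hb) h3, h2, map_mul, map_mul,
    mul_div_mul_right _ _ hb']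

end HasLocalLifts

lemma isVarietyIso_of_hasLocalLifts {e : X ≃ Y} (h : HasLocalLifts K e)
    (h' : HasLocalLifts K e.symm) : IsVarietyIso K e :=
  ⟨h.isMorphism, h'.isMorphism⟩

end Lifts

/-! ### Irreducibility and projective line bundles -/

/-- Any two nonempty Zariski open subsets of the nonempty set `X` meet. -/
def IsZariskiIrreducible (K : Type*) [Field K] (X : Type*) [HomCoords K X] : Prop :=
  Nonempty X ∧ ∀ U V : Set X, @IsOpen X (zariski K X) U → @IsOpen X (zariski K X) V →
    U.Nonempty → V.Nonempty → (U ∩ V).Nonempty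

/-- A `ℙ¹`-bundle with local trivializations which lift to rational maps on coordinates. -/
def IsLiftedProjLineBundle (K : Type*) [Field K] {X Y : Type*} [HomCoords K X] [HomCoords K Y]
    (f : X → Y) : Prop :=
  HasLocalLifts K f ∧ ∀ y : Y, ∃ U : Set Y, @IsOpen Y (zariski K Y) U ∧ y ∈ U ∧
    ∃ e : {x : X // f x ∈ U} ≃ {z : Y // z ∈ U} × ProjLine K,
      HasLocalLifts K e ∧ HasLocalLifts K e.symm ∧ ∀ x, ((e x).1 : Y) = f x

section

variable {K : Type*} [Field K] {X Y : Type*} [HomCoords K X] [HomCoords K Y]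

lemma IsZariskiIrreducible.isIrreducible_range {φ : X → Y} (hX : IsZariskiIrreducible K X)
    (hφ : HasLocalLifts K φ) : @IsIrreducible Y (zariski K Y) (Set.range φ) := by
  obtain ⟨⟨x⟩, h⟩ := hX
  refine ⟨⟨φ x, x, rfl⟩, ?_⟩
  rintro U V hU hV ⟨_, ⟨x, rfl⟩, hx⟩ ⟨_, ⟨y, rfl⟩, hy⟩
  obtain ⟨z, hzU, hzV⟩ := h _ _ (hφ.isOpen_preimage hU) (hφ.isOpen_preimage hV) ⟨x, hx⟩ ⟨y, hy⟩
  exact ⟨φ z, ⟨z, rfl⟩, hzU, hzV⟩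

lemma IsZariskiIrreducible.of_surjective {φ : X → Y} (hX : IsZariskiIrreducible K X)
    (hφ : HasLocalLifts K φ) (hs : Function.Surjective φ) : IsZariskiIrreducible K Y := by
  obtain ⟨⟨x⟩, h⟩ := hX
  refine ⟨⟨φ x⟩, ?_⟩
  rintro U V hU hV ⟨y, hy⟩ ⟨z, hz⟩
  obtain ⟨y, rfl⟩ := hs y
  obtain ⟨z, rfl⟩ := hs z
  obtain ⟨t, htU, htV⟩ := h _ _ (hφ.isOpen_preimage hU) (hφ.isOpen_preimage hV) ⟨y, hy⟩ ⟨z, hz⟩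
  exact ⟨φ t, htU, htV⟩

lemma isZariskiIrreducible_projLine [Infinite K] : IsZariskiIrreducible K (ProjLine K) := by
  refine ⟨inferInstance, ?_⟩
  rintro U V hU hV ⟨x, hx⟩ ⟨y, hy⟩
  obtain ⟨a, ha⟩ := exists_coord (K := K) x
  obtain ⟨b, hb⟩ := exists_coord (K := K) y
  obtain ⟨g, hga, hg⟩ := hU x hx a ha
  obtain ⟨h, hhb, hh⟩ := hV y hy b hb
  have hg0 : g ≠ 0 := by rintro rfl; simp at hga
  have hh0 : h ≠ 0 := by rintro rfl; simp at hhb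
  -- The factor `X 0` forces the common non-zero `c` to be a non-zero vector, hence the coordinates
  -- of a point of the line. Such a `c` exists because `K` is infinite.
  have hne : g * h * MvPolynomial.X (0 : Fin 2) ≠ 0 :=
    mul_ne_zero (mul_ne_zero hg0 hh0) (MvPolynomial.X_ne_zero _)
  obtain ⟨c, hc⟩ : ∃ c, MvPolynomial.eval c (g * h * MvPolynomial.X (0 : Fin 2)) ≠ 0 := by
    by_contra! hcon
    exact hne (MvPolynomial.funext fun c => by rw [hcon c, map_zero])
  rw [map_mul, map_mul, MvPolynomial.eval_X] at hc
  have hc0 : c ≠ 0 := by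
    rintro rfl
    simp at hc
  have h1 : Coord c (Projectivization.mk K c hc0) := ⟨hc0, rfl⟩
  exact ⟨Projectivization.mk K c hc0,
    hg _ c h1 (left_ne_zero_of_mul (left_ne_zero_of_mul hc)),
    hh _ c h1 (right_ne_zero_of_mul (left_ne_zero_of_mul hc))⟩

/-- The projection of a product to a factor is open. -/
lemma isOpen_fst_image {O : Set (X × Y)} (hO : @IsOpen (X × Y) (zariski K (X × Y)) O) :
    @IsOpen X (zariski K X) (Prod.fst '' O) := by
  rw [isOpen_zariski_iff] at hO ⊢
  rintro _ ⟨⟨x, y⟩, hxy, rfl⟩ a ha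
  -- Freezing the coordinates `c` of the second factor turns a neighbourhood in the product into one
  -- in the first factor.
  obtain ⟨c, hc⟩ := exists_coord (K := K) y
  have hL : ∀ j, IsRationalAt
      (fun b : Idx K X → K => (Sum.elim b c : Idx K X ⊕ Idx K Y → K) j) a := by
    rintro (j | j)
    · exact IsRationalAt.coord j
    · exact IsRationalAt.const _
  filter_upwards [(IsRationalAt.tendsto hL).eventually (hO (x, y) hxy (Sum.elim a c) ⟨ha, hc⟩)]
    with b hb z hz
  exact ⟨(z, y), hb (z, y) ⟨hz, hc⟩, rfl⟩

/-- Openness in an open subset is openness in the whole. -/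
lemma isOpen_val_image {U : Set X} (hU : @IsOpen X (zariski K X) U) {O : Set {x // x ∈ U}}
    (hO : @IsOpen {x // x ∈ U} (zariski K {x // x ∈ U}) O) :
    @IsOpen X (zariski K X) (Subtype.val '' O) := by
  rw [isOpen_zariski_iff] at hO hU ⊢
  rintro _ ⟨x, hx, rfl⟩ a ha
  filter_upwards [hO x hx a ha, hU x x.2 a ha] with b h1 h2 y hy
  exact ⟨⟨y, h2 y hy⟩, h1 ⟨y, h2 y hy⟩ hy, rfl⟩

namespace IsLiftedProjLineBundle

variable {f : X → Y} (hf : IsLiftedProjLineBundle K f)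

include hf

lemma isProjLineBundle : IsProjLineBundle K f := by
  refine ⟨hf.1.isMorphism, fun y => ?_⟩
  obtain ⟨U, hU, hy, e, h1, h2, h3⟩ := hf.2 y
  exact ⟨U, hU, hy, e, isVarietyIso_of_hasLocalLifts h1 h2, h3⟩

lemma exists_fiber_equiv (z : Y) : ∃ φ : {x : X // f x = z} ≃ ProjLine K,
    HasLocalLifts K φ ∧ HasLocalLifts K φ.symm := by
  obtain ⟨U, hU, hz, e, h1, h2, h3⟩ := hf.2 z
  have key : ∀ l, f (e.symm (⟨z, hz⟩, l)).1 = z := by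
    intro l
    rw [← h3, Equiv.apply_symm_apply]
  have hmem : ∀ y : {x : X // f x = z}, f y.1 ∈ U := fun y => by rw [y.2]; exact hz
  refine ⟨⟨fun y => (e ⟨y.1, hmem y⟩).2, fun l => ⟨(e.symm (⟨z, hz⟩, l)).1, key l⟩, ?_, ?_⟩, ?_, ?_⟩
  · rintro ⟨y, hy⟩
    apply Subtype.ext
    have : (⟨z, hz⟩, (e ⟨y, hmem ⟨y, hy⟩⟩).2) = e ⟨y, hmem ⟨y, hy⟩⟩ :=
      Prod.ext (Subtype.ext (by rw [h3, hy])) rfl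
    simp only [this, Equiv.symm_apply_apply]
  · intro l
    simp
  · exact HasLocalLifts.snd.comp (h1.comp (φ := fun y : {x : X // f x = z} =>
      (⟨y.1, hmem y⟩ : {x : X // f x ∈ U})) (HasLocalLifts.val (fun x => f x = z)))
  · exact ((HasLocalLifts.val _).comp
      (h2.comp ((HasLocalLifts.const _).prodMk HasLocalLifts.id)))

/-- Locally the map is the projection of a product to a factor, which is open. -/
lemma isOpen_image {O : Set X} (hO : @IsOpen X (zariski K X) O) :
    @IsOpen Y (zariski K Y) (f '' O) := by
  let _ := zariski K Y
  rw [isOpen_iff_mem_nhds]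
  rintro _ ⟨x, hx, rfl⟩
  obtain ⟨U, hU, hz, e, h1, h2, h3⟩ := hf.2 (f x)
  have hO' := isOpen_val_image hU (isOpen_fst_image
    (h2.isOpen_preimage ((HasLocalLifts.val (K := K) _).isOpen_preimage hO)))
  refine Filter.mem_of_superset (hO'.mem_nhds ?_) ?_
  · exact ⟨⟨f x, hz⟩, ⟨e ⟨x, hz⟩, by simpa using hx, Subtype.ext (h3 _)⟩, rfl⟩
  · rintro _ ⟨_, ⟨w, hw, rfl⟩, rfl⟩
    refine ⟨_, hw, ?_⟩
    rw [← h3, Equiv.apply_symm_apply]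

/-- Since the map is open, the images of two nonempty open sets meet over the irreducible base. Both
open sets then meet a common fiber, which is a projective line and so irreducible. -/
lemma isZariskiIrreducible [Infinite K] (hY : IsZariskiIrreducible K Y) :
    IsZariskiIrreducible K X := by
  obtain ⟨⟨y⟩, h⟩ := hY
  constructor
  · obtain ⟨φ, -⟩ := hf.exists_fiber_equiv y
    exact ⟨(φ.symm (Classical.arbitrary _)).1⟩
  rintro U V hU hV ⟨x, hx⟩ ⟨x', hx'⟩
  obtain ⟨_, ⟨x, hx, rfl⟩, ⟨x', hx', hxx⟩⟩ := h _ _ (hf.isOpen_image hU) (hf.isOpen_image hV)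
    ⟨f x, x, hx, rfl⟩ ⟨f x', x', hx', rfl⟩
  obtain ⟨φ, h1, h2⟩ := hf.exists_fiber_equiv (f x)
  have h3 := (HasLocalLifts.val (K := K) _).comp h2
  obtain ⟨l, hlU, hlV⟩ := isZariskiIrreducible_projLine.2 _ _ (h3.isOpen_preimage hU)
    (h3.isOpen_preimage hV) ⟨φ ⟨x, rfl⟩, by simpa using hx⟩ ⟨φ ⟨x', hxx⟩, by simpa using hx'⟩
  exact ⟨_, hlU, hlV⟩

end IsLiftedProjLineBundle

end

/-! ### Rational families of vectors and subspaces -/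

section RationalVectors

variable {K : Type*} [Field K] {ι : Type*} {a : ι → K}

/-- Rationality at `a` of a vector valued function. -/
def IsRationalVecAt {n : ℕ} (v : (ι → K) → Fin n → K) (a : ι → K) : Prop :=
  ∀ c, IsRationalAt (fun b => v b c) a

namespace IsRationalVecAt

variable {n m : ℕ}

lemma const (v : Fin n → K) : IsRationalVecAt (fun _ : ι → K => v) a :=
  fun _ => IsRationalAt.const _

lemma sum_smul {κ : Type*} {s : Finset κ} {t : κ → (ι → K) → K} {v : κ → (ι → K) → Fin n → K}
    (ht : ∀ j, IsRationalAt (t j) a) (hv : ∀ j, IsRationalVecAt (v j) a) :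
    IsRationalVecAt (fun b => ∑ j ∈ s, t j b • v j b) a := by
  intro c
  simp only [Finset.sum_apply, Pi.smul_apply, smul_eq_mul]
  exact IsRationalAt.sum _ fun j _ => (ht j).mul (hv j c)

lemma sub {v w : (ι → K) → Fin n → K} (hv : IsRationalVecAt v a) (hw : IsRationalVecAt w a) :
    IsRationalVecAt (fun b => v b - w b) a :=
  fun c => (hv c).sub (hw c)

lemma linearMap {v : (ι → K) → Fin n → K} (hv : IsRationalVecAt v a)
    (T : (Fin n → K) →ₗ[K] (Fin m → K)) : IsRationalVecAt (fun b => T (v b)) a :=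
  fun c => IsRationalAt.linearMap hv (LinearMap.proj c ∘ₗ T)

/-- Cramer's rule for a rational family of linear systems. -/
lemma exists_solution {y : Fin m → (ι → K) → Fin m → K} {x : (ι → K) → Fin m → K}
    (hy : ∀ i, IsRationalVecAt (y i) a) (hx : IsRationalVecAt x a)
    (hli : LinearIndependent K fun i => y i a) :
    ∃ t : Fin m → (ι → K) → K, (∀ i, IsRationalAt (t i) a) ∧
      ∀ᶠ b in zarNhds a, ∑ i, t i b • y i b = x b := by
  let A : (ι → K) → Matrix (Fin m) (Fin m) K := fun b => Matrix.of fun i => y i b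
  have hA : ∀ i j, IsRationalAt (fun b => A b i j) a := hy
  have hdet : (A a).det ≠ 0 := by
    rw [← isUnit_iff_ne_zero, ← Matrix.isUnit_iff_isUnit_det,
      ← Matrix.linearIndependent_rows_iff_isUnit]
    exact hli
  refine ⟨fun i b => Matrix.vecMul (x b) (A b)⁻¹ i, fun i => ?_, ?_⟩
  · simp only [Matrix.vecMul, dotProduct]
    exact IsRationalAt.sum _ fun j _ => (hx j).mul (IsRationalAt.matrix_inv hA hdet j i)
  · filter_upwards [(IsRationalAt.det hA).eventually_ne_zero hdet] with b hb
    have : Matrix.vecMul (Matrix.vecMul (x b) (A b)⁻¹) (A b) = x b := by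
      rw [Matrix.vecMul_vecMul, Matrix.nonsing_inv_mul _ (isUnit_iff_ne_zero.2 hb),
        Matrix.vecMul_one]
    rw [Matrix.vecMul_eq_sum] at this
    exact this

/-- A left inverse of the coordinate map at `a` turns independence into non-vanishing of a square
determinant, which is rational and equals `1` at `a`. -/
lemma eventually_linearIndependent_mkQ {v : Fin m → (ι → K) → Fin n → K}
    (hv : ∀ j, IsRationalVecAt (v j) a) (E : Submodule K (Fin n → K))
    (hli : LinearIndependent K fun j => E.mkQ (v j a)) :
    ∀ᶠ b in zarNhds a, LinearIndependent K fun j => E.mkQ (v j b) := by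
  obtain ⟨g, hg⟩ := LinearMap.exists_leftInverse_of_injective
    (Fintype.linearCombination K fun j => E.mkQ (v j a))
    (LinearMap.ker_eq_bot.2 (LinearIndependent.fintypeLinearCombination_injective hli))
  have hgv : ∀ j, g (E.mkQ (v j a)) = Pi.single j 1 := by
    intro j
    have := LinearMap.congr_fun hg (Pi.single j 1)
    simpa [Fintype.linearCombination_apply_single] using this
  let A : (ι → K) → Matrix (Fin m) (Fin m) K := fun b => Matrix.of fun i => g (E.mkQ (v i b))
  have hA : ∀ i j, IsRationalAt (fun b => A b i j) a :=
    fun i j => (hv i).linearMap (g ∘ₗ E.mkQ) j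
  have hdet : (A a).det ≠ 0 := by
    have : A a = 1 := by
      ext i j
      have h1 : A a i j = (Pi.single i 1 : Fin m → K) j := congrFun (hgv i) j
      rw [h1, Matrix.one_apply, Pi.single_apply]
      simp only [eq_comm]
    simp [this]
  filter_upwards [(IsRationalAt.det hA).eventually_ne_zero hdet] with b hb
  refine LinearIndependent.of_comp g ?_
  rw [← isUnit_iff_ne_zero, ← Matrix.isUnit_iff_isUnit_det,
      ← Matrix.linearIndependent_rows_iff_isUnit] at hb
  exact hb

end IsRationalVecAt

/-- The `m` vectors span a space of dimension `m`, so they are a basis of `W`; they remain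
independent modulo `E` exactly when `W → V / E` is injective. This makes transversality an open
condition on the Grassmannian. -/
lemma linearIndependent_mkQ_iff_disjoint {V : Type*} [AddCommGroup V] [Module K V] {m : ℕ}
    {v : Fin m → V} {W : Submodule K V} (hv : Submodule.span K (Set.range v) = W)
    (hW : Module.finrank K W = m) (E : Submodule K V) :
    LinearIndependent K (fun j => E.mkQ (v j)) ↔ Disjoint W E := by
  have hli : LinearIndependent K v := by
    rw [linearIndependent_iff_card_eq_finrank_span, Set.finrank, hv, hW, Fintype.card_fin]
  constructor
  · intro h
    rw [Submodule.disjoint_def]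
    intro x hx hxE
    rw [← hv, Submodule.mem_span_range_iff_exists_fun] at hx
    obtain ⟨c, rfl⟩ := hx
    have h0 : ∑ i, c i • E.mkQ (v i) = 0 := by
      simp only [← map_smul, ← map_sum]
      rw [Submodule.mkQ_apply, Submodule.Quotient.mk_eq_zero]
      exact hxE
    have := Fintype.linearIndependent_iff.1 h c h0
    simp [this]
  · intro h
    refine hli.map ?_
    rw [hv, Submodule.ker_mkQ]
    exact h

end RationalVectors

/-! ### Open conditions on Grassmannians and preimages of rational families of subspaces -/

section Grassmannians

variable {K : Type*} [Field K] {n : ℕ}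

/-- The space of matrix rows of a coordinate vector of a subspace. -/
lemma Gr.coord_iff {m : ℕ} {a : Fin m × Fin n → K} {W : Gr K m n} :
    Coord (K := K) a W ↔
      Submodule.span K (Set.range fun (i : Fin m) (j : Fin n) => a (i, j)) = W.1 := Iff.rfl

lemma Gr.isOpen_disjoint (m : ℕ) (E : Submodule K (Fin n → K)) :
    @IsOpen (Gr K m n) (zariski K _) {W | Disjoint W.1 E} := by
  rw [isOpen_zariski_iff]
  intro W hW a ha
  rw [Gr.coord_iff] at ha
  have := IsRationalVecAt.eventually_linearIndependent_mkQ (a := a) (m := m) (n := n)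
    (v := fun i b j => b (i, j)) (fun i j => IsRationalAt.coord _) E
    ((linearIndependent_mkQ_iff_disjoint ha W.2 E).2 hW)
  filter_upwards [this] with b hb W' hW'
  exact (linearIndependent_mkQ_iff_disjoint hW' W'.2 E).1 hb

lemma Gr.isOpen_notMem (m : ℕ) (v : Fin n → K) :
    @IsOpen (Gr K m n) (zariski K _) {W | v ∉ W.1} := by
  by_cases hv : v = 0
  · subst hv
    simp
  · convert Gr.isOpen_disjoint m (Submodule.span K {v}) using 1
    ext W
    exact (Submodule.disjoint_span_singleton' hv).symm

variable {X : Type*} [HomCoords K X]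

lemma hasLocalLifts_gr {m : ℕ} {ψ : X → Gr K m n}
    (h : ∀ x (a : Idx K X → K), Coord a x → ∃ v : Fin m → (Idx K X → K) → Fin n → K,
      (∀ j, IsRationalVecAt (v j) a) ∧
      ∀ᶠ b in zarNhds a, ∀ y, Coord b y → Submodule.span K (Set.range fun j => v j b) = (ψ y).1) :
    HasLocalLifts K ψ := by
  intro x a ha
  obtain ⟨v, hv, hψ⟩ := h x a ha
  exact ⟨fun b ij => v ij.1 b ij.2, fun j => hv _ _, hψ⟩

lemma HasLocalLifts.exists_rows {m : ℕ} {ψ : X → Gr K m n} (h : HasLocalLifts K ψ)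
    (x : X) (a : Idx K X → K) (ha : Coord a x) :
    ∃ v : Fin m → (Idx K X → K) → Fin n → K, (∀ j, IsRationalVecAt (v j) a) ∧
      ∀ᶠ b in zarNhds a, ∀ y, Coord b y → Submodule.span K (Set.range fun j => v j b) = (ψ y).1 := by
  obtain ⟨L, hL, hψ⟩ := h x a ha
  exact ⟨fun i b j => L b (i, j), fun i j => hL _, hψ⟩

lemma LinearMap.exists_section_on_range {V : Type*} [AddCommGroup V] [Module K V]
    (T : V →ₗ[K] V) : ∃ S : V →ₗ[K] V, ∀ v ∈ LinearMap.range T, T (S v) = v := by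
  obtain ⟨g, hg⟩ := T.rangeRestrict.exists_rightInverse_of_surjective T.range_rangeRestrict
  obtain ⟨S, hS⟩ := g.exists_extend
  refine ⟨S, fun v hv => ?_⟩
  have h1 := LinearMap.congr_fun hS ⟨v, hv⟩
  have h2 := congrArg Subtype.val (LinearMap.congr_fun hg ⟨v, hv⟩)
  simp only [LinearMap.comp_apply, Submodule.subtype_apply] at h1
  rw [h1]
  exact h2

/-- With a fixed linear section `S` of `T`, a spanning family of the preimage consists of the
`S`-images of one of `W` and a constant one of the kernel. A rational family `W` therefore has a
rational family of preimages. -/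
lemma Submodule.comap_eq_map_section_sup_ker {V : Type*} [AddCommGroup V] [Module K V]
    {T S : V →ₗ[K] V} (hS : ∀ v ∈ LinearMap.range T, T (S v) = v) {W : Submodule K V}
    (hW : W ≤ LinearMap.range T) : W.comap T = W.map S ⊔ LinearMap.ker T := by
  apply le_antisymm
  · intro v hv
    have hv' : T (S (T v)) = T v := hS _ ⟨v, rfl⟩
    have : v = S (T v) + (v - S (T v)) := by abel
    rw [this]
    exact Submodule.add_mem_sup ⟨T v, hv, rfl⟩ (by simp [hv'])
  · refine sup_le ?_ (LinearMap.ker_le_comap T)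
    rintro _ ⟨w, hw, rfl⟩
    rw [Submodule.mem_comap, hS w (hW hw)]
    exact hw

/-- The preimage under a linear map of a rational family of subspaces of its range is rational. -/
lemma HasLocalLifts.comap {m d m' : ℕ} (T : (Fin n → K) →ₗ[K] (Fin n → K)) {B : X → Gr K m n}
    (hB : HasLocalLifts K B) (hBT : ∀ x, (B x).1 ≤ LinearMap.range T)
    (hd : Module.finrank K (LinearMap.ker T) = d) (hm : m + d = m') {ψ : X → Gr K m' n}
    (hψ : ∀ x, (ψ x).1 = (B x).1.comap T) : HasLocalLifts K ψ := by
  subst hm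
  obtain ⟨S, hS⟩ := T.exists_section_on_range
  let κ := Module.finBasisOfFinrankEq K (LinearMap.ker T) hd
  have hκ : Submodule.span K (Set.range fun j => (κ j : Fin n → K)) = LinearMap.ker T := by
    have : (Set.range fun j => (κ j : Fin n → K)) = (LinearMap.ker T).subtype '' Set.range κ := by
      rw [← Set.range_comp]; rfl
    rw [this, Submodule.span_image, κ.span_eq, Submodule.map_top, Submodule.range_subtype]
  refine hasLocalLifts_gr fun x a ha => ?_
  obtain ⟨v, hv, hvB⟩ := hB.exists_rows x a ha
  refine ⟨Fin.append (fun j b => S (v j b)) (fun j _ => (κ j : Fin n → K)), fun j => ?_, ?_⟩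
  · refine Fin.addCases (fun j => ?_) (fun j => ?_) j
    · simpa using (hv j).linearMap S
    · simpa using IsRationalVecAt.const _
  · filter_upwards [hvB] with b hb y hy
    have : (Set.range fun j => (Fin.append (fun j b => S (v j b))
        (fun j (_ : Idx K X → K) => (κ j : Fin n → K)) j b)) =
        (S '' Set.range fun j => v j b) ∪ Set.range fun j => (κ j : Fin n → K) := by
      rw [← Set.range_comp]
      ext z
      simp only [Set.mem_range, Set.mem_union, Function.comp_apply]
      constructor
      · rintro ⟨j, rfl⟩
        refine Fin.addCases (fun j => ?_) (fun j => ?_) j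
        · exact Or.inl ⟨j, by simp⟩
        · exact Or.inr ⟨j, by simp⟩
      · rintro (⟨j, rfl⟩ | ⟨j, rfl⟩)
        · exact ⟨Fin.castAdd _ j, by simp⟩
        · exact ⟨Fin.natAdd _ j, by simp⟩
    rw [this, Submodule.span_union, hκ, Submodule.span_image, hb y hy, hψ,
      Submodule.comap_eq_map_section_sup_ker hS (hBT y)]

end Grassmannians

/-! ### Sequences of subspaces -/

section GrProd

variable {K : Type*} [Field K] {n r : ℕ}

/-- The member of dimension `i` of a partial flag, prolonged by `0` and by the whole space. -/
def GrProd.flag (F : GrProd K n r) : ℕ → Submodule K (Fin n → K)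
  | 0 => ⊥
  | i + 1 => if h : i < r then (F ⟨i, h⟩).1 else ⊤

@[simp] lemma GrProd.flag_zero (F : GrProd K n r) : F.flag 0 = ⊥ := rfl

lemma GrProd.flag_succ (F : GrProd K n r) {i : ℕ} (h : i < r) :
    F.flag (i + 1) = (F ⟨i, h⟩).1 := dif_pos h

lemma GrProd.finrank_flag (F : GrProd K n r) {i : ℕ} (h : i ≤ r) :
    Module.finrank K (F.flag i) = i := by
  cases i with
  | zero => exact finrank_bot K _
  | succ i => rw [F.flag_succ h]; exact (F ⟨i, h⟩).2

lemma GrProd.flag_trunc {s : ℕ} (h : r ≤ s) (F : GrProd K n s) {i : ℕ} (hi : i ≤ r) :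
    (GrProd.trunc K h F).flag i = F.flag i := by
  cases i with
  | zero => rfl
  | succ i => rw [GrProd.flag_succ _ hi, GrProd.flag_succ _ (hi.trans h)]; rfl

lemma GrProd.ext_flag {F G : GrProd K n r} (h : ∀ i ≤ r, F.flag i = G.flag i) : F = G := by
  funext i
  apply Subtype.ext
  have := h (i + 1) i.2
  rwa [GrProd.flag_succ _ i.2, GrProd.flag_succ _ i.2] at this

/-- The member of dimension `i` as a point of the Grassmannian. -/
def GrProd.member {i : ℕ} (h : i ≤ r) (F : GrProd K n r) : Gr K i n :=
  ⟨F.flag i, F.finrank_flag h⟩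

lemma GrProd.hasLocalLifts_member {i : ℕ} (h : i ≤ r) :
    HasLocalLifts K (GrProd.member h : GrProd K n r → Gr K i n) := by
  cases i with
  | zero =>
    refine hasLocalLifts_gr fun x a _ => ⟨fun j _ => j.elim0, fun j => j.elim0, ?_⟩
    refine Filter.Eventually.of_forall fun b y _ => ?_
    simp [GrProd.member]
  | succ i =>
    refine hasLocalLifts_gr fun x a _ =>
      ⟨fun j b c => b ⟨⟨i, h⟩, (j, c)⟩, fun j c => IsRationalAt.coord _, ?_⟩
    refine Filter.Eventually.of_forall fun b y hy => ?_
    exact (hy ⟨i, h⟩).trans (GrProd.flag_succ _ h).symm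

lemma GrProd.hasLocalLifts_trunc {s : ℕ} (h : r ≤ s) :
    HasLocalLifts K (GrProd.trunc K h : GrProd K n s → GrProd K n r) :=
  HasLocalLifts.of_forall _ (fun b s => b ⟨Fin.castLE h s.1, s.2⟩)
    (fun _ _ => IsRationalAt.coord _) fun _ _ hy i => hy (Fin.castLE h i)

/-- Prolongation of a partial flag. -/
def GrProd.snoc (F : GrProd K n r) (W : Gr K (r + 1) n) : GrProd K n (r + 1) :=
  Fin.snoc (α := fun i : Fin (r + 1) => Gr K (i + 1) n) F W

lemma GrProd.trunc_snoc (F : GrProd K n r) (W : Gr K (r + 1) n) :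
    GrProd.trunc K (Nat.le_succ r) (F.snoc W) = F := by
  funext i
  exact Fin.snoc_castSucc (α := fun i : Fin (r + 1) => Gr K (i + 1) n) W F i

lemma GrProd.flag_snoc_last (F : GrProd K n r) (W : Gr K (r + 1) n) :
    (F.snoc W).flag (r + 1) = W.1 := by
  rw [GrProd.flag_succ _ (Nat.lt_succ_self r)]
  exact congrArg Subtype.val
    (Fin.snoc_last (α := fun i : Fin (r + 1) => Gr K (i + 1) n) W F)

lemma GrProd.exists_prolongation (F : GrProd K n r) (W : Submodule K (Fin n → K))
    (hW : Module.finrank K W = r + 1) :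
    ∃ F' : GrProd K n (r + 1), GrProd.trunc K (Nat.le_succ r) F' = F ∧ F'.flag (r + 1) = W :=
  ⟨F.snoc ⟨W, hW⟩, GrProd.trunc_snoc _ _, GrProd.flag_snoc_last _ _⟩

lemma GrProd.ext_trunc {F G : GrProd K n (r + 1)}
    (h : GrProd.trunc K (Nat.le_succ r) F = GrProd.trunc K (Nat.le_succ r) G)
    (h' : F.flag (r + 1) = G.flag (r + 1)) : F = G := by
  refine GrProd.ext_flag fun i hi => ?_
  rcases Nat.lt_or_eq_of_le hi with hi | rfl
  · rw [← GrProd.flag_trunc (Nat.le_succ r) F (Nat.lt_succ_iff.1 hi), h,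
      GrProd.flag_trunc _ _ (Nat.lt_succ_iff.1 hi)]
  · exact h'

lemma HasLocalLifts.snoc {X : Type*} [HomCoords K X] {φ : X → GrProd K n r}
    {ψ : X → Gr K (r + 1) n} (hφ : HasLocalLifts K φ) (hψ : HasLocalLifts K ψ) :
    HasLocalLifts K (fun x => (φ x).snoc (ψ x)) := by
  intro x a ha
  obtain ⟨L, hL, hLφ⟩ := hφ x a ha
  obtain ⟨M, hM, hMψ⟩ := hψ x a ha
  refine ⟨fun b s => Fin.snoc (α := fun i : Fin (r + 1) => Idx K (Gr K (i + 1) n) → K)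
    (fun i j => L b ⟨i, j⟩) (M b) s.1 s.2, ?_, ?_⟩
  · rintro ⟨i, j⟩
    revert j
    refine Fin.lastCases ?_ (fun i => ?_) i
    · intro j
      simpa using hM j
    · intro j
      simpa using hL ⟨i, j⟩
  · filter_upwards [hLφ, hMψ] with b h1 h2 y hy i
    refine Fin.lastCases ?_ (fun i => ?_) i
    · simpa [GrProd.snoc] using h2 y hy
    · simpa [GrProd.snoc] using h1 y hy i

end GrProd

/-! ### Towers of partial flags -/

section Tower

variable {K : Type*} [Field K] {n r : ℕ}

/-- The map between sets of partial flags which forgets the last member. -/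
def truncMap {Z' : Set (GrProd K n (r + 1))} {Z : Set (GrProd K n r)}
    (h : ∀ F ∈ Z', GrProd.trunc K (Nat.le_succ r) F ∈ Z) (F : Z') : Z :=
  ⟨GrProd.trunc K (Nat.le_succ r) F.1, h F.1 F.2⟩

lemma hasLocalLifts_truncMap {Z' : Set (GrProd K n (r + 1))} {Z : Set (GrProd K n r)}
    (h : ∀ F ∈ Z', GrProd.trunc K (Nat.le_succ r) F ∈ Z) : HasLocalLifts K (truncMap h) :=
  (GrProd.hasLocalLifts_trunc (Nat.le_succ r)).comp (HasLocalLifts.val _)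

/-- If the last member is a rational function of the others, forgetting it is an isomorphism. -/
lemma exists_equiv_truncMap {Z' : Set (GrProd K n (r + 1))} {Z : Set (GrProd K n r)}
    (h : ∀ F ∈ Z', GrProd.trunc K (Nat.le_succ r) F ∈ Z) {ψ : Z → Gr K (r + 1) n}
    (hψ : HasLocalLifts K ψ)
    (hZ : ∀ F : GrProd K n (r + 1), F ∈ Z' ↔
      ∃ hF : GrProd.trunc K (Nat.le_succ r) F ∈ Z, F.flag (r + 1) = (ψ ⟨_, hF⟩).1) :
    ∃ φ : Z' ≃ Z, HasLocalLifts K φ ∧ HasLocalLifts K φ.symm ∧ ⇑φ = truncMap h := by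
  have hmem : ∀ F : Z, F.1.snoc (ψ F) ∈ Z' := by
    intro F
    have hF : GrProd.trunc K (Nat.le_succ r) (F.1.snoc (ψ F)) = F.1 := GrProd.trunc_snoc _ _
    refine (hZ _).2 ⟨by rw [hF]; exact F.2, ?_⟩
    rw [GrProd.flag_snoc_last]
    congr 2
    exact Subtype.ext hF.symm
  refine ⟨⟨truncMap h, fun F => ⟨F.1.snoc (ψ F), hmem F⟩, fun F => ?_, fun F => ?_⟩,
    hasLocalLifts_truncMap h, (HasLocalLifts.val _).snoc hψ, rfl⟩
  · apply Subtype.ext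
    refine GrProd.ext_trunc (GrProd.trunc_snoc _ _) ?_
    rw [GrProd.flag_snoc_last]
    obtain ⟨hF, h'⟩ := (hZ F.1).1 F.2
    exact h'.symm
  · exact Subtype.ext (GrProd.trunc_snoc _ _)

end Tower

/-! ### The lines in a plane bundle -/

section Planes

variable {K : Type*} [Field K]

section LinearAlgebra

variable {V : Type*} [AddCommGroup V] [Module K V]
  {W M C F : Submodule K V} {r : ℕ} {β : V →ₗ[K] (Fin 2 → K)}

lemma apply_ne_zero_of_mem_inf (hβ : Disjoint M (C ⊓ LinearMap.ker β)) (hFM : F ≤ M) {v : V}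
    (hv : v ∈ F ⊓ C) (h0 : v ≠ 0) : β v ≠ 0 := fun h =>
  h0 (Submodule.disjoint_def.1 hβ v (hFM hv.1) ⟨hv.2, h⟩)

lemma notMem_of_mem_inf (hC : IsCompl W C) {v : V} (hv : v ∈ F ⊓ C) (h0 : v ≠ 0) : v ∉ W :=
  fun h => h0 (Submodule.disjoint_def.1 hC.disjoint v h hv.2)

variable [FiniteDimensional K V]

/-- By the modular law, `M ⊓ C` is a complement of `W` inside `M`. It serves as a model of the
quotient `M / W`. -/
lemma finrank_inf_of_isCompl (hC : IsCompl W C) (hWM : W ≤ M) :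
    Module.finrank K W + Module.finrank K (M ⊓ C : Submodule K V) = Module.finrank K M := by
  have h1 : W ⊔ M ⊓ C = M := by
    rw [inf_comm, ← sup_inf_assoc_of_le _ hWM, hC.sup_eq_top, top_inf_eq]
  have h2 : W ⊓ (M ⊓ C) = ⊥ :=
    le_bot_iff.1 ((inf_le_inf_left W inf_le_right).trans hC.inf_eq_bot.le)
  have := Submodule.finrank_sup_add_finrank_inf_eq W (M ⊓ C)
  rw [h1, h2, finrank_bot] at this
  omega

lemma sup_span_singleton_eq (hW : Module.finrank K W = r) (hF : Module.finrank K F = r + 1)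
    (hWF : W ≤ F) {v : V} (hv : v ∈ F) (hvW : v ∉ W) : W ⊔ Submodule.span K {v} = F := by
  have hle : W ⊔ Submodule.span K {v} ≤ F :=
    sup_le hWF ((Submodule.span_singleton_le_iff_mem _ _).2 hv)
  refine Submodule.eq_of_le_of_finrank_le hle ?_
  have hlt : W < W ⊔ Submodule.span K {v} := by
    refine lt_of_le_of_ne le_sup_left fun h => hvW ?_
    rw [h]
    exact Submodule.mem_sup_right (Submodule.mem_span_singleton_self v)
  have := Submodule.finrank_lt_finrank_of_lt hlt
  omega

/-- `M ⊓ C` has dimension two and `β` is injective on it, so `β` identifies this model of `M / W`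
with `K ^ 2`. -/
lemma exists_mem_inf_eq (hC : IsCompl W C) (hWM : W ≤ M)
    (hM : Module.finrank K M = Module.finrank K W + 2) (hβ : Disjoint M (C ⊓ LinearMap.ker β))
    (x : Fin 2 → K) : ∃ v ∈ M ⊓ C, β v = x := by
  have hfin := finrank_inf_of_isCompl hC hWM
  let g : (M ⊓ C : Submodule K V) →ₗ[K] (Fin 2 → K) := β ∘ₗ (M ⊓ C).subtype
  have hinj : Function.Injective g := by
    rw [← LinearMap.ker_eq_bot, LinearMap.ker_eq_bot']
    intro v hv
    apply Subtype.ext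
    exact Submodule.disjoint_def.1 hβ v.1 v.2.1 ⟨v.2.2, hv⟩
  have hsurj : Function.Surjective g :=
    (LinearMap.injective_iff_surjective_of_finrank_eq_finrank (by
      rw [Module.finrank_fin_fun]; omega)).1 hinj
  obtain ⟨v, hv⟩ := hsurj x
  exact ⟨v.1, v.2, hv⟩

lemma finrank_map_inf (hC : IsCompl W C) (hWF : W ≤ F) (hFM : F ≤ M)
    (hF : Module.finrank K F = Module.finrank K W + 1) (hβ : Disjoint M (C ⊓ LinearMap.ker β)) :
    Module.finrank K ((F ⊓ C).map β) = 1 := by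
  have hfin := finrank_inf_of_isCompl hC hWF
  have hd : Disjoint (F ⊓ C) (LinearMap.ker β) := by
    rw [Submodule.disjoint_def]
    intro v hv h0
    exact Submodule.disjoint_def.1 hβ v (hFM hv.1) ⟨hv.2, h0⟩
  have : Module.finrank K ((F ⊓ C).map β) = Module.finrank K (F ⊓ C : Submodule K V) := by
    rw [← LinearMap.range_domRestrict]
    exact LinearMap.finrank_range_of_inj (LinearMap.injective_domRestrict_iff.2 hd)
  omega

end LinearAlgebra

variable {n r : ℕ}

/-- Such a `β` gives coordinates on the plane `M / W`, extended to the whole space by zero on `W`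
and on a complement of `M`. -/
lemma exists_linearMap_two {V : Type*} [AddCommGroup V] [Module K V] [FiniteDimensional K V]
    {W M : Submodule K V} (hWM : W ≤ M) (hM : Module.finrank K M = Module.finrank K W + 2) :
    ∃ β : V →ₗ[K] (Fin 2 → K), M ⊓ LinearMap.ker β ≤ W := by
  obtain ⟨C, hC⟩ := W.exists_isCompl
  obtain ⟨D, hD⟩ := M.exists_isCompl
  have hfin := finrank_inf_of_isCompl hC hWM
  have hWL : W ⊔ M ⊓ C = M := by
    rw [inf_comm, ← sup_inf_assoc_of_le _ hWM, hC.sup_eq_top, top_inf_eq]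
  have hMWD : M ⊓ (W ⊔ D) ≤ W := by
    rw [inf_comm, sup_inf_assoc_of_le _ hWM, inf_comm D, hD.inf_eq_bot, sup_bot_eq]
  have hcompl : IsCompl (M ⊓ C) (W ⊔ D) := by
    constructor
    · rw [disjoint_iff_inf_le]
      refine le_trans ?_ hC.inf_eq_bot.le
      exact le_inf ((inf_le_inf_right _ inf_le_left).trans hMWD) (inf_le_left.trans inf_le_right)
    · rw [codisjoint_iff_le_sup, ← sup_assoc, sup_comm (M ⊓ C), hWL, hD.sup_eq_top]
  have e : (M ⊓ C : Submodule K V) ≃ₗ[K] (Fin 2 → K) :=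
    LinearEquiv.ofFinrankEq _ _ (by rw [Module.finrank_fin_fun]; omega)
  refine ⟨e.toLinearMap ∘ₗ (M ⊓ C).projectionOnto (W ⊔ D) hcompl, ?_⟩
  rw [LinearEquiv.ker_comp, Submodule.ker_projectionOnto]
  exact hMWD

/-- Splitting a rational vector along a rational subspace and a fixed complement of its value. -/
lemma exists_rational_splitting {ι : Type*} {a : ι → K} {m : ℕ} {w : Fin m → (ι → K) → Fin n → K}
    (hw : ∀ j, IsRationalVecAt (w j) a) {W C : Submodule K (Fin n → K)}
    (hW : Submodule.span K (Set.range fun j => w j a) = W) (hm : Module.finrank K W = m)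
    (hC : IsCompl W C) {v : (ι → K) → Fin n → K} (hv : IsRationalVecAt v a) :
    ∃ k : (ι → K) → Fin n → K, IsRationalVecAt k a ∧
      ∀ᶠ b in zarNhds a, k b ∈ C ∧ v b - k b ∈ Submodule.span K (Set.range fun j => w j b) := by
  -- The `w j a` are a basis modulo `C`. Cramer's rule gives the combination of the `w j` congruent
  -- to `v` modulo `C`; subtracting it from `v` leaves the component in `C`.
  have e : ((Fin n → K) ⧸ C) ≃ₗ[K] (Fin m → K) :=
    LinearEquiv.ofFinrankEq _ _ (by
      rw [Module.finrank_fin_fun, ← hm]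
      exact (Submodule.quotientEquivOfIsCompl C W hC.symm).finrank_eq)
  let α : (Fin n → K) →ₗ[K] (Fin m → K) := e.toLinearMap ∘ₗ C.mkQ
  have hα : LinearMap.ker α = C := by rw [LinearEquiv.ker_comp, Submodule.ker_mkQ]
  have hli : LinearIndependent K fun j => α (w j a) :=
    ((linearIndependent_mkQ_iff_disjoint hW hm C).2 hC.disjoint).map' e.toLinearMap
      (LinearEquiv.ker e)
  obtain ⟨t, ht, hsol⟩ := IsRationalVecAt.exists_solution (y := fun j b => α (w j b))
    (x := fun b => α (v b)) (fun j => (hw j).linearMap α) (hv.linearMap α) hli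
  refine ⟨fun b => v b - ∑ j, t j b • w j b, hv.sub (IsRationalVecAt.sum_smul ht hw), ?_⟩
  filter_upwards [hsol] with b hb
  constructor
  · rw [← hα, LinearMap.mem_ker, map_sub, map_sum, ← hb]
    simp
  · rw [sub_sub_cancel]
    exact Submodule.sum_mem _ fun j _ => Submodule.smul_mem _ _ (Submodule.subset_span ⟨j, rfl⟩)

/-- The partial flags whose last member runs through the lines in a rational plane bundle. -/
theorem isLiftedProjLineBundle_truncMap {Z' : Set (GrProd K n (r + 1))} {Z : Set (GrProd K n r)}
    (h : ∀ F ∈ Z', GrProd.trunc K (Nat.le_succ r) F ∈ Z) {M : Z → Gr K (r + 2) n}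
    (hM : HasLocalLifts K M) (hWM : ∀ z : Z, z.1.flag r ≤ (M z).1)
    (hZ : ∀ F : GrProd K n (r + 1), F ∈ Z' ↔
      ∃ hF : GrProd.trunc K (Nat.le_succ r) F ∈ Z,
        F.flag r ≤ F.flag (r + 1) ∧ F.flag (r + 1) ≤ (M ⟨_, hF⟩).1) :
    IsLiftedProjLineBundle K (truncMap h) := by
  refine ⟨hasLocalLifts_truncMap h, fun z₀ => ?_⟩
  have hWfin : ∀ z : Z, Module.finrank K (z.1.flag r) = r := fun z => z.1.finrank_flag le_rfl
  have hMfin : ∀ z : Z, Module.finrank K (M z).1 = Module.finrank K (z.1.flag r) + 2 :=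
    fun z => by rw [hWfin]; exact (M z).2
  obtain ⟨C, hC⟩ := (z₀.1.flag r).exists_isCompl
  obtain ⟨β, hβ⟩ := exists_linearMap_two (hWM z₀) (hMfin z₀)
  -- Over `U` the fixed `C` remains complementary to `W_z = z.1.flag r`, and the fixed `β` maps `M_z
  -- ⊓ C` isomorphically to `K ^ 2`. The trivialization sends `F` to the line `β (F ⊓ C)`; its
  -- inverse sends a line `l` to `W_z` plus the line of `M_z ⊓ C` over `l`.
  let U : Set Z := {z | Disjoint (z.1.flag r) C ∧ Disjoint (M z).1 (C ⊓ LinearMap.ker β)}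
  have hU : @IsOpen Z (zariski K Z) U := by
    refine @IsOpen.inter _ (zariski K Z) _ _ ?_ ?_
    · exact ((GrProd.hasLocalLifts_member le_rfl).comp
        (HasLocalLifts.val (K := K) (· ∈ Z))).isOpen_preimage (Gr.isOpen_disjoint r C)
    · exact hM.isOpen_preimage (Gr.isOpen_disjoint (r + 2) _)
  have hz₀ : z₀ ∈ U := by
    refine ⟨hC.disjoint, ?_⟩
    rw [disjoint_iff_inf_le]
    refine le_trans ?_ hC.inf_eq_bot.le
    exact le_inf (le_trans (inf_le_inf_left _ inf_le_right) hβ) (inf_le_right.trans inf_le_left)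
  have hUC : ∀ z ∈ U, IsCompl (z.1.flag r) C := by
    intro z hz
    refine (Submodule.isCompl_iff_disjoint _ _ ?_).2 hz.1
    have := Submodule.finrank_add_eq_of_isCompl hC
    rw [hWfin] at this ⊢
    exact this.ge
  -- the members of dimension `r + 1`
  have hWF : ∀ x : Z', (truncMap h x).1.flag r ≤ x.1.flag (r + 1) := fun x => by
    rw [truncMap, GrProd.flag_trunc _ _ le_rfl]
    exact ((hZ x.1).1 x.2).2.1
  have hFM : ∀ x : Z', x.1.flag (r + 1) ≤ (M (truncMap h x)).1 := fun x => ((hZ x.1).1 x.2).2.2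
  have hFfin : ∀ x : Z', Module.finrank K (x.1.flag (r + 1)) = r + 1 :=
    fun x => x.1.finrank_flag le_rfl
  have hline : ∀ x : {x : Z' // truncMap h x ∈ U},
      Module.finrank K ((x.1.1.flag (r + 1) ⊓ C).map β) = 1 := fun x =>
    finrank_map_inf (hUC _ x.2) (hWF x.1) (hFM x.1) (by rw [hFfin, hWfin]) x.2.2
  let E : {x : Z' // truncMap h x ∈ U} → ProjLine K := fun x => Projectivization.mk'' _ (hline x)
  have hE : ∀ (x : {x : Z' // truncMap h x ∈ U}) (v), v ∈ x.1.1.flag (r + 1) ⊓ C →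
      (hv : β v ≠ 0) → Projectivization.mk K (β v) hv = E x := by
    intro x v hv h0
    apply Projectivization.submodule_injective
    rw [Projectivization.submodule_mk'', Projectivization.submodule_mk]
    refine Submodule.eq_of_le_of_finrank_le ?_ ?_
    · rw [Submodule.span_singleton_le_iff_mem]
      exact ⟨v, hv, rfl⟩
    · rw [hline, finrank_span_singleton h0]
  have hex : ∀ x : {x : Z' // truncMap h x ∈ U}, ∃ v ∈ x.1.1.flag (r + 1) ⊓ C, v ≠ 0 := by
    intro x
    have h1 := finrank_inf_of_isCompl (hUC _ x.2) (hWF x.1)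
    rw [hWfin, hFfin] at h1
    apply Submodule.exists_mem_ne_zero_of_ne_bot
    intro h0
    rw [h0, finrank_bot] at h1
    omega
  have hFeq : ∀ (x : {x : Z' // truncMap h x ∈ U}) (v), v ∈ x.1.1.flag (r + 1) ⊓ C → v ≠ 0 →
      (truncMap h x.1).1.flag r ⊔ Submodule.span K {v} = x.1.1.flag (r + 1) := by
    intro x v hv h0
    exact sup_span_singleton_eq (hWfin _) (hFfin _) (hWF x.1) hv.1 (notMem_of_mem_inf (hUC _ x.2) hv h0)
  -- the member is determined by the line
  have hdet : ∀ (x : {x : Z' // truncMap h x ∈ U}) (k), k ∈ (M (truncMap h x.1)).1 ⊓ C →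
      (hk : β k ≠ 0) → Projectivization.mk K (β k) hk = E x →
      (truncMap h x.1).1.flag r ⊔ Submodule.span K {k} = x.1.1.flag (r + 1) := by
    intro x k hk h0 hkE
    have hk' : β k ∈ (x.1.1.flag (r + 1) ⊓ C).map β := by
      rw [← Projectivization.submodule_mk'' _ (hline x)]
      change β k ∈ (E x).submodule
      rw [← hkE, Projectivization.submodule_mk]
      exact Submodule.mem_span_singleton_self _
    obtain ⟨v, hv, hvk⟩ := hk'
    have : v - k = 0 := Submodule.disjoint_def.1 x.2.2 _
      (Submodule.sub_mem _ (hFM x.1 hv.1) hk.1)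
      ⟨Submodule.sub_mem _ hv.2 hk.2, LinearMap.mem_ker.2 (by rw [map_sub, hvk, sub_self])⟩
    rw [sub_eq_zero] at this
    subst this
    exact hFeq x v hv (by rintro rfl; simp at h0)
  let f : {x : Z' // truncMap h x ∈ U} → {z : Z // z ∈ U} × ProjLine K :=
    fun x => (⟨truncMap h x.1, x.2⟩, E x)
  have hf : Function.Bijective f := by
    constructor
    · intro x x' hxx
      have h1 : truncMap h x.1 = truncMap h x'.1 := congrArg (fun t => t.1.1) hxx
      have h2 : E x = E x' := congrArg (fun t => t.2) hxx
      obtain ⟨v, hv, hv0⟩ := hex x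
      have hβv := apply_ne_zero_of_mem_inf x.2.2 (hFM x.1) hv hv0
      apply Subtype.ext
      apply Subtype.ext
      refine GrProd.ext_trunc (congrArg Subtype.val h1) ?_
      rw [← hFeq x v hv hv0, ← hdet x' v ⟨h1 ▸ hFM x.1 hv.1, hv.2⟩ hβv ((hE x v hv hβv).trans h2), h1]
    · rintro ⟨⟨z, hz⟩, l⟩
      obtain ⟨v, hv, hvl⟩ := exists_mem_inf_eq (hUC z hz) (hWM z) (hMfin z) hz.2 l.rep
      have hv0 : v ≠ 0 := by
        rintro rfl
        rw [map_zero] at hvl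
        exact l.rep_nonzero hvl.symm
      have hvW := notMem_of_mem_inf (hUC z hz) hv hv0
      have hfr : Module.finrank K (z.1.flag r ⊔ Submodule.span K {v} : Submodule K (Fin n → K))
          = r + 1 := by
        rw [Submodule.finrank_sup_span_singleton hvW, hWfin]
      obtain ⟨F', htr, hlast⟩ := z.1.exists_prolongation _ hfr
      have hmem : F' ∈ Z' := by
        refine (hZ _).2 ⟨by rw [htr]; exact z.2, ?_, ?_⟩
        · rw [hlast, ← GrProd.flag_trunc (Nat.le_succ r) _ le_rfl, htr]
          exact le_sup_left
        · have : (⟨GrProd.trunc K (Nat.le_succ r) F', by rw [htr]; exact z.2⟩ : Z) = z :=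
            Subtype.ext htr
          rw [this, hlast]
          exact sup_le (hWM z) ((Submodule.span_singleton_le_iff_mem _ _).2 hv.1)
      have htr' : truncMap h ⟨_, hmem⟩ = z := Subtype.ext htr
      refine ⟨⟨⟨_, hmem⟩, by rw [htr']; exact hz⟩, ?_⟩
      refine Prod.ext (Subtype.ext htr') ?_
      have hβv : β v ≠ 0 := by rw [hvl]; exact l.rep_nonzero
      change E _ = l
      rw [← hE _ v ⟨?_, hv.2⟩ hβv]
      · simp only [hvl, Projectivization.mk_rep]
      · change v ∈ F'.flag (r + 1)
        rw [hlast]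
        exact Submodule.mem_sup_right (Submodule.mem_span_singleton_self v)
  have hsplit : ∀ z ∈ U, ∀ v ∈ C, ∀ k ∈ C, v - k ∈ z.1.flag r → k = v := by
    intro z hz v hv k hk hvk
    exact (sub_eq_zero.1 (Submodule.disjoint_def.1 hz.1 _ hvk (Submodule.sub_mem _ hv hk))).symm
  have hmemC : ∀ z ∈ U, ∀ F : Submodule K (Fin n → K), z.1.flag r ≤ F → ∀ v ∈ F, ∀ k ∈ C,
      v - k ∈ z.1.flag r → k ∈ F ⊓ C := by
    intro z _ F hF v hv k hk hvk
    refine ⟨?_, hk⟩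
    have := Submodule.sub_mem _ hv (hF hvk)
    rwa [sub_sub_cancel] at this
  refine ⟨U, hU, hz₀, Equiv.ofBijective f hf, ?_, ?_, fun x => rfl⟩
  · refine HasLocalLifts.prodMk (φ := fun x : {x : Z' // truncMap h x ∈ U} =>
      (⟨truncMap h x.1, x.2⟩ : {z : Z // z ∈ U}))
      ((hasLocalLifts_truncMap h).comp (HasLocalLifts.val _)) ?_
    intro x a ha
    have memF : HasLocalLifts K (fun x : {x : Z' // truncMap h x ∈ U} =>
        GrProd.member (le_refl (r + 1)) x.1.1) :=
      (GrProd.hasLocalLifts_member le_rfl).comp ((HasLocalLifts.val _).comp (HasLocalLifts.val _))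
    have memW : HasLocalLifts K (fun x : {x : Z' // truncMap h x ∈ U} =>
        GrProd.member (le_refl r) (truncMap h x.1).1) :=
      (GrProd.hasLocalLifts_member le_rfl).comp ((HasLocalLifts.val _).comp
        ((hasLocalLifts_truncMap h).comp (HasLocalLifts.val _)))
    obtain ⟨g, hg, hgF⟩ := memF.exists_rows x a ha
    obtain ⟨w, hw, hwW⟩ := memW.exists_rows x a ha
    obtain ⟨v, hv, hv0⟩ := hex x
    have hvF : v ∈ Submodule.span K (Set.range fun j => g j a) := by
      rw [hgF.self_of_zarNhds x ha]
      exact hv.1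
    -- Keeping the coefficients `c` constant extends `v` to a rational vector in the moving member
    -- `F`; projecting it to `C` along the moving `W` gives a vector `k b` of `F ⊓ C`. As `k a = v`
    -- is non-zero, `β (k b)` is a coordinate vector of the line `E` near `a`.
    obtain ⟨c, hc⟩ := (Submodule.mem_span_range_iff_exists_fun K).1 hvF
    obtain ⟨k, hk, hkC⟩ := exists_rational_splitting hw (hwW.self_of_zarNhds x ha) (hWfin _)
      (hUC _ x.2) (IsRationalVecAt.sum_smul (s := Finset.univ)
        (fun j => IsRationalAt.const (c j)) hg)
    have hka : k a = v := by
      have h1 := hkC.self_of_zarNhds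
      rw [hc, hwW.self_of_zarNhds x ha] at h1
      exact hsplit _ x.2 v hv.2 _ h1.1 h1.2
    have hβk : β (k a) ≠ 0 := by
      rw [hka]
      exact apply_ne_zero_of_mem_inf x.2.2 (hFM x.1) hv hv0
    obtain ⟨i, hi⟩ := Function.ne_iff.1 hβk
    refine ⟨fun b => β (k b), hk.linearMap β, ?_⟩
    filter_upwards [hgF, hwW, hkC, (hk.linearMap β i).eventually_ne_zero hi] with b h1 h2 h3 h4 y hy
    have h0 : β (k b) ≠ 0 := fun h0 => h4 (congrFun h0 i)
    rw [h2 y hy] at h3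
    refine ⟨h0, hE y (k b) (hmemC _ y.2 _ (hWF y.1) _ ?_ _ h3.1 h3.2) h0⟩
    have hgy : Submodule.span K (Set.range fun j => g j b) = y.1.1.flag (r + 1) := h1 y hy
    rw [← hgy]
    exact Submodule.sum_mem _ fun j _ => Submodule.smul_mem _ _ (Submodule.subset_span ⟨j, rfl⟩)
  · set e := Equiv.ofBijective f hf with he
    have hesymm : ∀ y, truncMap h (e.symm y).1 = y.1.1 ∧ E (e.symm y) = y.2 := by
      intro y
      have : f (e.symm y) = y := e.apply_symm_apply y
      exact ⟨congrArg (fun t => t.1.1) this, congrArg (fun t => t.2) this⟩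
    have hsn : (fun y => (e.symm y).1.1) =
        fun y => y.1.1.1.snoc (GrProd.member le_rfl (e.symm y).1.1) := by
      funext y
      refine GrProd.ext_trunc ?_ ?_
      · rw [GrProd.trunc_snoc]
        exact congrArg Subtype.val (hesymm y).1
      · rw [GrProd.flag_snoc_last]
        rfl
    have hval : HasLocalLifts K (fun y : {z : Z // z ∈ U} × ProjLine K => y.1.1) :=
      (HasLocalLifts.val _).comp HasLocalLifts.fst
    have hgoal : HasLocalLifts K (fun y => (e.symm y).1.1) := by
      rw [hsn]
      refine HasLocalLifts.snoc ((HasLocalLifts.val _).comp hval) (hasLocalLifts_gr fun y a ha => ?_)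
      have memW : HasLocalLifts K (fun y : {z : Z // z ∈ U} × ProjLine K =>
          GrProd.member (le_refl r) y.1.1.1) :=
        (GrProd.hasLocalLifts_member le_rfl).comp ((HasLocalLifts.val _).comp hval)
      obtain ⟨w, hw, hwW⟩ := memW.exists_rows y a ha
      obtain ⟨g, hg, hgM⟩ := (hM.comp hval).exists_rows y a ha
      -- The vectors over the standard basis of `K ^ 2` are extended, as before, to rational vectors
      -- `k i b` of `M ⊓ C`.
      choose v hv hvβ using fun i : Fin 2 => exists_mem_inf_eq (hUC _ y.1.2) (hWM y.1.1)
        (hMfin y.1.1) y.1.2.2 (Pi.single i 1)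
      have hvM : ∀ i, v i ∈ Submodule.span K (Set.range fun j => g j a) := by
        intro i
        rw [hgM.self_of_zarNhds y ha]
        exact (hv i).1
      choose c hc using fun i => (Submodule.mem_span_range_iff_exists_fun K).1 (hvM i)
      choose k hk hkC using fun i => exists_rational_splitting hw (hwW.self_of_zarNhds y ha)
        (hWfin _) (hUC _ y.1.2) (IsRationalVecAt.sum_smul (s := Finset.univ)
          (fun j => IsRationalAt.const (c i j)) hg)
      have hka : ∀ i, k i a = v i := by
        intro i
        have h1 := (hkC i).self_of_zarNhds
        rw [hc, hwW.self_of_zarNhds y ha] at h1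
        exact hsplit _ y.1.2 _ (hv i).2 _ h1.1 h1.2
      -- The coordinates of the point of the projective line are expressed in the moving basis `β (k
      -- i b)` of `K ^ 2`; the same combination of the `k i b` spans the required member modulo `W`.
      obtain ⟨t, ht, hsol⟩ := IsRationalVecAt.exists_solution (a := a)
        (y := fun i b => β (k i b)) (x := fun b i => b (Sum.inr i))
        (fun i => (hk i).linearMap β) (fun i => IsRationalAt.coord _) (by
          simp only [hka, hvβ]
          convert (Pi.basisFun K (Fin 2)).linearIndependent using 1
          funext i
          simp)
      refine ⟨Fin.snoc (α := fun _ => _ → _) w (fun b => ∑ i, t i b • k i b), fun j => ?_, ?_⟩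
      · refine Fin.lastCases ?_ (fun j => ?_) j
        · rw [Fin.snoc_last]
          exact IsRationalVecAt.sum_smul ht hk
        · rw [Fin.snoc_castSucc]
          exact hw j
      · filter_upwards [hwW, hgM, Filter.eventually_all.2 hkC, hsol] with b h1 h2 h3 h4 z hz
        have hzW : Submodule.span K (Set.range fun j => w j b) = z.1.1.1.flag r := h1 z hz
        have hzM : Submodule.span K (Set.range fun j => g j b) = (M z.1.1).1 := h2 z hz
        have hrange : (Set.range fun j => (Fin.snoc (α := fun _ => _ → _) w
            (fun b => ∑ i, t i b • k i b) : Fin (r + 1) → _ → Fin n → K) j b) =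
            (Set.range fun j => w j b) ∪ {∑ i, t i b • k i b} := by
          ext u
          simp only [Set.mem_range, Set.mem_union, Set.mem_singleton_iff]
          constructor
          · rintro ⟨j, rfl⟩
            refine Fin.lastCases ?_ (fun j => ?_) j
            · exact Or.inr (by rw [Fin.snoc_last])
            · exact Or.inl ⟨j, by rw [Fin.snoc_castSucc]⟩
          · rintro (⟨j, rfl⟩ | rfl)
            · exact ⟨j.castSucc, by rw [Fin.snoc_castSucc]⟩
            · exact ⟨Fin.last r, by rw [Fin.snoc_last]⟩
        rw [hrange, Submodule.span_union, hzW]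
        have hki : ∀ i, k i b ∈ (M z.1.1).1 ⊓ C := by
          intro i
          have h5 := h3 i
          rw [hzW] at h5
          refine hmemC _ z.1.2 _ (hWM _) _ ?_ _ h5.1 h5.2
          rw [← hzM]
          exact Submodule.sum_mem _ fun j _ =>
            Submodule.smul_mem _ _ (Submodule.subset_span ⟨j, rfl⟩)
        obtain ⟨h6, h7⟩ := hz.2
        have h8 : β (∑ i, t i b • k i b) = fun i => b (Sum.inr i) := by
          simp only [map_sum, map_smul]
          exact h4
        have h9 := (hesymm z).1
        have := hdet (e.symm z) (∑ i, t i b • k i b)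
          (by
            rw [h9]
            exact Submodule.sum_mem _ fun i _ => Submodule.smul_mem _ _ (hki i))
          (by rw [h8]; exact h6) (by simp only [h8]; rw [h7, (hesymm z).2])
        rw [h9] at this
        exact this
    exact hgoal

end Planes

/-! ### Nilpotent endomorphisms with two Jordan blocks -/

section TwoBlocks

variable {K : Type*} [Field K] {V : Type*} [AddCommGroup V] [Module K V] {p q : ℕ}
  (e : Module.Basis (Fin p ⊕ Fin q) K V)

/-- The coordinates in the first chain of a basis, prolonged by `0`. -/
noncomputable def coordL (i : ℕ) : V →ₗ[K] K := if h : i < p then e.coord (Sum.inl ⟨i, h⟩) else 0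

/-- The coordinates in the second chain of a basis, prolonged by `0`. -/
noncomputable def coordR (i : ℕ) : V →ₗ[K] K := if h : i < q then e.coord (Sum.inr ⟨i, h⟩) else 0

/-- The vectors in the first chain of a basis, prolonged by `0`. -/
noncomputable def chainL (i : ℕ) : V := if h : i < p then e (Sum.inl ⟨i, h⟩) else 0

/-- The vectors in the second chain of a basis, prolonged by `0`. -/
noncomputable def chainR (i : ℕ) : V := if h : i < q then e (Sum.inr ⟨i, h⟩) else 0

/-- `N` shifts both chains of the basis `e` downwards. -/
structure IsShift (N : V →ₗ[K] V) : Prop where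
  left : ∀ i v, coordL e i (N v) = coordL e (i + 1) v
  right : ∀ i v, coordR e i (N v) = coordR e (i + 1) v

/-- The span of the first `a` and the first `b` vectors in the two chains of a basis. -/
def coordSub (a b : ℕ) : Submodule K V where
  carrier := {v | (∀ i, a ≤ i → coordL e i v = 0) ∧ ∀ i, b ≤ i → coordR e i v = 0}
  add_mem' := by
    rintro v w ⟨h1, h2⟩ ⟨h3, h4⟩
    exact ⟨fun i hi => by rw [map_add, h1 i hi, h3 i hi, add_zero],
      fun i hi => by rw [map_add, h2 i hi, h4 i hi, add_zero]⟩
  zero_mem' := ⟨fun i _ => map_zero _, fun i _ => map_zero _⟩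
  smul_mem' := by
    rintro c v ⟨h1, h2⟩
    exact ⟨fun i hi => by rw [map_smul, h1 i hi, smul_zero],
      fun i hi => by rw [map_smul, h2 i hi, smul_zero]⟩

variable {e}

lemma mem_coordSub {a b : ℕ} {v : V} : v ∈ coordSub e a b ↔
    (∀ i, a ≤ i → coordL e i v = 0) ∧ ∀ i, b ≤ i → coordR e i v = 0 := Iff.rfl

lemma coordL_of_le {i : ℕ} (h : p ≤ i) (v : V) : coordL e i v = 0 := by
  simp [coordL, h.not_gt]

lemma coordR_of_le {i : ℕ} (h : q ≤ i) (v : V) : coordR e i v = 0 := by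
  simp [coordR, h.not_gt]

lemma coordL_inl (i : ℕ) (j : Fin p) : coordL e i (e (Sum.inl j)) = if i = j then 1 else 0 := by
  by_cases h : i < p
  · simp [coordL, h, Finsupp.single_apply, Fin.ext_iff, eq_comm]
  · rw [coordL_of_le (not_lt.1 h), if_neg]
    omega

lemma coordL_inr (i : ℕ) (j : Fin q) : coordL e i (e (Sum.inr j)) = 0 := by
  by_cases h : i < p <;> simp [coordL, h]

lemma coordR_inr (i : ℕ) (j : Fin q) : coordR e i (e (Sum.inr j)) = if i = j then 1 else 0 := by
  by_cases h : i < q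
  · simp [coordR, h, Finsupp.single_apply, Fin.ext_iff, eq_comm]
  · rw [coordR_of_le (not_lt.1 h), if_neg]
    omega

lemma coordR_inl (i : ℕ) (j : Fin p) : coordR e i (e (Sum.inl j)) = 0 := by
  by_cases h : i < q <;> simp [coordR, h]

lemma coordL_chainL (i : ℕ) {j : ℕ} (hj : j < p) :
    coordL e i (chainL e j) = if i = j then 1 else 0 := by
  rw [chainL, dif_pos hj, coordL_inl]

lemma coordR_chainL (i j : ℕ) : coordR e i (chainL e j) = 0 := by
  unfold chainL
  split_ifs
  · exact coordR_inl _ _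
  · exact map_zero _

lemma coordR_chainR (i : ℕ) {j : ℕ} (hj : j < q) :
    coordR e i (chainR e j) = if i = j then 1 else 0 := by
  rw [chainR, dif_pos hj, coordR_inr]

lemma coordL_chainR (i j : ℕ) : coordL e i (chainR e j) = 0 := by
  unfold chainR
  split_ifs
  · exact coordL_inr _ _
  · exact map_zero _

lemma ext_coord {v w : V} (h : ∀ i, coordL e i v = coordL e i w)
    (h' : ∀ i, coordR e i v = coordR e i w) : v = w := by
  apply e.repr.injective
  ext i
  rcases i with i | i
  · simpa [coordL] using h i
  · simpa [coordR] using h' i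

lemma exists_coord_eq (f g : ℕ → K) : ∃ v : V,
    (∀ i, coordL e i v = if i < p then f i else 0) ∧
      ∀ i, coordR e i v = if i < q then g i else 0 := by
  refine ⟨e.repr.symm (Finsupp.equivFunOnFinite.symm
    (Sum.elim (fun i : Fin p => f i) (fun i : Fin q => g i))), fun i => ?_, fun i => ?_⟩
  · by_cases h : i < p <;> simp [coordL, h]
  · by_cases h : i < q <;> simp [coordR, h]

lemma coordSub_mono {a b a' b' : ℕ} (ha : a ≤ a') (hb : b ≤ b') :
    coordSub e a b ≤ coordSub e a' b' :=
  fun _ hv => ⟨fun i hi => hv.1 i (ha.trans hi), fun i hi => hv.2 i (hb.trans hi)⟩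

lemma coordSub_zero_zero : coordSub e 0 0 = ⊥ := by
  rw [eq_bot_iff]
  intro v hv
  refine (Submodule.mem_bot K).2 (ext_coord (e := e) (fun i => ?_) fun i => ?_)
  · rw [hv.1 i (Nat.zero_le i), map_zero]
  · rw [hv.2 i (Nat.zero_le i), map_zero]

lemma coordSub_eq_top {a b : ℕ} (ha : p ≤ a) (hb : q ≤ b) : coordSub e a b = ⊤ := by
  rw [eq_top_iff]
  exact fun v _ => ⟨fun i hi => coordL_of_le (ha.trans hi) v,
    fun i hi => coordR_of_le (hb.trans hi) v⟩

lemma coordSub_min (a b : ℕ) : coordSub e (min a p) (min b q) = coordSub e a b := by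
  apply le_antisymm (coordSub_mono (min_le_left _ _) (min_le_left _ _))
  intro v hv
  refine ⟨fun i hi => ?_, fun i hi => ?_⟩
  · rcases min_le_iff.1 hi with h | h
    · exact hv.1 i h
    · exact coordL_of_le h v
  · rcases min_le_iff.1 hi with h | h
    · exact hv.2 i h
    · exact coordR_of_le h v

lemma chainL_mem {a b i : ℕ} (h : i < a) : chainL e i ∈ coordSub e a b := by
  refine ⟨fun j hj => ?_, fun j _ => coordR_chainL _ _⟩
  by_cases hi : i < p
  · rw [coordL_chainL j hi, if_neg (by omega)]
  · simp [chainL, hi]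

lemma chainR_mem {a b i : ℕ} (h : i < b) : chainR e i ∈ coordSub e a b := by
  refine ⟨fun j _ => coordL_chainR _ _, fun j hj => ?_⟩
  by_cases hi : i < q
  · rw [coordR_chainR j hi, if_neg (by omega)]
  · simp [chainR, hi]

lemma lt_of_chainL_mem {a b i : ℕ} (hi : i < p) (h : chainL e i ∈ coordSub e a b) : i < a := by
  by_contra! hai
  have := h.1 i hai
  rw [coordL_chainL i hi, if_pos rfl] at this
  exact one_ne_zero this

lemma lt_of_chainR_mem {a b i : ℕ} (hi : i < q) (h : chainR e i ∈ coordSub e a b) : i < b := by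
  by_contra! hai
  have := h.2 i hai
  rw [coordR_chainR i hi, if_pos rfl] at this
  exact one_ne_zero this

/-- Peeling off the last coordinate in the first chain. -/
lemma sub_smul_chainL_mem {a b : ℕ} {v : V} (hv : v ∈ coordSub e (a + 1) b) :
    v - coordL e a v • chainL e a ∈ coordSub e a b := by
  refine ⟨fun i hi => ?_, fun i hi => ?_⟩
  · rcases hi.eq_or_lt with rfl | hi
    · by_cases ha : a < p
      · rw [map_sub, map_smul, coordL_chainL a ha, if_pos rfl, smul_eq_mul, mul_one, sub_self]
      · exact coordL_of_le (not_lt.1 ha) _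
    · rw [map_sub, map_smul, hv.1 i hi]
      by_cases ha : a < p
      · rw [coordL_chainL i ha, if_neg (by omega), smul_zero, sub_zero]
      · simp [chainL, ha]
  · rw [map_sub, map_smul, hv.2 i hi, coordR_chainL, smul_zero, sub_zero]

/-- Peeling off the last coordinate in the second chain. -/
lemma sub_smul_chainR_mem {a b : ℕ} {v : V} (hv : v ∈ coordSub e a (b + 1)) :
    v - coordR e b v • chainR e b ∈ coordSub e a b := by
  refine ⟨fun i hi => ?_, fun i hi => ?_⟩
  · rw [map_sub, map_smul, hv.1 i hi, coordL_chainR, smul_zero, sub_zero]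
  · rcases hi.eq_or_lt with rfl | hi
    · by_cases hb : b < q
      · rw [map_sub, map_smul, coordR_chainR b hb, if_pos rfl, smul_eq_mul, mul_one, sub_self]
      · exact coordR_of_le (not_lt.1 hb) _
    · rw [map_sub, map_smul, hv.2 i hi]
      by_cases hb : b < q
      · rw [coordR_chainR i hb, if_neg (by omega), smul_zero, sub_zero]
      · simp [chainR, hb]

lemma finrank_coordSub_of_le {a b : ℕ} (ha : a ≤ p) (hb : b ≤ q) :
    Module.finrank K (coordSub e a b) = a + b := by
  have hli : LinearIndependent K (e ∘ Sum.map (Fin.castLE ha) (Fin.castLE hb)) :=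
    e.linearIndependent.comp _
      (Sum.map_injective.2 ⟨Fin.castLE_injective ha, Fin.castLE_injective hb⟩)
  have hspan : Submodule.span K (Set.range (e ∘ Sum.map (Fin.castLE ha) (Fin.castLE hb))) =
      coordSub e a b := by
    apply le_antisymm
    · rw [Submodule.span_le]
      rintro _ ⟨i | i, rfl⟩
      · have := chainL_mem (e := e) (b := b) i.2
        rwa [chainL, dif_pos (i.2.trans_le ha)] at this
      · have := chainR_mem (e := e) (a := a) i.2
        rwa [chainR, dif_pos (i.2.trans_le hb)] at this
    · intro v hv
      rw [← e.sum_repr v]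
      refine Submodule.sum_mem _ fun i _ => ?_
      rcases i with i | i
      · by_cases hi : (i : ℕ) < a
        · exact Submodule.smul_mem _ _ (Submodule.subset_span ⟨Sum.inl ⟨i, hi⟩, rfl⟩)
        · have := hv.1 i (not_lt.1 hi)
          rw [coordL, dif_pos i.2] at this
          have h0 : e.repr v (Sum.inl i) = 0 := this
          simp [h0]
      · by_cases hi : (i : ℕ) < b
        · exact Submodule.smul_mem _ _ (Submodule.subset_span ⟨Sum.inr ⟨i, hi⟩, rfl⟩)
        · have := hv.2 i (not_lt.1 hi)
          rw [coordR, dif_pos i.2] at this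
          have h0 : e.repr v (Sum.inr i) = 0 := this
          simp [h0]
  rw [← hspan, finrank_span_eq_card hli]
  simp

lemma finrank_coordSub (a b : ℕ) : Module.finrank K (coordSub e a b) = min a p + min b q := by
  rw [← coordSub_min, finrank_coordSub_of_le (min_le_right _ _) (min_le_right _ _)]

namespace IsShift

variable {N : V →ₗ[K] V} (hN : IsShift e N)

include hN

lemma coordL_pow (k i : ℕ) (v : V) : coordL e i ((N ^ k) v) = coordL e (i + k) v := by
  induction k generalizing i with
  | zero => simp
  | succ k ih => rw [pow_succ', Module.End.mul_apply, hN.left, ih, add_assoc, add_comm 1]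

lemma coordR_pow (k i : ℕ) (v : V) : coordR e i ((N ^ k) v) = coordR e (i + k) v := by
  induction k generalizing i with
  | zero => simp
  | succ k ih => rw [pow_succ', Module.End.mul_apply, hN.right, ih, add_assoc, add_comm 1]

/-- `N` shifts coordinate indices by one, so a preimage under `N ^ k` lengthens both initial
segments by `k`. Kernels, ranges and all preimages of coordinate subspaces are computed by this
rule. -/
lemma comap_pow_coordSub (k a b : ℕ) :
    (coordSub e a b).comap (N ^ k) = coordSub e (a + k) (b + k) := by
  ext v
  simp only [Submodule.mem_comap, mem_coordSub, hN.coordL_pow, hN.coordR_pow]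
  refine and_congr ⟨fun h i hi => ?_, fun h i hi => h _ (by omega)⟩
    ⟨fun h i hi => ?_, fun h i hi => h _ (by omega)⟩
  · have := h (i - k) (by omega)
    rwa [Nat.sub_add_cancel (by omega)] at this
  · have := h (i - k) (by omega)
    rwa [Nat.sub_add_cancel (by omega)] at this

lemma ker_pow (k : ℕ) : LinearMap.ker (N ^ k) = coordSub e k k := by
  rw [LinearMap.ker, ← coordSub_zero_zero (e := e), hN.comap_pow_coordSub, zero_add]

lemma range_pow (k : ℕ) : LinearMap.range (N ^ k) = coordSub e (p - k) (q - k) := by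
  apply le_antisymm
  · rintro _ ⟨v, rfl⟩
    refine ⟨fun i hi => ?_, fun i hi => ?_⟩
    · rw [hN.coordL_pow, coordL_of_le (by omega)]
    · rw [hN.coordR_pow, coordR_of_le (by omega)]
  · intro v hv
    obtain ⟨w, h1, h2⟩ := exists_coord_eq (e := e) (fun i => coordL e (i - k) v)
      (fun i => coordR e (i - k) v)
    refine ⟨w, ext_coord (e := e) (fun i => ?_) fun i => ?_⟩
    · rw [hN.coordL_pow, h1, Nat.add_sub_cancel]
      split_ifs with h
      · rfl
      · rw [hv.1 i (by omega)]
    · rw [hN.coordR_pow, h2, Nat.add_sub_cancel]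
      split_ifs with h
      · rfl
      · rw [hv.2 i (by omega)]

lemma pow_chainL {i k : ℕ} (hi : i + k < p) : (N ^ k) (chainL e (i + k)) = chainL e i := by
  refine ext_coord (e := e) (fun j => ?_) fun j => ?_
  · rw [hN.coordL_pow, coordL_chainL _ hi, coordL_chainL _ (by omega)]
    simp
  · rw [hN.coordR_pow, coordR_chainL, coordR_chainL]

lemma apply_chainL {i : ℕ} (hi : i + 1 < p) : N (chainL e (i + 1)) = chainL e i := by
  simpa using hN.pow_chainL (k := 1) hi

lemma apply_chainR {i : ℕ} (hi : i + 1 < q) : N (chainR e (i + 1)) = chainR e i := by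
  refine ext_coord (e := e) (fun j => ?_) fun j => ?_
  · rw [hN.left, coordL_chainR, coordL_chainR]
  · rw [hN.right, coordR_chainR _ hi, coordR_chainR _ (by omega)]
    simp

lemma apply_mem_coordSub {a b : ℕ} {v : V} (hv : v ∈ coordSub e a b) :
    N v ∈ coordSub e (a - 1) (b - 1) := by
  refine ⟨fun i hi => ?_, fun i hi => ?_⟩
  · rw [hN.left, hv.1 _ (by omega)]
  · rw [hN.right, hv.2 _ (by omega)]

lemma finrank_ker_pow {k : ℕ} (hk : k ≤ q) (hqp : q ≤ p) :
    Module.finrank K (LinearMap.ker (N ^ k)) = 2 * k := by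
  rw [hN.ker_pow, finrank_coordSub_of_le (hk.trans hqp) hk, two_mul]

end IsShift

lemma finrank_comap_eq [FiniteDimensional K V] (T : V →ₗ[K] V) (W : Submodule K V) :
    Module.finrank K (W.comap T) =
      Module.finrank K (LinearMap.range T ⊓ W : Submodule K V) +
        Module.finrank K (LinearMap.ker T) := by
  have h := LinearMap.finrank_range_add_finrank_ker (T.domRestrict (W.comap T))
  rw [LinearMap.range_domRestrict, Submodule.map_comap_eq, LinearMap.ker_domRestrict] at h
  rw [← h]
  congr 1
  exact (Submodule.comapSubtypeEquivOfLe (LinearMap.ker_le_comap T)).finrank_eq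

namespace IsShift

variable {N : V →ₗ[K] V} (hN : IsShift e N)

include hN

/-- The kernel of `N ^ k` has dimension at most `2k` for every `k`. This bound suffices to turn
inclusions into equalities in `eq_comap`, without any condition on `W`. -/
lemma finrank_comap_le [FiniteDimensional K V] (k : ℕ) (W : Submodule K V) :
    Module.finrank K (W.comap (N ^ k)) ≤ Module.finrank K W + 2 * k := by
  rw [finrank_comap_eq, hN.ker_pow, finrank_coordSub]
  have := Submodule.finrank_mono (inf_le_right : LinearMap.range (N ^ k) ⊓ W ≤ W)
  omega

lemma finrank_comap [FiniteDimensional K V] {k : ℕ} (hk : k ≤ q) (hqp : q ≤ p) {W : Submodule K V}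
    (hW : W ≤ LinearMap.range (N ^ k)) :
    Module.finrank K (W.comap (N ^ k)) = Module.finrank K W + 2 * k := by
  rw [finrank_comap_eq, hN.finrank_ker_pow hk hqp, inf_eq_right.2 hW]

/-- A subspace of large dimension which `N ^ k` maps to `W` is the preimage of `W`. -/
lemma eq_comap [FiniteDimensional K V] {k : ℕ} {F W : Submodule K V}
    (hF : Module.finrank K W + 2 * k ≤ Module.finrank K F) (h : F ≤ W.comap (N ^ k)) :
    F = W.comap (N ^ k) :=
  Submodule.eq_of_le_of_finrank_le h ((hN.finrank_comap_le k W).trans hF)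

end IsShift

end TwoBlocks

lemma IsAdaptedBasis.isShift {K : Type*} [Field K] {p q : ℕ}
    {x : Matrix.SpecialLinearGroup (Fin (p + q)) K}
    {e : Module.Basis (Fin p ⊕ Fin q) K (Fin (p + q) → K)} (he : IsAdaptedBasis K x e) :
    IsShift e (Matrix.toLin' ((x : Matrix (Fin (p + q)) (Fin (p + q)) K) - 1)) := by
  obtain ⟨h1, h2, h3, h4⟩ := he
  constructor
  · intro i v
    suffices h : coordL e i ∘ₗ Matrix.toLin' ((x : Matrix (Fin (p + q)) (Fin (p + q)) K) - 1) =
        coordL e (i + 1) from LinearMap.congr_fun h v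
    refine e.ext fun j => ?_
    rw [LinearMap.comp_apply]
    rcases j with ⟨j, hj⟩ | ⟨j, hj⟩
    · cases j with
      | zero => rw [h1 _ rfl, map_zero, coordL_inl, if_neg (by simp)]
      | succ j => rw [h2 ⟨j, by omega⟩ ⟨j + 1, hj⟩ rfl, coordL_inl, coordL_inl]; simp
    · cases j with
      | zero => rw [h3 _ rfl, map_zero, coordL_inr]
      | succ j => rw [h4 ⟨j, by omega⟩ ⟨j + 1, hj⟩ rfl, coordL_inr, coordL_inr]
  · intro i v
    suffices h : coordR e i ∘ₗ Matrix.toLin' ((x : Matrix (Fin (p + q)) (Fin (p + q)) K) - 1) =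
        coordR e (i + 1) from LinearMap.congr_fun h v
    refine e.ext fun j => ?_
    rw [LinearMap.comp_apply]
    rcases j with ⟨j, hj⟩ | ⟨j, hj⟩
    · cases j with
      | zero => rw [h1 _ rfl, map_zero, coordR_inl]
      | succ j => rw [h2 ⟨j, by omega⟩ ⟨j + 1, hj⟩ rfl, coordR_inl, coordR_inl]
    · cases j with
      | zero => rw [h3 _ rfl, map_zero, coordR_inr, if_neg (by simp)]
      | succ j => rw [h4 ⟨j, by omega⟩ ⟨j + 1, hj⟩ rfl, coordR_inr, coordR_inr]; simp

/-! ### Words, heights -/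

section Words

/-- The number of letters `true` among the first `i` letters. -/
def numRight (w : ℕ → Bool) : ℕ → ℕ
  | 0 => 0
  | i + 1 => numRight w i + if w i then 1 else 0

/-- The number of letters `false` among the first `i` letters. -/
def numLeft (w : ℕ → Bool) : ℕ → ℕ
  | 0 => 0
  | i + 1 => numLeft w i + if w i then 0 else 1

/-- The height of the lattice path attached to a word. -/
def height (w : ℕ → Bool) (i : ℕ) : ℤ := numRight w i - numLeft w i

/-- The words in which a letter `true` is matched to a later letter `false`, like parentheses, with
`q` letters `true` and `p` letters `false`. -/
structure IsBallot (w : ℕ → Bool) (p q : ℕ) : Prop where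
  lower : ∀ i ≤ p + q, (q : ℤ) - p ≤ height w i
  numRight_eq : numRight w (p + q) = q

/-- The letters in position `i, …, j - 1` are completely matched among themselves. -/
def IsBalanced (w : ℕ → Bool) (i j : ℕ) : Prop :=
  height w i = height w j ∧ ∀ m, i ≤ m → m ≤ j → height w i ≤ height w m

/-- The height attains a minimum in position `s`. -/
def IsLow (w : ℕ → Bool) (s : ℕ) : Prop := ∀ m ≤ s, height w s ≤ height w m

variable {w : ℕ → Bool} {p q : ℕ}

lemma numRight_add_numLeft (w : ℕ → Bool) (i : ℕ) : numRight w i + numLeft w i = i := by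
  induction i with
  | zero => rfl
  | succ i ih =>
    simp only [numRight, numLeft]
    cases w i <;> simp <;> omega

/-- Position and height have the same parity, and heights determine the counts of letters. Matching
intervals therefore have even length. -/
lemma height_add (w : ℕ → Bool) (i : ℕ) : height w i + i = 2 * numRight w i := by
  have := numRight_add_numLeft w i
  unfold height
  omega

@[simp] lemma height_zero (w : ℕ → Bool) : height w 0 = 0 := rfl

lemma numRight_succ_right {i : ℕ} (h : w i = true) : numRight w (i + 1) = numRight w i + 1 := by
  simp [numRight, h]

lemma numRight_succ_left {i : ℕ} (h : w i = false) : numRight w (i + 1) = numRight w i := by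
  simp [numRight, h]

lemma numLeft_succ_right {i : ℕ} (h : w i = true) : numLeft w (i + 1) = numLeft w i := by
  simp [numLeft, h]

lemma numLeft_succ_left {i : ℕ} (h : w i = false) : numLeft w (i + 1) = numLeft w i + 1 := by
  simp [numLeft, h]

lemma height_succ_right {i : ℕ} (h : w i = true) : height w (i + 1) = height w i + 1 := by
  simp [height, numRight_succ_right h, numLeft_succ_right h]; ring

lemma height_succ_left {i : ℕ} (h : w i = false) : height w (i + 1) = height w i - 1 := by
  simp [height, numRight_succ_left h, numLeft_succ_left h]; ring

lemma height_succ (w : ℕ → Bool) (i : ℕ) :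
    height w (i + 1) = height w i + 1 ∨ height w (i + 1) = height w i - 1 := by
  cases h : w i
  · exact Or.inr (height_succ_left h)
  · exact Or.inl (height_succ_right h)

lemma numRight_mono (w : ℕ → Bool) : Monotone (numRight w) :=
  monotone_nat_of_le_succ fun i => by simp [numRight]

lemma numLeft_mono (w : ℕ → Bool) : Monotone (numLeft w) :=
  monotone_nat_of_le_succ fun i => by simp [numLeft]

lemma IsBallot.numRight_le (hw : IsBallot w p q) {i : ℕ} (hi : i ≤ p + q) : numRight w i ≤ q :=
  (numRight_mono w hi).trans hw.numRight_eq.le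

lemma IsBallot.numLeft_eq (hw : IsBallot w p q) : numLeft w (p + q) = p := by
  have := numRight_add_numLeft w (p + q)
  have := hw.numRight_eq
  omega

lemma IsBallot.numLeft_le (hw : IsBallot w p q) {i : ℕ} (hi : i ≤ p + q) : numLeft w i ≤ p :=
  (numLeft_mono w hi).trans hw.numLeft_eq.le

lemma IsBallot.height_eq (hw : IsBallot w p q) : height w (p + q) = q - p := by
  rw [height, hw.numLeft_eq, hw.numRight_eq]

/-- A discrete intermediate value argument, read backwards from `r`: the height moves by unit steps
and cannot cross `h` without attaining it. -/
lemma lt_height_of_ne {i r : ℕ} {h : ℤ} (hne : ∀ m, i < m → m ≤ r → height w m ≠ h)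
    (hr : h < height w r) : ∀ m, i < m → m ≤ r → h < height w m := by
  intro m him hmr
  obtain ⟨d, hd⟩ := Nat.exists_eq_add_of_le hmr
  induction d generalizing m with
  | zero => rwa [← show r = m from hd]
  | succ d ih =>
    have h1 := ih (m + 1) (by omega) (by omega) (by omega)
    have h2 := height_succ w m
    have h3 := hne m him (by omega)
    omega

/-- A letter `false` is matched to an earlier letter `true`, or the height is smaller after it than
it ever was. -/
lemma left_cases {r : ℕ} (hr : w r = false) :
    (∃ i k, i + 2 * (k + 1) = r + 1 ∧ height w i = height w (r + 1) ∧
      ∀ m, i < m → m ≤ r → height w i < height w m) ∨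
    (∃ t u, 2 * t + u = r ∧ height w (r + 1) = -(u + 1 : ℤ) ∧
      ∀ m ≤ r, height w (r + 1) < height w m) := by
  have hr' := height_succ_left hr
  by_cases hex : ∃ i ≤ r, height w i = height w (r + 1)
  · left
    classical
    obtain ⟨i, hi, hih⟩ := hex
    -- The up-step matched to the down-step at `r` starts at the last earlier position whose height
    -- is that of position `r + 1`.
    have hP := Nat.findGreatest_spec (P := fun i => height w i = height w (r + 1)) hi hih
    have hle := Nat.findGreatest_le (P := fun i => height w i = height w (r + 1)) r
    have hgr : ∀ m, Nat.findGreatest (fun i => height w i = height w (r + 1)) r < m → m ≤ r →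
        height w m ≠ height w (r + 1) := fun m h1 h2 => Nat.findGreatest_is_greatest h1 h2
    generalize Nat.findGreatest (fun i => height w i = height w (r + 1)) r = j at *
    have h1 := height_add w j
    have h2 := height_add w (r + 1)
    refine ⟨j, (r - j) / 2, ?_, hP, ?_⟩
    · push_cast at h2
      omega
    · rw [hP]
      exact lt_height_of_ne hgr (by omega)
  · right
    push Not at hex
    have hlt : ∀ m ≤ r, height w (r + 1) < height w m := by
      have := lt_height_of_ne (w := w) (i := 0) (r := r) (h := height w (r + 1))
        (fun m _ hm => hex m hm) (by omega)
      intro m hm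
      rcases Nat.eq_zero_or_pos m with rfl | hm0
      · by_contra! hcon
        have h0 := hex 0 (Nat.zero_le _)
        rcases Nat.eq_zero_or_pos r with rfl | hr0
        · omega
        · have h1 := this 1 (by omega) hr0
          have h2 := height_succ w 0
          simp only [zero_add] at h2
          omega
      · exact this m hm0 hm
    have h0 := hlt 0 (Nat.zero_le _)
    have h2 := height_add w (r + 1)
    simp only [height_zero] at h0
    refine ⟨numRight w (r + 1), r - 2 * numRight w (r + 1), ?_, ?_, hlt⟩ <;> push_cast at h2 <;> omega

end Words

/-! ### Sequences of subspaces adapted to a word -/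

section Adapted

variable {K : Type*} [Field K] {V : Type*} [AddCommGroup V] [Module K V] {p q : ℕ}

/-- The conditions on a partial flag `G 0 ⊂ G 1 ⊂ ⋯ ⊂ G r` imposed by a word: `N` maps each member to
the previous one, a completely matched interval of length `2 k` gives `N ^ k (G j) ⊆ G i`, and the
members in positions of minimal height are coordinate subspaces. -/
structure IsMatched (e : Module.Basis (Fin p ⊕ Fin q) K V) (N : V →ₗ[K] V) (w : ℕ → Bool) (r : ℕ)
    (G : ℕ → Submodule K V) : Prop where
  mono : ∀ i < r, G i ≤ G (i + 1)
  nil : ∀ i < r, G (i + 1) ≤ (G i).comap N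
  bal : ∀ i k, i + 2 * k ≤ r → IsBalanced w i (i + 2 * k) → G (i + 2 * k) ≤ (G i).comap (N ^ k)
  low : ∀ t u : ℕ, 2 * t + u ≤ r → IsLow w (2 * t + u) → height w (2 * t + u) = -u →
    G (2 * t + u) ≤ (coordSub e u 0).comap (N ^ t)

variable {e : Module.Basis (Fin p ⊕ Fin q) K V} {N : V →ₗ[K] V} {w : ℕ → Bool} {r : ℕ}
  {G G' : ℕ → Submodule K V}

namespace IsMatched

lemma congr (h : IsMatched e N w r G) (hG : ∀ i ≤ r, G i = G' i) : IsMatched e N w r G' where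
  mono i hi := by rw [← hG i hi.le, ← hG (i + 1) hi]; exact h.mono i hi
  nil i hi := by rw [← hG i hi.le, ← hG (i + 1) hi]; exact h.nil i hi
  bal i k hi hb := by rw [← hG i (by omega), ← hG _ hi]; exact h.bal i k hi hb
  low t u hi hl hh := by rw [← hG _ hi]; exact h.low t u hi hl hh

lemma of_le {s : ℕ} (h : IsMatched e N w r G) (hs : s ≤ r) : IsMatched e N w s G where
  mono i hi := h.mono i (hi.trans_le hs)
  nil i hi := h.nil i (hi.trans_le hs)
  bal i k hi hb := h.bal i k (hi.trans hs) hb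
  low t u hi hl hh := h.low t u (hi.trans hs) hl hh

lemma zero (hG : G 0 = ⊥) : IsMatched e N w 0 G where
  mono i hi := absurd hi (Nat.not_lt_zero i)
  nil i hi := absurd hi (Nat.not_lt_zero i)
  bal i k hi _ := by
    obtain ⟨rfl, rfl⟩ : i = 0 ∧ k = 0 := by omega
    simp [hG]
  low t u hi _ _ := by
    obtain ⟨rfl, rfl⟩ : t = 0 ∧ u = 0 := by omega
    simp [hG]

/-- Neither a nonempty balanced interval nor a new minimum can end just after an up-step, so only
monotonicity and nilpotency have to be checked. -/
lemma succ_right (h : IsMatched e N w r G) (hr : w r = true) (hmono : G r ≤ G (r + 1))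
    (hnil : G (r + 1) ≤ (G r).comap N) : IsMatched e N w (r + 1) G where
  mono i hi := by
    rcases Nat.lt_succ_iff_lt_or_eq.1 hi with hi | rfl
    · exact h.mono i hi
    · exact hmono
  nil i hi := by
    rcases Nat.lt_succ_iff_lt_or_eq.1 hi with hi | rfl
    · exact h.nil i hi
    · exact hnil
  bal i k hi hb := by
    rcases Nat.le_succ_iff.1 hi with hi | hi
    · exact h.bal i k hi hb
    · rcases Nat.eq_zero_or_pos k with rfl | hk
      · exact fun v hv => by simpa using hv
      · have h1 := hb.2 r (by omega) (by omega)
        have h2 := height_succ_right hr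
        have h3 := hb.1
        rw [hi, Nat.succ_eq_add_one] at h3
        omega
  low t u hi hl hh := by
    rcases Nat.le_succ_iff.1 hi with hi | hi
    · exact h.low t u hi hl hh
    · have h1 := hl r (by omega)
      rw [hi, Nat.succ_eq_add_one] at h1
      have h2 := height_succ_right hr
      omega

/-! ### Prolongation by a left letter matched to an earlier right letter -/

section Matched

lemma isBalanced_of_gt {i : ℕ} (hih : height w i = height w (r + 1))
    (hgt : ∀ m, i < m → m ≤ r → height w i < height w m) : IsBalanced w i (r + 1) := by
  refine ⟨hih, fun m h1 h2 => ?_⟩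
  rcases h1.eq_or_lt with rfl | h1
  · exact le_rfl
  · rcases Nat.le_succ_iff.1 h2 with h2 | rfl
    · exact (hgt m h1 h2).le
    · exact hih.le

variable {i k : ℕ} (hik : i + 2 * (k + 1) = r + 1) (hih : height w i = height w (r + 1))
  (hgt : ∀ m, i < m → m ≤ r → height w i < height w m)

include hik hih hgt

/-- The interval strictly inside a matched pair is itself balanced. -/
lemma le_comap_inner (h : IsMatched e N w r G) (hr : w r = false) :
    G r ≤ (G (i + 1)).comap (N ^ k) := by
  have h1 := hgt (i + 1) (by omega) (by omega)
  have h2 := height_succ w i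
  have h3 := height_succ_left hr
  have hri : r = i + 1 + 2 * k := by omega
  have hbal : IsBalanced w (i + 1) (i + 1 + 2 * k) := by
    rw [← hri]
    refine ⟨by omega, fun m h4 h5 => ?_⟩
    have := hgt m (by omega) h5
    omega
  have := h.bal (i + 1) k (by omega) hbal
  rwa [← hri] at this

lemma le_comap_of_matched (h : IsMatched e N w r G) (hr : w r = false) :
    G r ≤ (G i).comap (N ^ (k + 1)) := by
  intro v hv
  have h1 := le_comap_inner hik hih hgt h hr hv
  have h2 := h.nil i (by omega) h1
  rw [Submodule.mem_comap, pow_succ', Module.End.mul_apply]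
  exact h2

/-- One inclusion implies all new conditions. By dimension `G r` is the full preimage of `G (i + 1)`
under `N ^ k`, which gives nilpotency at the last step. Every nonempty balanced interval ending at
`r + 1` starts at or before `i` and splits there into two balanced ones; a minimum at `r + 1` is
likewise already attained at `i`. -/
lemma succ_of_matched [FiniteDimensional K V] (hN : IsShift e N) (h : IsMatched e N w r G)
    (hr : w r = false) (hfin : ∀ i ≤ r, Module.finrank K (G i) = i) (hmono : G r ≤ G (r + 1))
    (hle : G (r + 1) ≤ (G i).comap (N ^ (k + 1))) : IsMatched e N w (r + 1) G where
  mono j hj := by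
    rcases Nat.lt_succ_iff_lt_or_eq.1 hj with hj | rfl
    · exact h.mono j hj
    · exact hmono
  nil j hj := by
    rcases Nat.lt_succ_iff_lt_or_eq.1 hj with hj | rfl
    · exact h.nil j hj
    · have heq := hN.eq_comap (by rw [hfin _ le_rfl, hfin _ (by omega)]; omega)
        (le_comap_inner hik hih hgt h hr)
      rw [heq]
      intro v hv
      have h1 := h.mono i (by omega) (hle hv)
      rwa [pow_succ, Module.End.mul_apply] at h1
  bal j l hj hb := by
    rcases Nat.le_succ_iff.1 hj with hj | hj
    · exact h.bal j l hj hb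
    rw [Nat.succ_eq_add_one] at hj
    rcases Nat.eq_zero_or_pos l with rfl | hl
    · exact fun v hv => by simpa using hv
    have hji : j ≤ i := by
      by_contra! hcon
      have h1 := hgt j hcon (by omega)
      have h2 := hb.1
      rw [hj] at h2
      omega
    obtain ⟨m, rfl⟩ : ∃ m, i = j + 2 * m := ⟨(i - j) / 2, by omega⟩
    have hb' : IsBalanced w j (j + 2 * m) := by
      refine ⟨by rw [hb.1, hj, hih], fun x h1 h2 => hb.2 x h1 (by omega)⟩
    have h3 := h.bal j m (by omega) hb'
    obtain rfl : l = m + (k + 1) := by omega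
    intro v hv
    rw [hj] at hv
    have h4 := h3 (hle hv)
    rw [Submodule.mem_comap, pow_add, Module.End.mul_apply]
    exact h4
  low t u htu hl hh := by
    rcases Nat.le_succ_iff.1 htu with htu | htu
    · exact h.low t u htu hl hh
    rw [Nat.succ_eq_add_one] at htu
    have h1 := height_add w i
    rw [htu] at hl hh
    obtain ⟨m, rfl⟩ : ∃ m, t = m + (k + 1) := ⟨t - (k + 1), by omega⟩
    obtain rfl : i = 2 * m + u := by omega
    have h2 := h.low m u (by omega) (fun x hx => by rw [hih]; exact hl x (by omega))
      (by rw [hih, hh])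
    intro v hv
    rw [htu] at hv
    have h4 := h2 (hle hv)
    rw [Submodule.mem_comap, pow_add, Module.End.mul_apply]
    exact h4

end Matched

/-! ### Prolongation by a left letter reaching a new minimum -/

section Unmatched

variable {t u : ℕ} (htu : 2 * t + u = r) (hh : height w (r + 1) = -(u + 1 : ℤ))
  (hgt : ∀ m ≤ r, height w (r + 1) < height w m)

include htu hh hgt

lemma le_comap_coordSub (h : IsMatched e N w r G) (hr : w r = false) :
    G r ≤ (coordSub e u 0).comap (N ^ t) := by
  have h3 := height_succ_left hr
  subst htu
  exact h.low t u le_rfl (fun m hm => by have := hgt m hm; omega) (by omega)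

lemma le_comap_of_unmatched (h : IsMatched e N w r G) (hr : w r = false) :
    G r ≤ (coordSub e (u + 1) 0).comap (N ^ t) :=
  (le_comap_coordSub htu hh hgt h hr).trans
    (Submodule.comap_mono (coordSub_mono (Nat.le_succ u) le_rfl))

/-- By dimension `G r` is the full preimage of `coordSub e u 0` under `N ^ t`, which yields
nilpotency at the last step. No nonempty balanced interval ends at a strict minimum, and the numbers
`t` and `u` in the remaining condition are determined by position and height. -/
lemma succ_of_unmatched [FiniteDimensional K V] (hN : IsShift e N) (h : IsMatched e N w r G)
    (hr : w r = false) (hfin : ∀ i ≤ r, Module.finrank K (G i) = i) (hmono : G r ≤ G (r + 1))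
    (hle : G (r + 1) ≤ (coordSub e (u + 1) 0).comap (N ^ t)) : IsMatched e N w (r + 1) G where
  mono j hj := by
    rcases Nat.lt_succ_iff_lt_or_eq.1 hj with hj | rfl
    · exact h.mono j hj
    · exact hmono
  nil j hj := by
    rcases Nat.lt_succ_iff_lt_or_eq.1 hj with hj | rfl
    · exact h.nil j hj
    · have heq := hN.eq_comap (by rw [hfin _ le_rfl, finrank_coordSub]; omega)
        (le_comap_coordSub htu hh hgt h hr)
      rw [heq]
      intro v hv
      have h1 := hN.apply_mem_coordSub (hle hv)
      rw [← Module.End.mul_apply, ← pow_succ', pow_succ, Module.End.mul_apply] at h1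
      exact h1
  bal j l hj hb := by
    rcases Nat.le_succ_iff.1 hj with hj | hj
    · exact h.bal j l hj hb
    rw [Nat.succ_eq_add_one] at hj
    rcases Nat.eq_zero_or_pos l with rfl | hl
    · exact fun v hv => by simpa using hv
    have h1 := hgt j (by omega)
    have h2 := hb.1
    rw [hj] at h2
    omega
  low t' u' htu' hl hh' := by
    rcases Nat.le_succ_iff.1 htu' with htu' | htu'
    · exact h.low t' u' htu' hl hh'
    rw [Nat.succ_eq_add_one] at htu'
    rw [htu'] at hh' ⊢
    obtain rfl : u' = u + 1 := by omega
    obtain rfl : t' = t := by omega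
    exact hle

end Unmatched

/-- Each member of a matched flag lies in the image of a power of `N`. -/
lemma le_range (hN : IsShift e N) (hqp : q ≤ p) (hw : IsBallot w p q) (h : IsMatched e N w r G)
    (h0 : G 0 = ⊥) (hr : r ≤ p + q) {i d : ℕ} (hi : i ≤ r) (hd : d + numRight w i = q) :
    G i ≤ LinearMap.range (N ^ d) := by
  rw [hN.range_pow]
  -- A member is contained in the preimage of an earlier one under some `N ^ k`, and the number of
  -- right letters between the two positions is exactly `k`. Hence an earlier bound with exponent `d
  -- + k` gives one with exponent `d`.
  induction i using Nat.strong_induction_on generalizing d with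
  | _ i ih =>
    rcases Nat.eq_zero_or_pos i with rfl | hpos
    · rw [h0]; exact bot_le
    obtain ⟨i, rfl⟩ : ∃ j, i = j + 1 := ⟨i - 1, by omega⟩
    cases hwi : w i
    · rcases left_cases hwi with ⟨j, k, hjk, hjh, hgt⟩ | ⟨t, u, htu, hh, hgt⟩
      · have hnum : numRight w (i + 1) = numRight w j + (k + 1) := by
          have h1 := height_add w j
          have h2 := height_add w (i + 1)
          omega
        have h1 := ih j (by omega) (by omega) (d := d + (k + 1)) (by omega)
        have h2 := h.bal j (k + 1) (by omega) (by
          rw [hjk]; exact isBalanced_of_gt hjh hgt)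
        rw [hjk] at h2
        refine h2.trans ((Submodule.comap_mono h1).trans ?_)
        rw [hN.comap_pow_coordSub]
        exact coordSub_mono (by omega) (by omega)
      · have h2 := height_add w (i + 1)
        -- At a new minimum no earlier member is available; the ballot condition makes the
        -- coordinate subspace fit into the range.
        have h3 := hw.lower (i + 1) (by omega)
        have h1 := h.low t (u + 1) (by omega)
          (by
            have : 2 * t + (u + 1) = i + 1 := by omega
            rw [this]
            intro m hm
            rcases Nat.le_succ_iff.1 hm with hm | rfl
            · exact (hgt m hm).le
            · exact le_rfl)
          (by
            have : 2 * t + (u + 1) = i + 1 := by omega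
            rw [this, hh]
            push_cast
            ring)
        rw [hN.comap_pow_coordSub] at h1
        have h4 : 2 * t + (u + 1) = i + 1 := by omega
        rw [h4] at h1
        refine h1.trans (coordSub_mono ?_ ?_) <;> push_cast at h2 <;> omega
    · have hnum := numRight_succ_right hwi
      have h1 := ih i (by omega) (by omega) (d := d + 1) (by omega)
      refine (h.nil i (by omega)).trans ((Submodule.comap_mono h1).trans ?_)
      have h2 := hN.comap_pow_coordSub 1 (p - (d + 1)) (q - (d + 1))
      rw [pow_one] at h2
      rw [h2]
      exact coordSub_mono (by omega) (by omega)

end IsMatched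

end Adapted

/-! ### The tower of varieties of matched partial flags -/

section Closed

variable {K : Type*} [Field K] {n : ℕ} {X : Type*} [HomCoords K X]

/-- Incidence conditions between rational families of subspaces are closed. -/
lemma isClosed_le_comap {l m : ℕ} {φ : X → Gr K l n} {ψ : X → Gr K m n} (hφ : HasLocalLifts K φ)
    (hψ : HasLocalLifts K ψ) (T : (Fin n → K) →ₗ[K] (Fin n → K)) :
    @IsClosed X (zariski K X) {x | (φ x).1 ≤ (ψ x).1.comap T} := by
  let _ := zariski K X
  refine ⟨isOpen_zariski_iff.2 fun x hx a ha => ?_⟩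
  obtain ⟨v, hv, hvψ⟩ := Set.not_subset.1 (show ¬ (φ x).1 ≤ (ψ x).1.comap T from hx)
  obtain ⟨g, hg, hgφ⟩ := hφ.exists_rows x a ha
  obtain ⟨w, hw, hwψ⟩ := hψ.exists_rows x a ha
  obtain ⟨C, hC⟩ := (ψ x).1.exists_isCompl
  have hv' : v ∈ Submodule.span K (Set.range fun j => g j a) := by
    rw [hgφ.self_of_zarNhds x ha]
    exact hv
  obtain ⟨c, hc⟩ := (Submodule.mem_span_range_iff_exists_fun K).1 hv'
  obtain ⟨k, hk, hkC⟩ := exists_rational_splitting hw (hwψ.self_of_zarNhds x ha) (ψ x).2 hC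
    ((IsRationalVecAt.sum_smul (s := Finset.univ)
      (fun j => IsRationalAt.const (c j)) hg).linearMap T)
  -- Since `T v` lies outside `ψ x`, its component in `C` along `ψ x` is non-zero. It stays non-zero
  -- nearby, and while `C` remains transverse to the moving `ψ` this excludes the inclusion.
  have hka : k a ≠ 0 := by
    intro h0
    have h1 := hkC.self_of_zarNhds.2
    rw [h0, sub_zero, hc, hwψ.self_of_zarNhds x ha] at h1
    exact hvψ h1
  obtain ⟨i, hi⟩ := Function.ne_iff.1 hka
  have hopen := isOpen_zariski_iff.1 (hψ.isOpen_preimage (Gr.isOpen_disjoint m C)) x hC.disjoint a ha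
  filter_upwards [hgφ, hwψ, hkC, (hk i).eventually_ne_zero hi, hopen] with b h1 h2 h3 h4 h5 y hy hle
  rw [h2 y hy] at h3
  have h6 : T (∑ j, c j • g j b) ∈ (ψ y).1 := by
    refine hle ?_
    rw [← h1 y hy]
    exact Submodule.sum_mem _ fun j _ => Submodule.smul_mem _ _ (Submodule.subset_span ⟨j, rfl⟩)
  have h7 := Submodule.sub_mem _ h6 h3.2
  rw [sub_sub_cancel] at h7
  exact h4 (congrFun (Submodule.disjoint_def.1 (h5 y hy) _ h7 h3.1) i)

end Closed

/-! ### Bundles of matched partial flags, irreducibility and prolongation -/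

section Matched

variable {K : Type*} [Field K] {p q : ℕ} (e : Module.Basis (Fin p ⊕ Fin q) K (Fin (p + q) → K))
  (N : (Fin (p + q) → K) →ₗ[K] (Fin (p + q) → K)) (w : ℕ → Bool)

/-- The partial flags matched to a word. -/
def matchedFlags (r : ℕ) : Set (GrProd K (p + q) r) := {F | IsMatched e N w r F.flag}

variable {e N w}

lemma trunc_mem_matchedFlags_of_le {r s : ℕ} (h : r ≤ s) {F : GrProd K (p + q) s}
    (hF : F ∈ matchedFlags e N w s) : GrProd.trunc K h F ∈ matchedFlags e N w r :=
  (IsMatched.of_le hF h).congr fun _ hi => (GrProd.flag_trunc h F hi).symm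

lemma trunc_mem_matchedFlags (r : ℕ) : ∀ F ∈ matchedFlags e N w (r + 1),
    GrProd.trunc K (Nat.le_succ r) F ∈ matchedFlags e N w r :=
  fun _ hF => trunc_mem_matchedFlags_of_le _ hF

lemma isMatched_of_trunc_mem {r : ℕ} {F : GrProd K (p + q) (r + 1)}
    (hF : GrProd.trunc K (Nat.le_succ r) F ∈ matchedFlags e N w r) : IsMatched e N w r F.flag :=
  IsMatched.congr hF fun _ hi => GrProd.flag_trunc _ F hi

lemma isClosed_matchedFlags (r : ℕ) :
    @IsClosed _ (zariski K (GrProd K (p + q) r)) (matchedFlags e N w r) := by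
  let _ := zariski K (GrProd K (p + q) r)
  have key : ∀ i j, i ≤ r → j ≤ r → ∀ T : (Fin (p + q) → K) →ₗ[K] (Fin (p + q) → K),
      IsClosed {F : GrProd K (p + q) r | F.flag i ≤ (F.flag j).comap T} := fun i j hi hj T =>
    isClosed_le_comap (GrProd.hasLocalLifts_member hi) (GrProd.hasLocalLifts_member hj) T
  have key' : ∀ i, i ≤ r → ∀ (E : Submodule K (Fin (p + q) → K))
      (T : (Fin (p + q) → K) →ₗ[K] (Fin (p + q) → K)),
      IsClosed {F : GrProd K (p + q) r | F.flag i ≤ E.comap T} := fun i hi E T =>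
    isClosed_le_comap (GrProd.hasLocalLifts_member hi)
      (HasLocalLifts.const (Y := Gr K (Module.finrank K E) (p + q)) ⟨E, rfl⟩) T
  have : matchedFlags e N w r =
      {F | ∀ i < r, F.flag i ≤ (F.flag (i + 1)).comap LinearMap.id} ∩
      ({F | ∀ i < r, F.flag (i + 1) ≤ (F.flag i).comap N} ∩
      ({F | ∀ i k, i + 2 * k ≤ r → IsBalanced w i (i + 2 * k) →
        F.flag (i + 2 * k) ≤ (F.flag i).comap (N ^ k)} ∩
      {F | ∀ t u : ℕ, 2 * t + u ≤ r → IsLow w (2 * t + u) → height w (2 * t + u) = -u →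
        F.flag (2 * t + u) ≤ (coordSub e u 0).comap (N ^ t)})) := by
    ext F
    exact ⟨fun h => ⟨h.mono, h.nil, h.bal, h.low⟩, fun h => ⟨h.1, h.2.1, h.2.2.1, h.2.2.2⟩⟩
  rw [this]
  simp only [Set.ofPred_forall]
  refine IsClosed.inter ?_ (IsClosed.inter ?_ (IsClosed.inter ?_ ?_))
  · exact isClosed_iInter fun i => isClosed_iInter fun hi => key _ _ hi.le hi _
  · exact isClosed_iInter fun i => isClosed_iInter fun hi => key _ _ hi hi.le _
  · exact isClosed_iInter fun i => isClosed_iInter fun k => isClosed_iInter fun hi =>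
      isClosed_iInter fun _ => key _ _ hi (by omega) _
  · exact isClosed_iInter fun t => isClosed_iInter fun u => isClosed_iInter fun hi =>
      isClosed_iInter fun _ => isClosed_iInter fun _ => key' _ hi _ _

variable (hN : IsShift e N) (hqp : q ≤ p) (hw : IsBallot w p q)

include hN hqp hw

lemma flag_le_range_pow {r k i : ℕ} (hr : r ≤ p + q) (F : matchedFlags e N w r) (hi : i ≤ r)
    (hk : k + numRight w i ≤ q) : F.1.flag i ≤ LinearMap.range (N ^ k) := by
  have h1 := IsMatched.le_range hN hqp hw F.2 (GrProd.flag_zero _) hr hi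
    (d := q - numRight w i) (by omega)
  refine h1.trans ?_
  rw [hN.range_pow, hN.range_pow]
  exact coordSub_mono (by omega) (by omega)

/-- After a letter `false` the next member is a preimage of an earlier one, or of a fixed
subspace. -/
lemma exists_base_of_left {r : ℕ} (hr : r < p + q) (hwr : w r = false) :
    ∃ (k m : ℕ) (B : matchedFlags e N w r → Gr K m (p + q)), HasLocalLifts K B ∧ m + 2 * k = r + 1 ∧
      k ≤ q ∧ (∀ F, (B F).1 ≤ LinearMap.range (N ^ k)) ∧
      ∀ F : GrProd K (p + q) (r + 1), F ∈ matchedFlags e N w (r + 1) ↔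
        ∃ hF : GrProd.trunc K (Nat.le_succ r) F ∈ matchedFlags e N w r,
          F.flag (r + 1) = (B ⟨_, hF⟩).1.comap (N ^ k) := by
  have hcount := hw.numRight_le (i := r + 1) hr
  rcases left_cases hwr with ⟨i, k, hik, hih, hgt⟩ | ⟨t, u, htu, hh, hgt⟩
  · have hi : i ≤ r := by omega
    have hnum : numRight w (r + 1) = numRight w i + (k + 1) := by
      have h1 := height_add w i
      have h2 := height_add w (r + 1)
      omega
    refine ⟨k + 1, i, fun F => GrProd.member hi F.1,
      (GrProd.hasLocalLifts_member hi).comp (HasLocalLifts.val _), hik, by omega,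
      fun F => flag_le_range_pow hN hqp hw hr.le F hi (by omega), fun F => ⟨fun hF => ?_, ?_⟩⟩
    · refine ⟨trunc_mem_matchedFlags r F hF, ?_⟩
      change _ = ((GrProd.trunc K _ F).flag i).comap _
      rw [GrProd.flag_trunc _ _ hi]
      refine hN.eq_comap ?_ ?_
      · rw [F.finrank_flag le_rfl, F.finrank_flag (by omega)]
        omega
      · have := IsMatched.bal hF i (k + 1) (by omega)
          (by rw [hik]; exact IsMatched.isBalanced_of_gt hih hgt)
        rwa [hik] at this
    · rintro ⟨hF, heq⟩
      have hF' := isMatched_of_trunc_mem hF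
      change _ = ((GrProd.trunc K _ F).flag i).comap _ at heq
      rw [GrProd.flag_trunc _ _ hi] at heq
      refine hF'.succ_of_matched hik hih hgt hN hwr (fun j hj => F.finrank_flag (by omega)) ?_ heq.le
      rw [heq]
      exact hF'.le_comap_of_matched hik hih hgt hwr
  · have hlow := hw.lower (r + 1) hr
    have hadd := height_add w (r + 1)
    push_cast at hadd
    have hfin : Module.finrank K (coordSub e (u + 1) 0) = u + 1 := by
      rw [finrank_coordSub_of_le (by omega) (by omega), add_zero]
    refine ⟨t, u + 1, fun _ => ⟨coordSub e (u + 1) 0, hfin⟩, HasLocalLifts.const _, by omega,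
      by omega, fun F => ?_, fun F => ⟨fun hF => ?_, ?_⟩⟩
    · rw [hN.range_pow]
      exact coordSub_mono (by omega) (by omega)
    · refine ⟨trunc_mem_matchedFlags r F hF, ?_⟩
      have hr1 : 2 * t + (u + 1) = r + 1 := by omega
      refine hN.eq_comap ?_ ?_
      · rw [F.finrank_flag le_rfl]
        change Module.finrank K (coordSub e (u + 1) 0) + 2 * t ≤ r + 1
        omega
      · have := IsMatched.low hF t (u + 1) (by omega)
          (by
            rw [hr1]
            intro m hm
            rcases Nat.le_succ_iff.1 hm with hm | rfl
            · exact (hgt m hm).le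
            · exact le_rfl)
          (by rw [hr1, hh]; push_cast; ring)
        rwa [hr1] at this
    · rintro ⟨hF, heq⟩
      have hF' := isMatched_of_trunc_mem hF
      change _ = (coordSub e (u + 1) 0).comap _ at heq
      refine hF'.succ_of_unmatched htu hh hgt hN hwr (fun j hj => F.finrank_flag (by omega)) ?_ heq.le
      rw [heq]
      exact hF'.le_comap_of_unmatched htu hh hgt hwr

/-- After a letter `false` the next member is a rational function of the previous ones. -/
theorem exists_equiv_matchedFlags {r : ℕ} (hr : r < p + q) (hwr : w r = false) :
    ∃ φ : matchedFlags e N w (r + 1) ≃ matchedFlags e N w r,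
      HasLocalLifts K φ ∧ HasLocalLifts K φ.symm ∧ ⇑φ = truncMap (trunc_mem_matchedFlags r) := by
  obtain ⟨k, m, B, hB, hmk, hk, hBN, hF⟩ := exists_base_of_left hN hqp hw hr hwr
  have hfin : ∀ F, Module.finrank K ((B F).1.comap (N ^ k)) = r + 1 := fun F => by
    rw [hN.finrank_comap hk hqp (hBN F), (B F).2, hmk]
  exact exists_equiv_truncMap _ (ψ := fun F => ⟨(B F).1.comap (N ^ k), hfin F⟩)
    (hB.comap (N ^ k) hBN (hN.finrank_ker_pow hk hqp) hmk fun F => rfl) hF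

/-- After a letter `true` the next member varies in a projective line. -/
theorem isLiftedProjLineBundle_matchedFlags {r : ℕ} (hr : r < p + q) (hwr : w r = true) :
    IsLiftedProjLineBundle K (truncMap (trunc_mem_matchedFlags (e := e) (N := N) (w := w) r)) := by
  have hcount := hw.numRight_le (i := r + 1) hr
  rw [numRight_succ_right hwr] at hcount
  have hrange : ∀ F : matchedFlags e N w r, F.1.flag r ≤ LinearMap.range N := by
    intro F
    have := flag_le_range_pow hN hqp hw (k := 1) hr.le F le_rfl (by omega)
    rwa [pow_one] at this
  have hker := hN.finrank_ker_pow (k := 1) (by omega) hqp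
  have hfin : ∀ F : matchedFlags e N w r, Module.finrank K ((F.1.flag r).comap N) = r + 2 := by
    intro F
    have := hN.finrank_comap (k := 1) (by omega) hqp (W := F.1.flag r)
      (by rw [pow_one]; exact hrange F)
    rw [pow_one, F.1.finrank_flag le_rfl] at this
    exact this
  rw [pow_one] at hker
  refine isLiftedProjLineBundle_truncMap _ (M := fun F => ⟨(F.1.flag r).comap N, hfin F⟩)
    (HasLocalLifts.comap N (B := fun F : matchedFlags e N w r => GrProd.member le_rfl F.1)
      ((GrProd.hasLocalLifts_member le_rfl).comp (HasLocalLifts.val _)) hrange hker rfl fun F => rfl)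
    (fun F => ?_) (fun F => ⟨fun hF => ?_, ?_⟩)
  · rcases Nat.eq_zero_or_pos r with rfl | hr0
    · exact bot_le
    · obtain ⟨s, rfl⟩ : ∃ s, r = s + 1 := ⟨r - 1, by omega⟩
      intro v hv
      exact F.2.mono s (by omega) (F.2.nil s (by omega) hv)
  · refine ⟨trunc_mem_matchedFlags r F hF, IsMatched.mono hF r (by omega), ?_⟩
    change _ ≤ ((GrProd.trunc K _ F).flag r).comap N
    rw [GrProd.flag_trunc _ _ le_rfl]
    exact IsMatched.nil hF r (by omega)
  · rintro ⟨hF, h1, h2⟩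
    change _ ≤ ((GrProd.trunc K _ F).flag r).comap N at h2
    rw [GrProd.flag_trunc _ _ le_rfl] at h2
    exact (isMatched_of_trunc_mem hF).succ_right hwr h1 h2

/-- Irreducibility ascends the tower from a point, through isomorphisms and projective line bundles.
-/
lemma isZariskiIrreducible_matchedFlags [Infinite K] {r : ℕ} (hr : r ≤ p + q) :
    IsZariskiIrreducible K (matchedFlags e N w r) := by
  induction r with
  | zero =>
    have hsub : Subsingleton (matchedFlags e N w 0) :=
      ⟨fun a b => Subtype.ext (funext fun i => i.elim0)⟩
    refine ⟨⟨⟨fun i => i.elim0, IsMatched.zero rfl⟩⟩, ?_⟩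
    rintro U V - - ⟨x, hx⟩ ⟨y, hy⟩
    exact ⟨x, hx, hsub.elim y x ▸ hy⟩
  | succ r ih =>
    cases hwr : w r
    · obtain ⟨φ, -, h2, -⟩ := exists_equiv_matchedFlags hN hqp hw hr hwr
      exact (ih (by omega)).of_surjective h2 φ.symm.surjective
    · exact (isLiftedProjLineBundle_matchedFlags hN hqp hw hr hwr).isZariskiIrreducible
        (ih (by omega))

/-- Every map of the tower is surjective. This identifies the projections of the set of complete
matched flags. -/
lemma exists_prolongation_matchedFlags {r s : ℕ} (hrs : r ≤ s) (hs : s ≤ p + q)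
    {F : GrProd K (p + q) r} (hF : F ∈ matchedFlags e N w r) :
    ∃ F' ∈ matchedFlags e N w s, GrProd.trunc K hrs F' = F := by
  induction s, hrs using Nat.le_induction with
  | base => exact ⟨F, hF, rfl⟩
  | succ s hrs ih =>
    obtain ⟨F', hF', rfl⟩ := ih (by omega)
    suffices h : ∃ G : matchedFlags e N w (s + 1),
        truncMap (trunc_mem_matchedFlags s) G = ⟨F', hF'⟩ by
      obtain ⟨G, hG⟩ := h
      have hG' : GrProd.trunc K (Nat.le_succ s) G.1 = F' := congrArg Subtype.val hG
      exact ⟨G.1, G.2, by rw [← hG']; rfl⟩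
    cases hws : w s
    · obtain ⟨φ, -, -, h3⟩ := exists_equiv_matchedFlags hN hqp hw hs hws
      rw [← h3]
      exact φ.surjective _
    · obtain ⟨φ, -⟩ := (isLiftedProjLineBundle_matchedFlags hN hqp hw hs hws).exists_fiber_equiv
        ⟨F', hF'⟩
      exact ⟨_, (φ.symm (Classical.arbitrary _)).2⟩

end Matched

/-! ### The strata -/

section Unroll

universe v₁

variable {K : Type*} [Field K]

/-- The condition defining strata, written in terms of vectors and subspaces of a fixed space. -/
def InStratumOver (K : Type*) [Field K] {V : Type*} [AddCommGroup V] [Module K V] :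
    List Column → (ℕ → V) → (ℕ → V) → Submodule K V → (ℕ → Submodule K V) → Prop
  | [], _, _, _, _ => True
  | Column.left :: ψ, u, w, G, F => F 0 = G ⊔ Submodule.span K {u 0} ∧
      InStratumOver K ψ (fun i => u (i + 1)) w (F 0) (fun i => F (i + 1))
  | Column.right :: ψ, u, w, G, F => ∃ a : K, F 0 = G ⊔ Submodule.span K {a • u 0 + w 0} ∧
      InStratumOver K ψ u (fun i => a • u (i + 1) + w (i + 1)) (F 0) (fun i => F (i + 1))

lemma map_eq_span_singleton_iff {V V' : Type*} [AddCommGroup V] [Module K V] [AddCommGroup V']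
    [Module K V'] (π : V →ₗ[K] V') {F : Submodule K V} (hF : LinearMap.ker π ≤ F) (v : V) :
    F.map π = Submodule.span K {π v} ↔ F = LinearMap.ker π ⊔ Submodule.span K {v} := by
  constructor
  · intro h
    have h1 : (F.map π).comap π = ((Submodule.span K {v}).map π).comap π := by
      rw [h, Submodule.map_span, Set.image_singleton]
    rw [Submodule.comap_map_eq, Submodule.comap_map_eq, sup_eq_left.2 hF] at h1
    rw [h1, sup_comm]
  · rintro rfl
    rw [Submodule.map_sup, Submodule.map_span, Set.image_singleton,
      (LinearMap.le_ker_iff_map).1 le_rfl, bot_sup_eq]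

/-- The iterated quotients in the definition of the stratum are replaced by single quotients of `V`.
The induction therefore runs over all surjections `π` from `V`, whose kernel is the preceding member
of the flag. -/
lemma inStratum_iff_inStratumOver {V : Type v₁} [AddCommGroup V] [Module K V] (ψ : List Column) :
    ∀ (V' : Type v₁) [AddCommGroup V'] [Module K V'] (π : V →ₗ[K] V') (_ : Function.Surjective π)
      (u w : ℕ → V) (F : ℕ → Submodule K V) (_ : ∀ i, LinearMap.ker π ≤ F i)
      (_ : ∀ i, F i ≤ F (i + 1)),
      InStratum K ψ V' (fun i => π (u i)) (fun i => π (w i)) (fun i => (F i).map π) ↔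
        InStratumOver K ψ u w (LinearMap.ker π) F := by
  induction ψ with
  | nil => intros; simp [InStratum, InStratumOver]
  | cons c ψ ih =>
    intro V' _ _ π hπ u w F hker hmono
    have h0 : ∀ i, F 0 ≤ F i := fun i => monotone_nat_of_le_succ hmono (Nat.zero_le i)
    have hker' : LinearMap.ker (((F 0).map π).mkQ ∘ₗ π) = F 0 := by
      rw [LinearMap.ker_comp, Submodule.ker_mkQ, Submodule.comap_map_eq, sup_eq_left.2 (hker 0)]
    have hsurj : Function.Surjective (((F 0).map π).mkQ ∘ₗ π) :=
      (Submodule.mkQ_surjective _).comp hπ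
    have key := fun u' w' => ih (V' ⧸ (F 0).map π) (((F 0).map π).mkQ ∘ₗ π) hsurj u' w'
      (fun i => F (i + 1)) (fun i => by rw [hker']; exact h0 _) (fun i => hmono _)
    rw [hker'] at key
    cases c with
    | left =>
      simp only [InStratum, InStratumOver]
      refine and_congr (map_eq_span_singleton_iff π (hker 0) _) ?_
      rw [← key]
      simp only [Submodule.map_comp, LinearMap.comp_apply]
    | right =>
      simp only [InStratum, InStratumOver]
      refine exists_congr fun a => and_congr ?_ ?_
      · rw [← map_eq_span_singleton_iff π (hker 0), map_add, map_smul]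
      · rw [← key]
        simp only [Submodule.map_comp, LinearMap.comp_apply, map_add, map_smul]

end Unroll

/-! ### Flags in a stratum are matched -/

section Strata

variable {K : Type*} [Field K] {V : Type*} [AddCommGroup V] [Module K V] {p q : ℕ}
  {e : Module.Basis (Fin p ⊕ Fin q) K V} {N : V →ₗ[K] V} {w : ℕ → Bool}

/-- The column attached to a letter. -/
def letterColumn (b : Bool) : Column := if b then Column.right else Column.left

/-- The sequence `W` prolongs downwards to a second Jordan chain modulo the member `G r`. -/
def IsSecondChain (N : V →ₗ[K] V) (q : ℕ) (w : ℕ → Bool) (G : ℕ → Submodule K V) (r : ℕ)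
    (W : ℕ → V) : Prop :=
  (numRight w r < q → N (W 0) ∈ G r) ∧ ∀ i, i + 1 + numRight w r < q → N (W (i + 1)) = W i

lemma IsSecondChain.succ_left {G : ℕ → Submodule K V} {r : ℕ} {W : ℕ → V}
    (hW : IsSecondChain N q w G r W) (hwr : w r = false) (hG : G r ≤ G (r + 1)) :
    IsSecondChain N q w G (r + 1) W := by
  rw [IsSecondChain, numRight_succ_left hwr]
  exact ⟨fun h => hG (hW.1 h), hW.2⟩

/-- The ballot condition ensures that the first chain is still at least as long as the second, so
that the summands `a • chainL e _` are shifted by `N` within the basis. -/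
lemma IsSecondChain.succ_right {G : ℕ → Submodule K V} {r : ℕ} {W : ℕ → V} (hN : IsShift e N)
    (hw : IsBallot w p q) (hr : r < p + q) (hW : IsSecondChain N q w G r W) (hwr : w r = true)
    {a : K} (ha : a • chainL e (numLeft w r) + W 0 ∈ G (r + 1)) :
    IsSecondChain N q w G (r + 1)
      (fun i => a • chainL e (numLeft w r + (i + 1)) + W (i + 1)) := by
  have hlow := hw.lower r hr.le
  unfold height at hlow
  rw [IsSecondChain, numRight_succ_right hwr]
  refine ⟨fun h => ?_, fun i hi => ?_⟩
  · rw [map_add, map_smul, hW.2 0 (by omega), zero_add, hN.apply_chainL (by omega)]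
    exact ha
  · rw [map_add, map_smul, hW.2 (i + 1) (by omega), ← add_assoc, hN.apply_chainL (by omega)]

lemma coordSub_succ_le {a b : ℕ} : coordSub e (a + 1) b ≤
    coordSub e a b ⊔ Submodule.span K {chainL e a} := by
  intro v hv
  have h := sub_smul_chainL_mem hv
  rw [← sub_add_cancel v (coordL e a v • chainL e a)]
  exact Submodule.add_mem_sup h (Submodule.smul_mem _ _ (Submodule.mem_span_singleton_self _))

lemma ofFn_letterColumn_succ (w : ℕ → Bool) (r m : ℕ) :
    (List.ofFn fun i : Fin (m + 1) => letterColumn (w (r + i))) =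
      letterColumn (w r) :: List.ofFn fun i : Fin m => letterColumn (w (r + 1 + i)) := by
  rw [List.ofFn_succ]
  simp only [Fin.val_zero, add_zero, Fin.val_succ, add_assoc, add_comm 1]

lemma inStratumOver_ofFn_left {G : ℕ → Submodule K V} {W : ℕ → V} {r m : ℕ} (hwr : w r = false) :
    InStratumOver K (List.ofFn fun i : Fin (m + 1) => letterColumn (w (r + i)))
        (fun i => chainL e (numLeft w r + i)) W (G r) (fun i => G (r + 1 + i)) ↔
      G (r + 1) = G r ⊔ Submodule.span K {chainL e (numLeft w r)} ∧
        InStratumOver K (List.ofFn fun i : Fin m => letterColumn (w (r + 1 + i)))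
          (fun i => chainL e (numLeft w (r + 1) + i)) W (G (r + 1)) (fun i => G (r + 1 + 1 + i)) := by
  have h1 : (fun i => chainL e (numLeft w (r + 1) + i)) =
      fun i => chainL e (numLeft w r + (i + 1)) := by
    funext i
    rw [numLeft_succ_left hwr, add_assoc, add_comm 1]
  have h2 : (fun i => G (r + 1 + 1 + i)) = fun i => G (r + 1 + (i + 1)) := by
    funext i
    rw [add_assoc (r + 1), add_comm 1]
  rw [ofFn_letterColumn_succ, hwr, h1, h2]
  exact Iff.rfl

lemma inStratumOver_ofFn_right {G : ℕ → Submodule K V} {W : ℕ → V} {r m : ℕ} (hwr : w r = true) :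
    InStratumOver K (List.ofFn fun i : Fin (m + 1) => letterColumn (w (r + i)))
        (fun i => chainL e (numLeft w r + i)) W (G r) (fun i => G (r + 1 + i)) ↔
      ∃ a : K, G (r + 1) = G r ⊔ Submodule.span K {a • chainL e (numLeft w r) + W 0} ∧
        InStratumOver K (List.ofFn fun i : Fin m => letterColumn (w (r + 1 + i)))
          (fun i => chainL e (numLeft w (r + 1) + i))
          (fun i => a • chainL e (numLeft w r + (i + 1)) + W (i + 1)) (G (r + 1))
          (fun i => G (r + 1 + 1 + i)) := by
  have h2 : (fun i => G (r + 1 + 1 + i)) = fun i => G (r + 1 + (i + 1)) := by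
    funext i
    rw [add_assoc (r + 1), add_comm 1]
  rw [ofFn_letterColumn_succ, hwr, numLeft_succ_right hwr, h2]
  exact Iff.rfl

/-- The induction carries along that `G i` contains the first `numLeft w i` vectors of the first
chain and that `W` is a second chain modulo `G r`. The first fact controls the vector added by a
left letter, both control the one added by a right letter. -/
lemma isMatched_of_inStratumOver [FiniteDimensional K V] (hN : IsShift e N) (hw : IsBallot w p q)
    {G : ℕ → Submodule K V} (hfin : ∀ i ≤ p + q, Module.finrank K (G i) = i) (m : ℕ) :
    ∀ (r : ℕ) (W : ℕ → V), r + m = p + q → IsMatched e N w r G →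
      (∀ i ≤ r, coordSub e (numLeft w i) 0 ≤ G i) → IsSecondChain N q w G r W →
      InStratumOver K (List.ofFn fun i : Fin m => letterColumn (w (r + i)))
        (fun i => chainL e (numLeft w r + i)) W (G r) (fun i => G (r + 1 + i)) →
      IsMatched e N w (p + q) G := by
  induction m with
  | zero =>
    intro r W hr h _ _ _
    rwa [← hr]
  | succ m ih =>
    intro r W hr h hL hW hs
    have hfin' : ∀ i ≤ r, Module.finrank K (G i) = i := fun i hi => hfin i (by omega)
    cases hwr : w r
    · obtain ⟨h0, hs⟩ := (inStratumOver_ofFn_left hwr).1 hs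
      have hnl := numLeft_succ_left hwr
      have hmono : G r ≤ G (r + 1) := by rw [h0]; exact le_sup_left
      have hmem : chainL e (numLeft w r) ∈ coordSub e (numLeft w r + 1) 0 :=
        chainL_mem (Nat.lt_succ_self _)
      have h1 : IsMatched e N w (r + 1) G := by
        have hadd := height_add w (r + 1)
        have hcount := numRight_add_numLeft w (r + 1)
        rcases left_cases hwr with ⟨i, k, hik, hih, hgt⟩ | ⟨t, u, htu, hh, hgt⟩
        · refine h.succ_of_matched hik hih hgt hN hwr hfin' hmono ?_
          have hadd' := height_add w i
          have hcount' := numRight_add_numLeft w i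
          rw [h0]
          refine sup_le (h.le_comap_of_matched hik hih hgt hwr) ?_
          rw [Submodule.span_singleton_le_iff_mem]
          -- The matched interval contains `k + 1` left letters, so `N ^ (k + 1)` moves the new
          -- chain vector into the initial segment already contained in `G i`.
          refine Submodule.comap_mono (hL i (by omega)) ?_
          rw [hN.comap_pow_coordSub]
          exact coordSub_mono (by omega) (by omega) hmem
        · refine h.succ_of_unmatched htu hh hgt hN hwr hfin' hmono ?_
          rw [h0]
          refine sup_le (h.le_comap_of_unmatched htu hh hgt hwr) ?_
          rw [Submodule.span_singleton_le_iff_mem, hN.comap_pow_coordSub]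
          push_cast at hadd
          exact coordSub_mono (by omega) (by omega) hmem
      refine ih (r + 1) W (by omega) h1 ?_ (hW.succ_left hwr hmono) hs
      · intro i hi
        rcases Nat.le_succ_iff.1 hi with hi | rfl
        · exact hL i hi
        · rw [Nat.succ_eq_add_one, hnl, h0]
          exact coordSub_succ_le.trans (sup_le_sup_right (hL r le_rfl) _)
    · obtain ⟨a, h0, hs⟩ := (inStratumOver_ofFn_right hwr).1 hs
      have hnl := numLeft_succ_right hwr
      have hnr := numRight_succ_right hwr
      have hcount := hw.numRight_le (i := r + 1) (by omega)
      have hmono : G r ≤ G (r + 1) := by rw [h0]; exact le_sup_left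
      have h1 : IsMatched e N w (r + 1) G := by
        refine h.succ_right hwr hmono ?_
        rw [h0]
        refine sup_le ?_ ?_
        · rcases Nat.eq_zero_or_pos r with rfl | hr0
          · have : G 0 = ⊥ := Submodule.finrank_eq_zero.1 (hfin 0 (by omega))
            rw [this]
            exact bot_le
          · obtain ⟨s, rfl⟩ : ∃ s, r = s + 1 := ⟨r - 1, by omega⟩
            exact fun v hv => h.mono s (by omega) (h.nil s (by omega) hv)
        · rw [Submodule.span_singleton_le_iff_mem, Submodule.mem_comap, map_add, map_smul]
          refine Submodule.add_mem _ (Submodule.smul_mem _ _ (hL r le_rfl ?_)) (hW.1 (by omega))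
          have := hN.apply_mem_coordSub (chainL_mem (e := e) (b := 0) (Nat.lt_succ_self (numLeft w r)))
          exact this
      refine ih (r + 1) (fun i => a • chainL e (numLeft w r + (i + 1)) + W (i + 1)) (by omega) h1 ?_
        (hW.succ_right hN hw (by omega) hwr ?_) hs
      · intro i hi
        rcases Nat.le_succ_iff.1 hi with hi | rfl
        · exact hL i hi
        · rw [Nat.succ_eq_add_one, hnl]
          exact (hL r le_rfl).trans hmono
      · rw [h0]
        exact Submodule.mem_sup_right (Submodule.mem_span_singleton_self _)

/-- A matched flag contains the beginning of the first Jordan chain. -/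
lemma IsMatched.coordSub_le [FiniteDimensional K V] (hN : IsShift e N) {r : ℕ}
    {G : ℕ → Submodule K V} (h : IsMatched e N w r G)
    (hfin : ∀ i ≤ r, Module.finrank K (G i) = i) {i : ℕ} (hi : i ≤ r) :
    coordSub e (numLeft w i) 0 ≤ G i := by
  induction i using Nat.strong_induction_on with
  | _ i ih =>
    rcases Nat.eq_zero_or_pos i with rfl | hpos
    · rw [numLeft, coordSub_zero_zero]; exact bot_le
    obtain ⟨i, rfl⟩ : ∃ j, i = j + 1 := ⟨i - 1, by omega⟩
    cases hwi : w i
    · have hadd := height_add w (i + 1)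
      have hcount := numRight_add_numLeft w (i + 1)
      rcases left_cases hwi with ⟨j, k, hjk, hjh, hgt⟩ | ⟨t, u, htu, hh, hgt⟩
      · have hadd' := height_add w j
        have hcount' := numRight_add_numLeft w j
        have h2 := h.bal j (k + 1) (by omega) (by
          rw [hjk]; exact IsMatched.isBalanced_of_gt hjh hgt)
        rw [hjk] at h2
        rw [hN.eq_comap (by rw [hfin _ hi, hfin _ (by omega)]; omega) h2]
        refine le_trans ?_ (Submodule.comap_mono (ih j (by omega) (by omega)))
        rw [hN.comap_pow_coordSub]
        exact coordSub_mono (by omega) (by omega)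
      · have hi1 : 2 * t + (u + 1) = i + 1 := by omega
        have h1 := h.low t (u + 1) (by omega)
          (by
            rw [hi1]
            intro m hm
            rcases Nat.le_succ_iff.1 hm with hm | rfl
            · exact (hgt m hm).le
            · exact le_rfl)
          (by rw [hi1, hh]; push_cast; ring)
        rw [hi1] at h1
        rw [hN.eq_comap (by rw [hfin _ hi, finrank_coordSub]; omega) h1, hN.comap_pow_coordSub]
        push_cast at hadd
        exact coordSub_mono (by omega) (by omega)
    · rw [numLeft_succ_right hwi]
      exact (ih i (by omega) (by omega)).trans (h.mono i (by omega))

lemma IsMatched.le_comap_self {r : ℕ} {G : ℕ → Submodule K V} (h : IsMatched e N w r G)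
    (h0 : G 0 = ⊥) {i : ℕ} (hi : i ≤ r) : G i ≤ (G i).comap N := by
  rcases Nat.eq_zero_or_pos i with rfl | hpos
  · rw [h0]; exact bot_le
  · obtain ⟨s, rfl⟩ : ∃ s, i = s + 1 := ⟨i - 1, by omega⟩
    exact fun v hv => h.mono s (by omega) (h.nil s (by omega) hv)

/-- An invariant subspace which does not contain the next vector of the first chain meets the first
chain in its beginning only. -/
lemma mem_coordSub_of_chainL_notMem (hN : IsShift e N) {F : Submodule K V} (hF : F ≤ F.comap N)
    {l : ℕ} (hl : coordSub e l 0 ≤ F) (hnot : l < p → chainL e l ∉ F) {v : V} (hv : v ∈ F)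
    (hvp : v ∈ coordSub e p 0) : v ∈ coordSub e l 0 := by
  have hFk : ∀ k, ∀ x ∈ F, (N ^ k) x ∈ F := by
    intro k
    induction k with
    | zero => simp
    | succ k ih =>
      intro x hx
      rw [pow_succ', Module.End.mul_apply]
      exact hF (ih x hx)
  suffices h : ∀ d, v ∈ coordSub e (l + d) 0 → v ∈ coordSub e l 0 from
    h p (coordSub_mono (by omega) le_rfl hvp)
  intro d
  induction d with
  | zero => exact fun h => h
  | succ d ih =>
    intro h
    apply ih
    by_cases hlp : l + d < p
    · have h1 := sub_smul_chainL_mem (show v ∈ coordSub e (l + d + 1) 0 from h)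
      by_cases hc : coordL e (l + d) v = 0
      · rwa [hc, zero_smul, sub_zero] at h1
      · exfalso
        -- `N ^ d` sends everything below the leading term of `v` into `coordSub e l 0`, hence into
        -- `F`, and the leading chain vector to `chainL e l`. A non-zero leading coefficient would
        -- put that vector into `F`.
        have h2 : (N ^ d) (v - coordL e (l + d) v • chainL e (l + d)) ∈ F := by
          apply hl
          change _ ∈ (coordSub e l 0).comap (N ^ d)
          rw [hN.comap_pow_coordSub]
          exact coordSub_mono le_rfl (Nat.zero_le _) h1
        rw [map_sub, map_smul, hN.pow_chainL hlp] at h2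
        have h3 := Submodule.sub_mem _ (hFk d v hv) h2
        rw [sub_sub_cancel, Submodule.smul_mem_iff _ hc] at h3
        exact hnot (by omega) h3
    · exact coordSub_mono (by omega) le_rfl hvp

/-! ### Generic matched flags lie in the stratum -/

section Generic

variable {G : ℕ → Submodule K V}

/-- The next vector of the first chain lies in `G (r + 1)` because the flag is matched, and outside
`G r` because it is generic. -/
lemma IsMatched.sup_chainL_eq [FiniteDimensional K V] (hN : IsShift e N) (hw : IsBallot w p q)
    (hfin : ∀ i ≤ p + q, Module.finrank K (G i) = i) (h : IsMatched e N w (p + q) G)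
    (hgen : ∀ i ≤ p + q, numLeft w i < p → chainL e (numLeft w i) ∉ G i)
    {r : ℕ} (hr : r < p + q) (hwr : w r = false) :
    G r ⊔ Submodule.span K {chainL e (numLeft w r)} = G (r + 1) := by
  have hle := hw.numLeft_le (i := r + 1) hr
  have hnl := numLeft_succ_left hwr
  refine sup_span_singleton_eq (hfin r hr.le) (hfin (r + 1) hr) (h.mono r hr) ?_
    (hgen r hr.le (by omega))
  exact h.coordSub_le hN hfin (i := r + 1) hr (chainL_mem (by omega))

lemma IsMatched.le_coordSub [FiniteDimensional K V] (hN : IsShift e N) (hw : IsBallot w p q)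
    (hfin : ∀ i ≤ p + q, Module.finrank K (G i) = i) (h : IsMatched e N w (p + q) G)
    (hgen : ∀ i ≤ p + q, numLeft w i < p → chainL e (numLeft w i) ∉ G i)
    {r : ℕ} (hr : r ≤ p + q) : G r ≤ coordSub e p (numRight w r) := by
  induction r with
  | zero => rw [Submodule.finrank_eq_zero.1 (hfin 0 hr)]; exact bot_le
  | succ r ih =>
    cases hwr : w r
    · have hle := hw.numLeft_le (i := r + 1) hr
      have hnl := numLeft_succ_left hwr
      rw [← h.sup_chainL_eq hN hw hfin hgen hr hwr, numRight_succ_left hwr]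
      refine sup_le (ih (by omega)) ?_
      rw [Submodule.span_singleton_le_iff_mem]
      exact chainL_mem (by omega)
    · rw [numRight_succ_right hwr]
      refine (h.nil r hr).trans ((Submodule.comap_mono (ih (by omega))).trans ?_)
      have h2 := hN.comap_pow_coordSub 1 p (numRight w r)
      rw [pow_one] at h2
      rw [h2, ← coordSub_min]
      exact coordSub_mono (min_le_right _ _) (min_le_left _ _)

/-- Take `f` in `G (r + 1)` outside `G r`. After subtracting a multiple `b • x`, it is congruent
modulo `G r` to a vector `α` of the first chain. Genericity at `r` puts `N α` into the initial
segment of length `numLeft w r`, so `α` is a multiple of the next chain vector modulo `G r`. If `b`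
were zero, that chain vector would lie in `G (r + 1)`, against genericity at `r + 1`. -/
lemma IsMatched.exists_sup_eq [FiniteDimensional K V] (hN : IsShift e N) (hw : IsBallot w p q)
    (hfin : ∀ i ≤ p + q, Module.finrank K (G i) = i) (h : IsMatched e N w (p + q) G)
    (hgen : ∀ i ≤ p + q, numLeft w i < p → chainL e (numLeft w i) ∉ G i)
    {r : ℕ} (hr : r < p + q) (hwr : w r = true) {x : V} (hx : N x ∈ G r)
    (hx' : x - chainR e (numRight w r) ∈ coordSub e p 0) :
    ∃ a : K, G r ⊔ Submodule.span K {a • chainL e (numLeft w r) + x} = G (r + 1) := by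
  have h0 : G 0 = ⊥ := Submodule.finrank_eq_zero.1 (hfin 0 (by omega))
  have hnl := numLeft_succ_right hwr
  have hnr := numRight_succ_right hwr
  have hnlp := hw.numLeft_le hr.le
  have hnrq := hw.numRight_le (i := r + 1) hr
  have hadd := numRight_add_numLeft w r
  have hL := h.coordSub_le hN hfin hr.le
  have hstab := h.le_comap_self h0 hr.le
  have hmeet : ∀ v ∈ G r, v ∈ coordSub e p 0 → v ∈ coordSub e (numLeft w r) 0 := fun v h1 h2 =>
    mem_coordSub_of_chainL_notMem hN hstab hL (hgen r hr.le) h1 h2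
  -- A dimension count: `G r` meets the first chain in dimension at most `numLeft w r`, so the sum
  -- has dimension at least `p + numRight w r`.
  have hsup : coordSub e p 0 ⊔ G r = coordSub e p (numRight w r) := by
    refine Submodule.eq_of_le_of_finrank_le
      (sup_le (coordSub_mono le_rfl (Nat.zero_le _)) (h.le_coordSub hN hw hfin hgen hr.le)) ?_
    have h1 := Submodule.finrank_sup_add_finrank_inf_eq (coordSub e p 0) (G r)
    have h2 : Module.finrank K (coordSub e p 0 ⊓ G r : Submodule K V) ≤ numLeft w r := by
      rw [← add_zero (numLeft w r), ← finrank_coordSub_of_le (e := e) hnlp (Nat.zero_le q)]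
      exact Submodule.finrank_mono fun v hv => hmeet v hv.2 hv.1
    rw [finrank_coordSub_of_le le_rfl (Nat.zero_le q), hfin r hr.le] at h1
    rw [finrank_coordSub_of_le le_rfl (by omega)]
    omega
  obtain ⟨f, hf, hfr⟩ : ∃ f ∈ G (r + 1), f ∉ G r := by
    by_contra! hcon
    have h1 := Submodule.finrank_mono (show G (r + 1) ≤ G r from hcon)
    rw [hfin r hr.le, hfin (r + 1) hr] at h1
    omega
  set b := coordR e (numRight w r) f with hb
  have hfb : f - b • x ∈ coordSub e p 0 ⊔ G r := by
    rw [hsup]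
    have h1 : f ∈ coordSub e p (numRight w r + 1) := by
      rw [← hnr]; exact h.le_coordSub hN hw hfin hgen hr hf
    have h2 := sub_smul_chainR_mem h1
    have h3 : f - b • x = (f - b • chainR e (numRight w r)) - b • (x - chainR e (numRight w r)) := by
      rw [smul_sub]; abel
    rw [h3]
    exact Submodule.sub_mem _ h2
      (Submodule.smul_mem _ _ (coordSub_mono le_rfl (Nat.zero_le _) hx'))
  obtain ⟨α, hα, g, hg, hαg⟩ := Submodule.mem_sup.1 hfb
  have hNα : N α ∈ coordSub e (numLeft w r) 0 := by
    refine hmeet _ ?_ (coordSub_mono (by omega) (by omega) (hN.apply_mem_coordSub hα))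
    have h1 : N α = N f - b • N x - N g := by
      rw [← map_smul, ← map_sub, ← map_sub, ← hαg, add_sub_cancel_right]
    rw [h1]
    exact Submodule.sub_mem _ (Submodule.sub_mem _ (h.nil r hr hf) (Submodule.smul_mem _ _ hx))
      (hstab hg)
  have hα' : α ∈ coordSub e (numLeft w r + 1) 0 := by
    refine ⟨fun i hi => ?_, hα.2⟩
    obtain ⟨i, rfl⟩ : ∃ j, i = j + 1 := ⟨i - 1, by omega⟩
    rw [← hN.left]
    exact hNα.1 i (by omega)
  set c := coordL e (numLeft w r) α with hc
  have hα'' := hL (sub_smul_chainL_mem hα')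
  have hmod : f - (c • chainL e (numLeft w r) + b • x) ∈ G r := by
    have h1 : f - (c • chainL e (numLeft w r) + b • x) =
        (α - c • chainL e (numLeft w r)) + g := by
      rw [← sub_sub, sub_right_comm, ← hαg]; abel
    rw [h1]
    exact Submodule.add_mem _ hα'' hg
  have hmono := h.mono r hr
  have hb0 : b ≠ 0 := by
    intro hb0
    rw [hb0, zero_smul, add_zero] at hmod
    have h1 := Submodule.sub_mem _ hf (hmono hmod)
    rw [sub_sub_cancel] at h1
    have hc0 : c • chainL e (numLeft w r) ≠ 0 := by
      intro h2
      rw [h2, sub_zero] at hmod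
      exact hfr hmod
    have hc1 : c ≠ 0 := left_ne_zero_of_smul hc0
    have hlp : numLeft w r < p := by
      by_contra hcon
      exact hc0 (by simp [chainL, hcon])
    rw [Submodule.smul_mem_iff _ hc1, ← hnl] at h1
    exact hgen (r + 1) hr (by omega) h1
  refine ⟨b⁻¹ * c, sup_span_singleton_eq (hfin r hr.le) (hfin (r + 1) hr) hmono ?_ ?_⟩
  · have h1 := Submodule.smul_mem _ b⁻¹ (Submodule.sub_mem _ hf (hmono hmod))
    rwa [sub_sub_cancel, smul_add, smul_smul, smul_smul, inv_mul_cancel₀ hb0, one_smul] at h1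
  · intro h1
    have h2 := Submodule.smul_mem _ b h1
    rw [smul_add, smul_smul, mul_inv_cancel_left₀ hb0] at h2
    have h3 := Submodule.add_mem _ hmod h2
    rw [sub_add_cancel] at h3
    exact hfr h3

/-- The second chain is kept congruent to the basis chain modulo the first chain, so that the
coefficient of `W 0` in a vector can be read off from its coordinates at each right letter. -/
lemma inStratumOver_of_isMatched [FiniteDimensional K V] (hN : IsShift e N) (hw : IsBallot w p q)
    (hfin : ∀ i ≤ p + q, Module.finrank K (G i) = i) (h : IsMatched e N w (p + q) G)
    (hgen : ∀ i ≤ p + q, numLeft w i < p → chainL e (numLeft w i) ∉ G i) (m : ℕ) :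
    ∀ (r : ℕ) (W : ℕ → V), r + m = p + q → IsSecondChain N q w G r W →
      (∀ i, W i - chainR e (numRight w r + i) ∈ coordSub e p 0) →
      InStratumOver K (List.ofFn fun i : Fin m => letterColumn (w (r + i)))
        (fun i => chainL e (numLeft w r + i)) W (G r) (fun i => G (r + 1 + i)) := by
  induction m with
  | zero =>
    intro r W _ _ _
    simp [InStratumOver]
  | succ m ih =>
    intro r W hr hW hWR
    cases hwr : w r
    · have hnl := numLeft_succ_left hwr
      have hnr := numRight_succ_left hwr
      refine (inStratumOver_ofFn_left hwr).2 ⟨(h.sup_chainL_eq hN hw hfin hgen (by omega) hwr).symm, ?_⟩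
      exact ih (r + 1) W (by omega) (hW.succ_left hwr (h.mono r (by omega)))
        (by rw [hnr]; exact hWR)
    · have hnl := numLeft_succ_right hwr
      have hnr := numRight_succ_right hwr
      have hcount := hw.numRight_le (i := r + 1) (by omega)
      obtain ⟨a, ha⟩ := h.exists_sup_eq hN hw hfin hgen (by omega) hwr (hW.1 (by omega)) (hWR 0)
      refine (inStratumOver_ofFn_right hwr).2 ⟨a, ha.symm, ?_⟩
      exact ih (r + 1) (fun i => a • chainL e (numLeft w r + (i + 1)) + W (i + 1)) (by omega)
        (hW.succ_right hN hw (by omega) hwr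
          (by rw [← ha]; exact Submodule.mem_sup_right (Submodule.mem_span_singleton_self _)))
        (fun i => by
          rw [hnr, add_assoc, add_comm 1 i, add_sub_assoc]
          refine Submodule.add_mem _ (Submodule.smul_mem _ _ ?_) (hWR (i + 1))
          by_cases hlp : numLeft w r + (i + 1) < p
          · exact chainL_mem hlp
          · simp [chainL, hlp])

end Generic

end Strata

/-! ### Coordinate flags -/

section Reflection

variable {w w' : ℕ → Bool} {p q : ℕ}

/-- The word whose lattice path has the height function `g`. -/
def wordOfHeight (g : ℕ → ℤ) (i : ℕ) : Bool := decide (g i < g (i + 1))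

lemma height_wordOfHeight {g : ℕ → ℤ} (h0 : g 0 = 0)
    (hg : ∀ i, g (i + 1) = g i + 1 ∨ g (i + 1) = g i - 1) (i : ℕ) :
    height (wordOfHeight g) i = g i := by
  induction i with
  | zero => rw [h0, height_zero]
  | succ i ih =>
    rcases hg i with h | h
    · rw [height_succ_right (by simp [wordOfHeight, h]), ih, h]
    · rw [height_succ_left (by simp [wordOfHeight, h]), ih, h]

/-- The lattice path of `l` is level on the intervals which `w` matches completely and has the height
of `w` wherever the latter is minimal. -/
structure IsCompatible (w : ℕ → Bool) (n : ℕ) (l : ℕ → Bool) : Prop where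
  bal : ∀ i j, i ≤ j → j ≤ n → IsBalanced w i j → height l i = height l j
  low : ∀ s ≤ n, IsLow w s → height l s = height w s

lemma IsCompatible.refl (w : ℕ → Bool) (n : ℕ) : IsCompatible w n w :=
  ⟨fun _ _ _ _ h => h.1, fun _ _ _ => rfl⟩

/-- The height function of `w`, reflected downwards from position `m` on. -/
def reflectedHeight (w : ℕ → Bool) (m x : ℕ) : ℤ :=
  if x ≤ m then height w x else min (height w x) (2 * height w m - height w x)

lemma reflectedHeight_of_ge {m x : ℕ} (h : m ≤ x) :
    reflectedHeight w m x = min (height w x) (2 * height w m - height w x) := by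
  unfold reflectedHeight
  split_ifs with h1
  · obtain rfl : x = m := by omega
    omega
  · rfl

lemma reflectedHeight_of_le {m x : ℕ} (h : x ≤ m) : reflectedHeight w m x = height w x :=
  if_pos h

lemma height_wordOfHeight_reflectedHeight (w : ℕ → Bool) (m x : ℕ) :
    height (wordOfHeight (reflectedHeight w m)) x = reflectedHeight w m x := by
  refine height_wordOfHeight (by simp [reflectedHeight]) (fun x => ?_) x
  have h1 := height_succ w x
  rcases Nat.lt_or_ge x m with h | h
  · rw [reflectedHeight_of_le h, reflectedHeight_of_le h.le]
    exact h1
  · rw [reflectedHeight_of_ge h, reflectedHeight_of_ge (x := x + 1) (by omega)]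
    omega

/-- Only parts of the path above its height at `m` are changed. A balanced interval containing `m`,
or a minimum after `m`, has its endpoints no higher than that, so they stay where they were. -/
lemma isCompatible_reflected (w : ℕ → Bool) (n m : ℕ) :
    IsCompatible w n (wordOfHeight (reflectedHeight w m)) where
  bal i j hij _ hb := by
    simp only [height_wordOfHeight_reflectedHeight]
    have h1 := hb.1
    rcases Nat.lt_or_ge m i with h | h
    · rw [reflectedHeight_of_ge h.le, reflectedHeight_of_ge (h.le.trans hij), h1]
    · rw [reflectedHeight_of_le h]
      rcases Nat.lt_or_ge m j with h' | h'
      · have := hb.2 m h h'.le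
        rw [reflectedHeight_of_ge h'.le]
        omega
      · rw [reflectedHeight_of_le h', h1]
  low s _ hs := by
    rw [height_wordOfHeight_reflectedHeight]
    rcases Nat.lt_or_ge m s with h | h
    · have := hs m h.le
      rw [reflectedHeight_of_ge h.le]
      omega
    · rw [reflectedHeight_of_le h]

/-- The words of the paths compatible with a ballot word determine it. -/
lemma IsBallot.eq_of_isCompatible (hw : IsBallot w p q) (hw' : IsBallot w' p q)
    (h : ∀ l, numRight l (p + q) = q → IsCompatible w (p + q) l → IsCompatible w' (p + q) l) :
    ∀ i < p + q, w i = w' i := by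
  intro i
  induction i using Nat.strong_induction_on with
  | _ i ih =>
    intro hi
    have hnum : ∀ j ≤ i, height w j = height w' j := by
      intro j hj
      induction j with
      | zero => simp
      | succ j ihj =>
        have h1 := ih j (by omega) (by omega)
        have h2 := ihj (by omega)
        cases hwj : w j
        · rw [height_succ_left hwj, height_succ_left (h1 ▸ hwj), h2]
        · rw [height_succ_right hwj, height_succ_right (h1 ▸ hwj), h2]
    have hii := hnum i le_rfl
    have hself := h w hw.numRight_eq (IsCompatible.refl w _)
    cases hwi : w i <;> cases hwi' : w' i
    · rfl
    · exfalso
      have hs := height_succ_left hwi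
      have hs' := height_succ_right hwi'
      have hlow' := hw'.lower i hi.le
      have hex : ∃ j, i < j ∧ height w' j ≤ height w' i :=
        ⟨p + q, hi, by rw [hw'.height_eq]; exact hlow'⟩
      classical
      -- First disagreement, with `w` going down and `w'` up. The first return of `w'` to its height
      -- at `i` closes a balanced interval of `w'`, on which every path compatible with `w` would
      -- have to be level.
      obtain ⟨hj1, hj2⟩ := Nat.find_spec hex
      have hmin := fun m (hm : m < Nat.find hex) => Nat.find_min hex hm
      have hjn : Nat.find hex ≤ p + q := Nat.find_min' hex ⟨hi, by rw [hw'.height_eq]; exact hlow'⟩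
      generalize Nat.find hex = j at *
      obtain ⟨j, rfl⟩ : ∃ k, j = k + 1 := ⟨j - 1, by omega⟩
      have hgt : ∀ m, i < m → m ≤ j → height w' i < height w' m := by
        intro m h1 h2
        by_contra! hcon
        exact hmin m (by omega) ⟨h1, hcon⟩
      have hij : i < j := by
        by_contra! hcon
        obtain rfl : j = i := by omega
        omega
      have hgj := hgt j hij le_rfl
      have hsj := height_succ w' j
      have hbal : IsBalanced w' i (j + 1) := IsMatched.isBalanced_of_gt (by omega) hgt
      have h1 := hself.bal i (j + 1) (by omega) hjn hbal
      -- The endpoint of a ballot path is its lowest level and is not moved, so the reflected word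
      -- still has `q` right letters.
      have hend : reflectedHeight w (i + 1) (p + q) = height w (p + q) := by
        rw [reflectedHeight_of_ge (m := i + 1) hi]
        have := hw.lower (i + 1) hi
        have := hw.height_eq
        omega
      have h2 := (h (wordOfHeight (reflectedHeight w (i + 1))) (by
        have h3 := height_add (wordOfHeight (reflectedHeight w (i + 1))) (p + q)
        have h4 := height_add w (p + q)
        have h5 := hw.numRight_eq
        rw [height_wordOfHeight_reflectedHeight, hend] at h3
        -- The path `w` returns to its height `h` at `i`, but was at `h - 1` just after `i`;
        -- reflected there it ends the interval at `h - 2`, so it is not level.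
        omega) (isCompatible_reflected w _ _)).bal i (j + 1) (by omega) hjn hbal
      rw [height_wordOfHeight_reflectedHeight, height_wordOfHeight_reflectedHeight,
        reflectedHeight_of_le (Nat.le_succ i), reflectedHeight_of_ge (by omega)] at h2
      omega
    · exfalso
      have hs := height_succ_right hwi
      have hs' := height_succ_left hwi'
      -- Here `w` goes up and `w'` down. The matching or minimum of `w'` at `i + 1` prescribes a
      -- height there, and the path of `w` itself, compatible with `w`, is too high by two.
      rcases left_cases hwi' with ⟨j, k, hjk, hjh, hgt⟩ | ⟨t, u, htu, hh, hgt⟩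
      · have h1 := hself.bal j (i + 1) (by omega) hi (IsMatched.isBalanced_of_gt hjh hgt)
        have h2 := hnum j (by omega)
        omega
      · have h1 := hself.low (i + 1) hi (fun m hm => by
          rcases Nat.le_succ_iff.1 hm with hm | rfl
          · exact (hgt m hm).le
          · exact le_rfl)
        omega
    · rfl

end Reflection

/-! ### Coordinate flags distinguish the sets of matched flags -/

section CoordFlags

variable {K : Type*} [Field K] {p q : ℕ}

lemma le_of_coordSub_le {V : Type*} [AddCommGroup V] [Module K V]
    {e : Module.Basis (Fin p ⊕ Fin q) K V} {a b a' b' : ℕ} (ha : a ≤ p) (hb : b ≤ q)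
    (h : coordSub e a b ≤ coordSub e a' b') : a ≤ a' ∧ b ≤ b' := by
  constructor
  · rcases Nat.eq_zero_or_pos a with rfl | ha0
    · exact Nat.zero_le _
    · have := lt_of_chainL_mem (e := e) (i := a - 1) (by omega) (h (chainL_mem (by omega)))
      omega
  · rcases Nat.eq_zero_or_pos b with rfl | hb0
    · exact Nat.zero_le _
    · have := lt_of_chainR_mem (e := e) (i := b - 1) (by omega) (h (chainR_mem (by omega)))
      omega

variable (e : Module.Basis (Fin p ⊕ Fin q) K (Fin (p + q) → K))

lemma finrank_coordSub_num {l : ℕ → Bool} (hl : numRight l (p + q) = q) {i : ℕ} (hi : i ≤ p + q) :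
    Module.finrank K (coordSub e (numLeft l i) (numRight l i)) = i := by
  have h1 := numRight_add_numLeft l (p + q)
  have h2 := numRight_add_numLeft l i
  have h3 := numRight_mono l hi
  have h4 := numLeft_mono l hi
  rw [finrank_coordSub_of_le (by omega) (by omega)]
  omega

/-- The flag of coordinate subspaces in which the basis vectors are adjoined in the order given by a
word. -/
def coordFlag {l : ℕ → Bool} (hl : numRight l (p + q) = q) : GrProd K (p + q) (p + q) :=
  fun i => ⟨coordSub e (numLeft l (i + 1)) (numRight l (i + 1)), finrank_coordSub_num e hl i.2⟩

variable {e}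

lemma flag_coordFlag {l : ℕ → Bool} (hl : numRight l (p + q) = q) {i : ℕ} (hi : i ≤ p + q) :
    (coordFlag e hl).flag i = coordSub e (numLeft l i) (numRight l i) := by
  cases i with
  | zero => exact coordSub_zero_zero.symm
  | succ i => rw [GrProd.flag_succ _ hi]; rfl

/-- For coordinate subspaces the conditions become two inequalities between counts of letters. Both
sides have the same total, so these are equalities, that is, conditions on the height of `l`. -/
lemma coordFlag_mem_matchedFlags_iff {N : (Fin (p + q) → K) →ₗ[K] (Fin (p + q) → K)}
    (hN : IsShift e N) {w l : ℕ → Bool} (hl : numRight l (p + q) = q) :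
    coordFlag e hl ∈ matchedFlags e N w (p + q) ↔ IsCompatible w (p + q) l := by
  have hend := numRight_add_numLeft l (p + q)
  have hR : ∀ i ≤ p + q, numRight l i ≤ q := fun i hi => (numRight_mono l hi).trans hl.le
  have hL : ∀ i ≤ p + q, numLeft l i ≤ p := fun i hi => (numLeft_mono l hi).trans (by omega)
  constructor
  · intro h
    refine ⟨fun i j hij hj hb => ?_, fun s hs hlow => ?_⟩
    · have h1 := height_add w i
      have h2 := height_add w j
      have h3 := hb.1
      obtain ⟨k, rfl⟩ : ∃ k, j = i + 2 * k := ⟨(j - i) / 2, by omega⟩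
      have h4 := h.bal i k hj hb
      rw [flag_coordFlag hl hj, flag_coordFlag hl (by omega), hN.comap_pow_coordSub] at h4
      have h5 := le_of_coordSub_le (hL _ hj) (hR _ hj) h4
      have h6 := numRight_add_numLeft l i
      have h7 := numRight_add_numLeft l (i + 2 * k)
      unfold height
      omega
    · have h1 := height_add w s
      have h0 := hlow 0 (Nat.zero_le s)
      rw [height_zero] at h0
      have hu : ∃ u : ℕ, height w s = -u := ⟨(-height w s).toNat, by omega⟩
      obtain ⟨u, hu⟩ := hu
      obtain ⟨t, rfl⟩ : ∃ t, s = 2 * t + u := ⟨numRight w s, by omega⟩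
      have h4 := h.low t u hs hlow hu
      rw [flag_coordFlag hl hs, hN.comap_pow_coordSub] at h4
      have h5 := le_of_coordSub_le (hL _ hs) (hR _ hs) h4
      have h6 := numRight_add_numLeft l (2 * t + u)
      rw [hu]
      unfold height
      omega
  · intro h
    refine ⟨fun i hi => ?_, fun i hi => ?_, fun i k hi hb => ?_, fun t u hi hlow hh => ?_⟩
    · rw [flag_coordFlag hl hi.le, flag_coordFlag hl hi]
      exact coordSub_mono (numLeft_mono l (Nat.le_succ i)) (numRight_mono l (Nat.le_succ i))
    · rw [flag_coordFlag hl hi.le, flag_coordFlag hl hi, ← pow_one N, hN.comap_pow_coordSub]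
      refine coordSub_mono ?_ ?_
      · simp only [numLeft]; split_ifs <;> omega
      · simp only [numRight]; split_ifs <;> omega
    · rw [flag_coordFlag hl hi, flag_coordFlag hl (by omega), hN.comap_pow_coordSub]
      have h1 := h.bal i (i + 2 * k) (by omega) hi hb
      have h2 := height_add l i
      have h3 := height_add l (i + 2 * k)
      have h6 := numRight_add_numLeft l i
      have h7 := numRight_add_numLeft l (i + 2 * k)
      exact coordSub_mono (by omega) (by omega)
    · rw [flag_coordFlag hl hi, hN.comap_pow_coordSub]
      have h1 := h.low _ hi hlow
      have h3 := height_add l (2 * t + u)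
      have h7 := numRight_add_numLeft l (2 * t + u)
      exact coordSub_mono (by omega) (by omega)

/-- The sets of matched flags of different ballot words are not contained in each other. -/
lemma IsBallot.eq_of_matchedFlags_subset {N : (Fin (p + q) → K) →ₗ[K] (Fin (p + q) → K)}
    (hN : IsShift e N) {w w' : ℕ → Bool} (hw : IsBallot w p q) (hw' : IsBallot w' p q)
    (h : matchedFlags e N w (p + q) ⊆ matchedFlags e N w' (p + q)) : ∀ i < p + q, w i = w' i :=
  hw.eq_of_isCompatible hw' fun _ hl hc =>
    (coordFlag_mem_matchedFlags_iff hN hl).1 (h ((coordFlag_mem_matchedFlags_iff hN hl).2 hc))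

end CoordFlags

/-! ### Covering the flags fixed by a unipotent element -/

section Cover

variable {K : Type*} [Field K] {V : Type*} [AddCommGroup V] [Module K V] {p q : ℕ}
  {e : Module.Basis (Fin p ⊕ Fin q) K V} {N : V →ₗ[K] V} {G : ℕ → Submodule K V}

lemma IsShift.pow_eq_zero (hN : IsShift e N) (hqp : q ≤ p) {k : ℕ} (hk : p ≤ k) : N ^ k = 0 := by
  rw [← LinearMap.ker_eq_top, hN.ker_pow, coordSub_eq_top hk (hqp.trans hk)]

/-- A nilpotent endomorphism preserving a complete flag maps each member to the previous one. -/
lemma le_comap_of_nilpotent [FiniteDimensional K V] (hN : IsNilpotent N) {W W' : Submodule K V}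
    {r : ℕ} (hW : Module.finrank K W = r) (hW' : Module.finrank K W' = r + 1) (hle : W ≤ W')
    (h : W ≤ W.comap N) (h' : W' ≤ W'.comap N) : W' ≤ W.comap N := by
  obtain ⟨v, hv, hvW⟩ : ∃ v ∈ W', v ∉ W := by
    by_contra! hcon
    have := Submodule.finrank_mono (show W' ≤ W from hcon)
    omega
  have hsup := sup_span_singleton_eq hW hW' hle hv hvW
  have hNv : N v ∈ W ⊔ Submodule.span K {v} := by rw [hsup]; exact h' hv
  obtain ⟨c, hc⟩ : ∃ c : K, N v - c • v ∈ W := by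
    obtain ⟨y, hy, z, hz, hyz⟩ := Submodule.mem_sup.1 hNv
    obtain ⟨c, rfl⟩ := Submodule.mem_span_singleton.1 hz
    exact ⟨c, by rw [← hyz, add_sub_cancel_right]; exact hy⟩
  have hpow : ∀ k, (N ^ k) v - c ^ k • v ∈ W := by
    intro k
    induction k with
    | zero => simp
    | succ k ih =>
      have h1 := Submodule.add_mem W (h ih) (Submodule.smul_mem _ (c ^ k) hc)
      rw [map_sub, map_smul, smul_sub, smul_smul, ← pow_succ, sub_add_sub_cancel,
        ← Module.End.mul_apply, ← pow_succ'] at h1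
      exact h1
  obtain ⟨k, hk⟩ := hN
  have h0 := hpow k
  rw [hk, LinearMap.zero_apply, zero_sub, neg_mem_iff] at h0
  have hc0 : c = 0 := by
    by_contra hc0
    exact hvW ((Submodule.smul_mem_iff _ (pow_ne_zero k hc0)).1 h0)
  rw [hc0, zero_smul, sub_zero] at hc
  rw [← hsup]
  exact sup_le h ((Submodule.span_singleton_le_iff_mem _ _).2 hc)

lemma exists_range_pow_le (hN : IsShift e N) (hqp : q ≤ p) (W : Submodule K V) :
    ∃ k, LinearMap.range (N ^ k) ≤ W :=
  ⟨p, by rw [hN.pow_eq_zero hqp le_rfl, LinearMap.range_zero]; exact bot_le⟩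

/-- Every complete flag on which `N` acts nilpotently is matched to a ballot word. -/
lemma exists_isBallot_isMatched [FiniteDimensional K V] (hN : IsShift e N) (hqp : q ≤ p)
    (hfin : ∀ i ≤ p + q, Module.finrank K (G i) = i) (hmono : ∀ i < p + q, G i ≤ G (i + 1))
    (hnil : ∀ i < p + q, G (i + 1) ≤ (G i).comap N) :
    ∃ w, IsBallot w p q ∧ IsMatched e N w (p + q) G := by
  classical
  have hV : Module.finrank K V = p + q := by
    rw [Module.finrank_eq_card_basis e, Fintype.card_sum, Fintype.card_fin, Fintype.card_fin]
  -- `P i` is the least power of `N` whose image lies in `G i`. It descends from `p` to `0` by steps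
  -- of at most one, and the descents are taken as the left letters.
  let P : ℕ → ℕ := fun i => Nat.find (exists_range_pow_le hN hqp (G i))
  have hP : ∀ i, LinearMap.range (N ^ P i) ≤ G i := fun i =>
    Nat.find_spec (exists_range_pow_le hN hqp (G i))
  have hPmin : ∀ i k, LinearMap.range (N ^ k) ≤ G i → P i ≤ k := fun i k h =>
    Nat.find_min' (exists_range_pow_le hN hqp (G i)) h
  clear_value P
  have hG0 : G 0 = ⊥ := Submodule.finrank_eq_zero.1 (hfin 0 (by omega))
  have hP0 : P 0 = p := by
    refine le_antisymm (hPmin 0 p ?_) ?_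
    · rw [hN.pow_eq_zero hqp le_rfl, LinearMap.range_zero]; exact bot_le
    · have h := hP 0
      rw [hG0, hN.range_pow, ← coordSub_zero_zero (e := e)] at h
      have := (le_of_coordSub_le (by omega) (by omega) h).1
      omega
  have hPn : P (p + q) = 0 := by
    refine Nat.le_zero.1 (hPmin _ _ ?_)
    rw [Submodule.eq_top_of_finrank_eq ((hfin _ le_rfl).trans hV.symm)]
    exact le_top
  have hPle : ∀ i < p + q, P (i + 1) ≤ P i := fun i hi => hPmin _ _ ((hP i).trans (hmono i hi))
  have hPge : ∀ i < p + q, P i ≤ P (i + 1) + 1 := by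
    intro i hi
    refine hPmin _ _ ?_
    rintro _ ⟨v, rfl⟩
    rw [pow_succ', Module.End.mul_apply]
    exact hnil i hi (hP (i + 1) ⟨v, rfl⟩)
  let w : ℕ → Bool := fun i => decide (P i = P (i + 1))
  have hnum : ∀ i ≤ p + q, numLeft w i + P i = p := by
    intro i
    induction i with
    | zero => intro _; simp [numLeft, hP0]
    | succ i ih =>
      intro hi
      have h1 := ih (by omega)
      have h2 := hPle i hi
      have h3 := hPge i hi
      cases hwi : w i
      · have h4 : P i ≠ P (i + 1) := of_decide_eq_false hwi
        rw [numLeft_succ_left hwi]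
        omega
      · have h4 : P i = P (i + 1) := of_decide_eq_true hwi
        rw [numLeft_succ_right hwi]
        omega
  have hw : IsBallot w p q := by
    refine ⟨fun i hi => ?_, ?_⟩
    · have h1 := Submodule.finrank_mono (hP i)
      have h2 := LinearMap.finrank_range_add_finrank_ker (N ^ P i)
      rw [hN.ker_pow, finrank_coordSub, hV] at h2
      rw [hfin i hi] at h1
      have h3 := numRight_add_numLeft w i
      have h4 := hnum i hi
      unfold height
      omega
    · have h3 := numRight_add_numLeft w (p + q)
      have h4 := hnum _ le_rfl
      omega
  refine ⟨w, hw, ?_⟩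
  suffices h : ∀ r ≤ p + q, IsMatched e N w r G from h _ le_rfl
  intro r
  induction r with
  | zero => exact fun _ => IsMatched.zero hG0
  | succ r ih =>
    intro hr
    have h := ih (by omega)
    have hmr := hmono r hr
    cases hwr : w r
    · have hne : P r ≠ P (r + 1) := of_decide_eq_false hwr
      have hfin' : ∀ i ≤ r, Module.finrank K (G i) = i := fun i hi => hfin i (by omega)
      -- At a descent the new direction comes from the image of `N ^ P (r + 1)`. Applying the
      -- relevant power of `N` sends it into the image of `N ^ P i`, contained in `G i`, or into an
      -- initial segment of the first chain.
      have hsup : G (r + 1) ≤ G r ⊔ LinearMap.range (N ^ P (r + 1)) := by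
        obtain ⟨v, hv, hvr⟩ := Set.not_subset.1 (show ¬ LinearMap.range (N ^ P (r + 1)) ≤ G r from
          fun hle => hne (le_antisymm (hPmin _ _ hle) (hPle r hr)))
        rw [← sup_span_singleton_eq (hfin r (by omega)) (hfin (r + 1) hr) hmr (hP _ hv) hvr]
        exact sup_le_sup_left ((Submodule.span_singleton_le_iff_mem _ _).2 hv) _
      have hnr := hnum (r + 1) hr
      have hadd := height_add w (r + 1)
      have hcount := numRight_add_numLeft w (r + 1)
      rcases left_cases hwr with ⟨i, k, hik, hih, hgt⟩ | ⟨t, u, htu, hh, hgt⟩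
      · refine h.succ_of_matched hik hih hgt hN hwr hfin' hmr ?_
        refine hsup.trans (sup_le (h.le_comap_of_matched hik hih hgt hwr) ?_)
        have hni := hnum i (by omega)
        have haddi := height_add w i
        have hcounti := numRight_add_numLeft w i
        rintro _ ⟨v, rfl⟩
        rw [Submodule.mem_comap, ← Module.End.mul_apply, ← pow_add,
          show k + 1 + P (r + 1) = P i by omega]
        exact hP i ⟨v, rfl⟩
      · refine h.succ_of_unmatched htu hh hgt hN hwr hfin' hmr ?_
        refine hsup.trans (sup_le (h.le_comap_of_unmatched htu hh hgt hwr) ?_)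
        have hlow := hw.lower (r + 1) hr
        push_cast at hadd
        rw [hN.range_pow, hN.comap_pow_coordSub]
        exact coordSub_mono (by omega) (by omega)
    · exact h.succ_right hwr hmr (hnil r hr)

end Cover

/-! ### The word of a tableau -/

section Tableau

variable {p q : ℕ}

/-- The columns of the successive entries of a tableau; `true` stands for the right column. -/
def StandardTableau.word (σ : StandardTableau p q) (j : ℕ) : Bool :=
  if h : j < p + q then (σ.entry.symm ⟨j, h⟩).isRight else false

variable (σ : StandardTableau p q)

lemma StandardTableau.letterColumn_word (r : Fin (p + q)) :
    letterColumn (σ.word r) = σ.column r := by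
  simp only [word, column, r.2, dif_pos, Fin.eta]
  cases σ.entry.symm r <;> rfl

lemma StandardTableau.word_eq_true_iff {j : ℕ} (hj : j < p + q) :
    σ.word j = true ↔ ∃ k, (σ.entry (Sum.inr k) : ℕ) = j := by
  rw [word, dif_pos hj, Sum.isRight_iff]
  refine exists_congr fun k => ?_
  rw [Equiv.symm_apply_eq, Fin.ext_iff]
  exact eq_comm

lemma StandardTableau.word_eq_false_iff {j : ℕ} (hj : j < p + q) :
    σ.word j = false ↔ ∃ k, (σ.entry (Sum.inl k) : ℕ) = j := by
  rw [word, dif_pos hj, Sum.isRight_eq_false, Sum.isLeft_iff]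
  refine exists_congr fun k => ?_
  rw [Equiv.symm_apply_eq, Fin.ext_iff]
  exact eq_comm

lemma card_filter_lt_succ_of_exists {m : ℕ} {f : Fin m → ℕ} (hf : Function.Injective f) {i : ℕ}
    (h : ∃ k, f k = i) : (Finset.univ.filter fun j => f j < i + 1).card =
      (Finset.univ.filter fun j => f j < i).card + 1 := by
  obtain ⟨k, rfl⟩ := h
  rw [← Finset.card_insert_of_notMem (a := k) (by simp)]
  congr 1
  ext j
  simp only [Finset.mem_filter, Finset.mem_univ, true_and, Finset.mem_insert, Nat.lt_succ_iff_lt_or_eq,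
    hf.eq_iff, or_comm]

lemma card_filter_lt_succ_of_not_exists {m : ℕ} {f : Fin m → ℕ} {i : ℕ} (h : ¬ ∃ k, f k = i) :
    (Finset.univ.filter fun j => f j < i + 1).card =
      (Finset.univ.filter fun j => f j < i).card := by
  push Not at h
  congr 1
  ext j
  simp only [Finset.mem_filter, Finset.mem_univ, true_and, Nat.lt_succ_iff_lt_or_eq, h j, or_false]

lemma StandardTableau.card_lt {i : ℕ} (hi : i ≤ p + q) :
    numRight σ.word i = (Finset.univ.filter fun k => (σ.entry (Sum.inr k) : ℕ) < i).card ∧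
      numLeft σ.word i = (Finset.univ.filter fun k => (σ.entry (Sum.inl k) : ℕ) < i).card := by
  have hR : Function.Injective fun k => (σ.entry (Sum.inr k) : ℕ) :=
    Fin.val_injective.comp (σ.entry.injective.comp Sum.inr_injective)
  have hL : Function.Injective fun k => (σ.entry (Sum.inl k) : ℕ) :=
    Fin.val_injective.comp (σ.entry.injective.comp Sum.inl_injective)
  induction i with
  | zero => simp [numRight, numLeft]
  | succ i ih =>
    obtain ⟨h1, h2⟩ := ih (by omega)
    have hr := σ.word_eq_true_iff hi
    have hl := σ.word_eq_false_iff hi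
    cases hw : σ.word i
    · rw [numRight_succ_left hw, numLeft_succ_left hw, h1, h2,
        card_filter_lt_succ_of_exists hL (hl.1 hw),
        card_filter_lt_succ_of_not_exists (by rw [← hr, hw]; simp)]
      exact ⟨rfl, rfl⟩
    · rw [numRight_succ_right hw, numLeft_succ_right hw, h1, h2,
        card_filter_lt_succ_of_exists hR (hr.1 hw),
        card_filter_lt_succ_of_not_exists (by rw [← hl, hw]; simp)]
      exact ⟨rfl, rfl⟩

/-- In each row the right entry is smaller than the left one. Hence the right entries not yet read
inject, row by row, into the left entries not yet read. -/
lemma StandardTableau.isBallot_word (hqp : q ≤ p) : IsBallot σ.word p q := by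
  refine ⟨fun i hi => ?_, ?_⟩
  · obtain ⟨h1, h2⟩ := σ.card_lt hi
    have h3 := Finset.card_filter_add_card_filter_not (s := (Finset.univ : Finset (Fin q)))
      (fun k => (σ.entry (Sum.inr k) : ℕ) < i)
    have h4 := Finset.card_filter_add_card_filter_not (s := (Finset.univ : Finset (Fin p)))
      (fun k => (σ.entry (Sum.inl k) : ℕ) < i)
    have h5 : (Finset.univ.filter fun k => ¬ (σ.entry (Sum.inr k) : ℕ) < i).card ≤
        (Finset.univ.filter fun k => ¬ (σ.entry (Sum.inl k) : ℕ) < i).card := by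
      refine Finset.card_le_card_of_injOn (Fin.castLE hqp) (fun k hk => ?_)
        (Fin.castLE_injective hqp).injOn
      have := σ.row_anti (Fin.castLE hqp k) k rfl
      simp only [Finset.coe_filter, Finset.mem_univ, true_and, Set.mem_ofPred_eq] at hk ⊢
      rw [Fin.lt_def] at this
      omega
    rw [Finset.card_univ, Fintype.card_fin] at h3 h4
    unfold height
    omega
  · rw [(σ.card_lt le_rfl).1, Finset.filter_true_of_mem fun k _ => (σ.entry (Sum.inr k)).2,
      Finset.card_univ, Fintype.card_fin]

end Tableau

/-! ### The closures of the strata -/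

section Component

variable {K : Type*} [Field K] {p q : ℕ} {e : Module.Basis (Fin p ⊕ Fin q) K (Fin (p + q) → K)}
  {N : (Fin (p + q) → K) →ₗ[K] (Fin (p + q) → K)}

lemma mem_flagVariety_iff {n : ℕ} {F : GrProd K n n} :
    F ∈ flagVariety K n ↔ ∀ i < n, F.flag i ≤ F.flag (i + 1) := by
  constructor
  · intro h i hi
    cases i with
    | zero => exact bot_le
    | succ i =>
      rw [F.flag_succ hi, F.flag_succ (by omega)]
      exact h _ _ (Fin.mk_le_mk.2 (Nat.le_succ i))
  · intro h i j hij
    have key : ∀ d, (i : ℕ) + 1 + d ≤ n → F.flag (i + 1) ≤ F.flag (i + 1 + d) := by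
      intro d
      induction d with
      | zero => exact fun _ => le_rfl
      | succ d ih => exact fun hd => (ih (by omega)).trans (h _ (by omega))
    have hij' : (i : ℕ) ≤ j := hij
    have := key (j - i) (by omega)
    rwa [show (i : ℕ) + 1 + (j - i) = j + 1 by omega, F.flag_succ i.2, F.flag_succ j.2] at this

/-- The summands `0` give the condition the shape of the inductions over a starting position `r`,
here at `r = 0`. -/
lemma mem_stratum_iff (σ : StandardTableau p q) {F : GrProd K (p + q) (p + q)} :
    F ∈ stratum K e σ ↔ (∀ i < p + q, F.flag i ≤ F.flag (i + 1)) ∧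
      InStratumOver K (List.ofFn fun i : Fin (p + q) => letterColumn (σ.word (0 + i)))
        (fun i => chainL e (numLeft σ.word 0 + i)) (chainR e) (F.flag 0)
        (fun i => F.flag (0 + 1 + i)) := by
  refine (and_congr_left' mem_flagVariety_iff).trans (and_congr_right fun hF => ?_)
  have hmono : ∀ i, F.flag (i + 1) ≤ F.flag (i + 1 + 1) := by
    intro i
    by_cases hi : i + 1 < p + q
    · exact hF _ hi
    · rw [show F.flag (i + 1 + 1) = ⊤ from dif_neg hi]
      exact le_top
  have hker : LinearMap.ker (LinearMap.id : (Fin (p + q) → K) →ₗ[K] _) = ⊥ := LinearMap.ker_id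
  have h := inStratum_iff_inStratumOver (List.ofFn σ.column) (Fin (p + q) → K) LinearMap.id
    Function.surjective_id (chainL e) (chainR e) (fun i => F.flag (i + 1))
    (fun i => by rw [hker]; exact bot_le) hmono
  simp only [Submodule.map_id, LinearMap.id_apply, hker] at h
  simp only [zero_add, σ.letterColumn_word, numLeft, add_comm 1]
  exact h

lemma isSecondChain_chainR (hN : IsShift e N) {w : ℕ → Bool} {G : ℕ → Submodule K (Fin (p + q) → K)} :
    IsSecondChain N q w G 0 (chainR e) := by
  refine ⟨fun _ => ?_, fun i hi => hN.apply_chainR (by simpa [numRight] using hi)⟩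
  have h := hN.apply_mem_coordSub (chainR_mem (e := e) (a := 0) Nat.zero_lt_one)
  rw [Nat.zero_sub, coordSub_zero_zero, Submodule.mem_bot] at h
  rw [h]
  exact Submodule.zero_mem _

lemma stratum_subset_matchedFlags (hN : IsShift e N) (hqp : q ≤ p) (σ : StandardTableau p q) :
    stratum K e σ ⊆ matchedFlags e N σ.word (p + q) := by
  intro F hF
  refine isMatched_of_inStratumOver hN (σ.isBallot_word hqp) (fun i hi => F.finrank_flag hi) (p + q)
    0 (chainR e) (zero_add _) (IsMatched.zero rfl) (fun i hi => ?_) (isSecondChain_chainR hN)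
    ((mem_stratum_iff σ).1 hF).2
  obtain rfl : i = 0 := by omega
  rw [numLeft, coordSub_zero_zero]
  exact bot_le

/-- The flags which avoid the vectors of the first chain as long as possible. -/
def genericFlags (e : Module.Basis (Fin p ⊕ Fin q) K (Fin (p + q) → K)) (w : ℕ → Bool) :
    Set (GrProd K (p + q) (p + q)) :=
  {F | ∀ i ≤ p + q, numLeft w i < p → chainL e (numLeft w i) ∉ F.flag i}

lemma isOpen_genericFlags (w : ℕ → Bool) :
    @IsOpen _ (zariski K (GrProd K (p + q) (p + q))) (genericFlags e w) := by
  let _ := zariski K (GrProd K (p + q) (p + q))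
  have : genericFlags e w = ⋂ i ∈ {i | i ≤ p + q ∧ numLeft w i < p},
      {F | chainL e (numLeft w i) ∉ F.flag i} := by
    ext F
    simp only [Set.mem_iInter]
    exact ⟨fun h i hi => h i hi.1 hi.2, fun h i h1 h2 => h i ⟨h1, h2⟩⟩
  rw [this]
  refine Set.Finite.isOpen_biInter ((Set.finite_Iic (p + q)).subset fun i hi => hi.1) fun i hi => ?_
  exact (GrProd.hasLocalLifts_member hi.1).isOpen_preimage
    (Gr.isOpen_notMem i (chainL e (numLeft w i)))

/-- Together with compatibility of `w` with itself, this gives a generic matched flag, so that the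
open condition is not empty on the matched flags. -/
lemma coordFlag_mem_genericFlags {w : ℕ → Bool} (hw : numRight w (p + q) = q) :
    coordFlag e hw ∈ genericFlags e w := by
  intro i hi hlt h
  rw [flag_coordFlag hw hi] at h
  exact lt_irrefl _ (lt_of_chainL_mem hlt h)

lemma matchedFlags_inter_genericFlags_subset (hN : IsShift e N) (hqp : q ≤ p)
    (σ : StandardTableau p q) :
    matchedFlags e N σ.word (p + q) ∩ genericFlags e σ.word ⊆ stratum K e σ := by
  rintro F ⟨hF, hgen⟩
  refine (mem_stratum_iff σ).2 ⟨hF.mono, ?_⟩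
  refine inStratumOver_of_isMatched hN (σ.isBallot_word hqp) (fun i hi => F.finrank_flag hi) hF hgen
    (p + q) 0 (chainR e) (zero_add _) (isSecondChain_chainR hN) fun i => ?_
  rw [numRight, zero_add, sub_self]
  exact Submodule.zero_mem _

lemma isIrreducible_matchedFlags [Infinite K] (hN : IsShift e N) (hqp : q ≤ p) {w : ℕ → Bool}
    (hw : IsBallot w p q) :
    @IsIrreducible _ (zariski K (GrProd K (p + q) (p + q))) (matchedFlags e N w (p + q)) := by
  have := (isZariskiIrreducible_matchedFlags hN hqp hw le_rfl).isIrreducible_range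
    (HasLocalLifts.val (K := K) _)
  rwa [Subtype.range_val] at this

/-- The closure of a stratum is the set of flags matched to its word. -/
theorem component_eq_matchedFlags [Infinite K] (hN : IsShift e N) (hqp : q ≤ p)
    (σ : StandardTableau p q) : component K e σ = matchedFlags e N σ.word (p + q) := by
  let _ := zariski K (GrProd K (p + q) (p + q))
  have hw := σ.isBallot_word hqp
  refine (closure_minimal (stratum_subset_matchedFlags hN hqp σ)
    (isClosed_matchedFlags _)).antisymm ?_
  -- A nonempty open part of an irreducible set is dense in it, and the generic part lies in the
  -- stratum.
  refine (subset_closure_inter_of_isPreirreducible_of_isOpen (isIrreducible_matchedFlags hN hqp hw).2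
    (isOpen_genericFlags σ.word) ⟨coordFlag e hw.numRight_eq, ?_⟩).trans
    (closure_mono (matchedFlags_inter_genericFlags_subset hN hqp σ))
  exact ⟨(coordFlag_mem_matchedFlags_iff hN _).2 (IsCompatible.refl _ _),
    coordFlag_mem_genericFlags _⟩

theorem componentImage_eq_matchedFlags [Infinite K] (hN : IsShift e N) (hqp : q ≤ p)
    (σ : StandardTableau p q) {r : ℕ} (hr : r ≤ p + q) :
    componentImage K e σ r hr = matchedFlags e N σ.word r := by
  rw [componentImage, component_eq_matchedFlags hN hqp]
  refine Set.Subset.antisymm ?_ fun F hF => ?_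
  · rintro _ ⟨F, hF, rfl⟩
    exact trunc_mem_matchedFlags_of_le hr hF
  · exact exists_prolongation_matchedFlags hN hqp (σ.isBallot_word hqp) hr le_rfl hF

/-! ### The Springer fiber -/

/-- Invariance under `x` and under `x - 1` agree, and a nilpotent map acts as zero on the
one-dimensional successive quotients of an invariant flag. -/
lemma mem_springerFiber_iff (hqp : q ≤ p) {x : Matrix.SpecialLinearGroup (Fin (p + q)) K}
    (hN : IsShift e (Matrix.toLin' ((x : Matrix (Fin (p + q)) (Fin (p + q)) K) - 1)))
    {F : GrProd K (p + q) (p + q)} : F ∈ springerFiber K x ↔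
      (∀ i < p + q, F.flag i ≤ F.flag (i + 1)) ∧ ∀ i < p + q, F.flag (i + 1) ≤ (F.flag i).comap
        (Matrix.toLin' ((x : Matrix (Fin (p + q)) (Fin (p + q)) K) - 1)) := by
  refine (and_congr_left' mem_flagVariety_iff).trans (and_congr_right fun hF => ?_)
  have hx : ∀ v, Matrix.toLin' (x : Matrix (Fin (p + q)) (Fin (p + q)) K) v =
      Matrix.toLin' ((x : Matrix (Fin (p + q)) (Fin (p + q)) K) - 1) v + v := by
    intro v
    rw [map_sub, Matrix.toLin'_one, LinearMap.sub_apply, LinearMap.id_apply, sub_add_cancel]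
  constructor
  · intro h i hi
    have hinv : ∀ j ≤ p + q, F.flag j ≤ (F.flag j).comap
        (Matrix.toLin' ((x : Matrix (Fin (p + q)) (Fin (p + q)) K) - 1)) := by
      intro j hj
      cases j with
      | zero => exact bot_le
      | succ j =>
        intro v hv
        rw [F.flag_succ hj] at hv ⊢
        have h1 := h ⟨j, hj⟩ ⟨v, hv, rfl⟩
        rw [hx] at h1
        have h2 := Submodule.sub_mem _ h1 hv
        rwa [add_sub_cancel_right] at h2
    exact le_comap_of_nilpotent ⟨p, hN.pow_eq_zero hqp le_rfl⟩ (F.finrank_flag hi.le)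
      (F.finrank_flag hi) (hF i hi) (hinv i hi.le) (hinv (i + 1) hi)
  · rintro h i _ ⟨v, hv, rfl⟩
    have hv' : v ∈ F.flag (i + 1) := by rw [F.flag_succ i.2]; exact hv
    have h1 := hF i i.2 (h i i.2 hv')
    rw [F.flag_succ i.2] at h1
    rw [hx]
    exact Submodule.add_mem _ h1 hv

lemma matchedFlags_congr {w w' : ℕ → Bool} {r : ℕ} (h : ∀ i < r, w i = w' i) :
    matchedFlags e N w r = matchedFlags e N w' r := by
  have key : ∀ i ≤ r, height w i = height w' i := by
    intro i hi
    induction i with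
    | zero => rfl
    | succ i ih =>
      have h1 := ih (by omega)
      have h2 := h i hi
      cases hwi : w i
      · rw [height_succ_left hwi, height_succ_left (h2 ▸ hwi), h1]
      · rw [height_succ_right hwi, height_succ_right (h2 ▸ hwi), h1]
  have hbal : ∀ i j, i ≤ j → j ≤ r → (IsBalanced w i j ↔ IsBalanced w' i j) := by
    intro i j hij hj
    refine and_congr (by rw [key i (by omega), key j hj]) (forall_congr' fun m =>
      forall_congr' fun _ => forall_congr' fun hm => ?_)
    rw [key i (by omega), key m (by omega)]
  have hlow : ∀ s ≤ r, (IsLow w s ↔ IsLow w' s) := by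
    intro s hs
    refine forall_congr' fun m => forall_congr' fun hm => ?_
    rw [key s hs, key m (by omega)]
  ext F
  constructor <;> intro hF
  · exact ⟨hF.mono, hF.nil, fun i k hi hb => hF.bal i k hi ((hbal _ _ (by omega) hi).2 hb),
      fun t u hs hl hh => hF.low t u hs ((hlow _ hs).2 hl) (by rw [key _ hs, hh])⟩
  · exact ⟨hF.mono, hF.nil, fun i k hi hb => hF.bal i k hi ((hbal _ _ (by omega) hi).1 hb),
      fun t u hs hl hh => hF.low t u hs ((hlow _ hs).1 hl) (by rw [← key _ hs, hh])⟩

/-- Only the first `r` letters of the word matter. -/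
lemma finite_range_matchedFlags (r : ℕ) :
    (Set.range fun w => matchedFlags e N w r).Finite := by
  refine (Set.finite_range fun f : Fin r → Bool =>
    matchedFlags e N (fun i => if h : i < r then f ⟨i, h⟩ else false) r).subset ?_
  rintro _ ⟨w, rfl⟩
  exact ⟨fun i => w i, matchedFlags_congr fun i hi => dif_pos hi⟩

/-- An irreducible set in the Springer fiber lies in one of the finitely many closed sets of matched
flags covering it. If it contains `Y_σ`, non-inclusion forces the word to be that of `σ`. -/
theorem maximal_component [Infinite K] (hqp : q ≤ p)
    {x : Matrix.SpecialLinearGroup (Fin (p + q)) K} (he : IsAdaptedBasis K x e)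
    (σ : StandardTableau p q) :
    Maximal (fun Z : Set (GrProd K (p + q) (p + q)) =>
        Z ⊆ springerFiber K x ∧ @IsIrreducible _ (zariski K (GrProd K (p + q) (p + q))) Z)
      (component K e σ) := by
  let _ := zariski K (GrProd K (p + q) (p + q))
  have hN := he.isShift
  have hw := σ.isBallot_word hqp
  rw [component_eq_matchedFlags hN hqp]
  refine ⟨⟨fun F hF => (mem_springerFiber_iff hqp hN).2 ⟨hF.mono, hF.nil⟩,
    isIrreducible_matchedFlags hN hqp hw⟩, ?_⟩
  rintro Z ⟨hZ, hirr⟩ hle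
  have hfin : {Z | ∃ w, IsBallot w p q ∧ matchedFlags e
      (Matrix.toLin' ((x : Matrix (Fin (p + q)) (Fin (p + q)) K) - 1)) w (p + q) = Z}.Finite :=
    (finite_range_matchedFlags (p + q)).subset fun _ ⟨w, _, h⟩ => ⟨w, h⟩
  obtain ⟨Y, hY, hZY⟩ := isIrreducible_iff_sUnion_isClosed.1 hirr hfin.toFinset (by
    intro Y hY
    obtain ⟨w, -, rfl⟩ := hfin.mem_toFinset.1 hY
    exact isClosed_matchedFlags _) (by
    intro F hF
    obtain ⟨h1, h2⟩ := (mem_springerFiber_iff hqp hN).1 (hZ hF)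
    obtain ⟨w, hw, hm⟩ := exists_isBallot_isMatched hN hqp (fun i hi => F.finrank_flag hi) h1 h2
    exact ⟨_, hfin.mem_toFinset.2 ⟨w, hw, rfl⟩, hm⟩)
  obtain ⟨w, hw', rfl⟩ := hfin.mem_toFinset.1 hY
  rw [matchedFlags_congr (hw.eq_of_matchedFlags_subset hN hw' (hle.trans hZY))]
  exact hZY

/-- The sets are kept as variables so that the descriptions of `Y_σ(r)` and `Y_σ(r + 1)` can be
substituted in the types of the maps. -/
lemma exists_varietyIso_truncMap (hN : IsShift e N) (hqp : q ≤ p) {w : ℕ → Bool}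
    (hw : IsBallot w p q) {r : ℕ} (hr : r < p + q) (hwr : w r = false)
    {Z' : Set (GrProd K (p + q) (r + 1))} {Z : Set (GrProd K (p + q) r)}
    (hZ' : Z' = matchedFlags e N w (r + 1)) (hZ : Z = matchedFlags e N w r)
    (h : ∀ F ∈ Z', GrProd.trunc K (Nat.le_succ r) F ∈ Z) :
    ∃ φ : Z' ≃ Z, IsVarietyIso K φ ∧ ⇑φ = truncMap h := by
  subst hZ' hZ
  obtain ⟨φ, h1, h2, h3⟩ := exists_equiv_matchedFlags hN hqp hw hr hwr
  exact ⟨φ, isVarietyIso_of_hasLocalLifts h1 h2, h3⟩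

lemma isLiftedProjLineBundle_truncMap_of_eq (hN : IsShift e N) (hqp : q ≤ p) {w : ℕ → Bool}
    (hw : IsBallot w p q) {r : ℕ} (hr : r < p + q) (hwr : w r = true)
    {Z' : Set (GrProd K (p + q) (r + 1))} {Z : Set (GrProd K (p + q) r)}
    (hZ' : Z' = matchedFlags e N w (r + 1)) (hZ : Z = matchedFlags e N w r)
    (h : ∀ F ∈ Z', GrProd.trunc K (Nat.le_succ r) F ∈ Z) :
    IsLiftedProjLineBundle K (truncMap h) := by
  subst hZ' hZ
  exact isLiftedProjLineBundle_matchedFlags hN hqp hw hr hwr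

end Component

theorem mainTheorem1 {K : Type*} [Field K] [IsAlgClosed K] {p q : ℕ} (hqp : q ≤ p)
    (x : Matrix.SpecialLinearGroup (Fin (p + q)) K)
    (e : Module.Basis (Fin p ⊕ Fin q) K (Fin (p + q) → K)) (he : IsAdaptedBasis K x e)
    (σ : StandardTableau p q) :
    Maximal (fun Z : Set (GrProd K (p + q) (p + q)) =>
        Z ⊆ springerFiber K x ∧ @IsIrreducible _ (zariski K (GrProd K (p + q) (p + q))) Z)
      (component K e σ) ∧
    ∀ r : Fin (p + q),
      (σ.column r = Column.left →
        (∀ z : componentImage K e σ r r.2.le,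
          ∃! y : componentImage K e σ (r + 1) r.2, componentProj K e σ r y = z) ∧
        ∃ φ : componentImage K e σ (r + 1) r.2 ≃ componentImage K e σ r r.2.le,
          IsVarietyIso K φ ∧ ⇑φ = componentProj K e σ r) ∧
      (σ.column r = Column.right →
        (∀ z : componentImage K e σ r r.2.le,
          ∃ φ : {y : componentImage K e σ (r + 1) r.2 // componentProj K e σ r y = z} ≃ ProjLine K,
            IsVarietyIso K φ) ∧
        IsProjLineBundle K (componentProj K e σ r)) := by
  have hN := he.isShift
  have hw := σ.isBallot_word hqp
  refine ⟨maximal_component hqp he σ, fun r => ⟨fun hr => ?_, fun hr => ?_⟩⟩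
  · have hwr : σ.word r = false := by
      rw [← σ.letterColumn_word] at hr
      cases h : σ.word r
      · rfl
      · rw [h] at hr; cases hr
    obtain ⟨φ, h1, h2⟩ : ∃ φ : componentImage K e σ (r + 1) r.2 ≃ componentImage K e σ r r.2.le,
        IsVarietyIso K φ ∧ ⇑φ = componentProj K e σ r :=
      exists_varietyIso_truncMap hN hqp hw r.2 hwr (componentImage_eq_matchedFlags hN hqp σ r.2)
        (componentImage_eq_matchedFlags hN hqp σ r.2.le) fun F hF => (componentProj K e σ r ⟨F, hF⟩).2
    refine ⟨fun z => ?_, φ, h1, h2⟩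
    rw [← h2]
    exact φ.bijective.existsUnique z
  · have hwr : σ.word r = true := by
      rw [← σ.letterColumn_word] at hr
      cases h : σ.word r
      · rw [h] at hr; cases hr
      · rfl
    have hbundle : IsLiftedProjLineBundle K (componentProj K e σ r) :=
      isLiftedProjLineBundle_truncMap_of_eq hN hqp hw r.2 hwr
        (componentImage_eq_matchedFlags hN hqp σ r.2)
        (componentImage_eq_matchedFlags hN hqp σ r.2.le) fun F hF => (componentProj K e σ r ⟨F, hF⟩).2
    refine ⟨fun z => ?_, hbundle.isProjLineBundle⟩
    obtain ⟨φ, h1, h2⟩ := hbundle.exists_fiber_equiv z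
    exact ⟨φ, isVarietyIso_of_hasLocalLifts h1 h2⟩
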